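/- \textbf{Setting.} Inner products $\langle\cdot,\cdot\rangle$ are linear in the first argument; $\mathbb C^\pm=\{z:\pm\operatorname{Im}z>0\}$. A linear operator $A$ with dense domain $D(A)$ in a complex Hilbert space $H$ is \emph{dissipative} if $\operatorname{Im}\langle Ah,h\rangle\ge 0$ for $h\in D(A)$, and \emph{maximal dissipative} if moreover it has no proper dissipative extension; then $\mathbb C^-\subseteq\rho(A)$ and $\mathbb C^+\subseteq\rho(A^*)$. A closed subspace $K$ is \emph{invariant} for an operator $B$ if $P_KD(B)\subseteq D(B)$ and $BP_Kh\in K$ for all $h\in D(B)$; it \emph{reduces} $B$ if $K$ and $K^\perp$ are invariant; $B|_K$ is then the operator in $K$ with domain $K\cap D(B)$. A maximal dissipative operator is \emph{completely non-selfadjoint} if it has no non-zero reducing subspace on which its restriction is selfadjoint. A selfadjoint operator $L$ on a Hilbert space containing $H$ is a \emph{selfadjoint dilation} of $A$ if $(A-z)^{-1}=P_H(L-z)^{-1}|_H$ for all $z\in\mathbb C^-$; it is \emph{minimal} if no proper reducing subspace of $L$ containing $H$ carries a restriction of $L$ that is itself a selfadjoint dilation of $A$. Let $A$ be a maximal dissipative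 operator on $H$, let $E,E_*$ be Hilbert spaces, and let $\Gamma:D(A)\to E$ and $\Gamma_*:D(A^*)\to E_*$ be linear, bounded in the graph norms of $A$ and $A^*$ respectively, with dense ranges, and such that $$\langle Au,v\rangle-\langle u,Av\rangle=i\langle\Gamma u,\Gamma v\rangle\quad(u,v\in D(A)),\qquad \langle A^*u,v\rangle-\langle u,A^*v\rangle=-i\langle\Gamma_*u,\Gamma_*v\rangle\quad(u,v\in D(A^*)).$$ For $z\in\mathbb C^+$ let $S(z):E\to E_*$ be the bounded operator with $S(z)\Gamma u=\Gamma_*(A^*-z)^{-1}(A-z)u$ for $u\in D(A)$. Fix $\mu\in\mathbb C^-$ and $\nu\in\mathbb C^+$. On $\mathcal H=L^2(\mathbb R^-,E_*)\oplus H\oplus L^2(\mathbb R^+,E)$ let $\mathcal L$ be the operator whose domain consists of all $U=(v_-,u,v_+)$ with $v_-\in H^1(\mathbb R^-,E_*)$, $v_+\in H^1(\mathbb R^+,E)$, $u+(\Gamma_*(A^*+\mu)^{-1})^*v_-(0)\in D(A)$, $u+(\Gamma(A+\nu)^{-1})^*v_+(0)\in D(A^*)$ and $$v_+(0)=S(-\mu)^*v_-(0)+i\Gamma\bigl(u+(\Gamma_*(A^*+\mu)^{-1})^*v_-(0)\bigr),$$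 $$v_-(0)=S(-\bar\nu)v_+(0)-i\Gamma_*\bigl(u+(\Gamma(A+\nu)^{-1})^*v_+(0)\bigr),$$ with the action $\mathcal LU=(iv_-',\,TU,\,iv_+')$, $TU=A^*\bigl(u+(\Gamma(A+\nu)^{-1})^*v_+(0)\bigr)+\bar\nu(\Gamma(A+\nu)^{-1})^*v_+(0)$. Put $M=\operatorname{Ran}\bigl((\Gamma(A+i)^{-1})^*\bigr)\cup\operatorname{Ran}\bigl((\Gamma_*(A^*-i)^{-1})^*\bigr)$, $$H_{cns}=\operatorname{clos}\Bigl[\operatorname{Span}_{z\in\mathbb C^-}\{(A-z)^{-1}M\}+\operatorname{Span}_{z\in\mathbb C^+}\{(A^*-z)^{-1}M\}\Bigr],\qquad H_{sa}=H\ominus H_{cns}.$$ \textbf{Theorem.} \begin{enumerate} \item $H_{cns}$ is a reducing subspace for $A$. \item $A_{sa}:=A|_{H_{sa}}$ is selfadjoint. \item $A_{cns}:=A|_{H_{cns}}$ is a completely non-selfadjoint (maximal dissipative) operator. \item $0\oplus H_{sa}\oplus0$ is a reducing subspace for $\mathcal L$, and $\mathcal L$ restricted to it is $A_{sa}$: for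 $w\in H_{sa}$ one has $(0,w,0)\in D(\mathcal L)$ if and only if $w\in D(A)$, and then $\mathcal L(0,w,0)=(0,Aw,0)$. \item The closed linear span of the spaces $(\mathcal L-z)^{-1}\bigl(L^2(\mathbb R^-,E_*)\oplus0\oplus L^2(\mathbb R^+,E)\bigr)$, $z\in\mathbb C\setminus\mathbb R$, equals $\mathcal H\ominus(0\oplus H_{sa}\oplus0)=L^2(\mathbb R^-,E_*)\oplus H_{cns}\oplus L^2(\mathbb R^+,E)$. \item $\mathcal L$ restricted to $L^2(\mathbb R^-,E_*)\oplus H_{cns}\oplus L^2(\mathbb R^+,E)$ is a minimal selfadjoint dilation of $A_{cns}$, where $H_{cns}$ is embedded by $w\mapsto(0,w,0)$. \end{enumerate} -/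

import Mathlib

open MeasureTheory Set

set_option linter.unusedSectionVars false

noncomputable section

namespace DissipativeDilation

section Aux

variable {M N : Type*} [AddCommGroup M] [Module ℂ M] [AddCommGroup N] [Module ℂ N]

lemma map_mk_zero {S : Submodule ℂ M} (f : S →ₗ[ℂ] N) {a : M} (ha : a ∈ S) (h : a = 0) :
    f ⟨a, ha⟩ = 0 := by
  subst h; exact map_zero f

lemma map_mk_add {S : Submodule ℂ M} (f : S →ₗ[ℂ] N) {a b c : M} (ha : a ∈ S) (hb : b ∈ S)
    (hc : c ∈ S) (h : c = a + b) : f ⟨c, hc⟩ = f ⟨a, ha⟩ + f ⟨b, hb⟩ := by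
  subst h; exact map_add f ⟨a, ha⟩ ⟨b, hb⟩

lemma map_mk_smul {S : Submodule ℂ M} (f : S →ₗ[ℂ] N) (k : ℂ) {a c : M} (ha : a ∈ S)
    (hc : c ∈ S) (h : c = k • a) : f ⟨c, hc⟩ = k • f ⟨a, ha⟩ := by
  subst h; exact map_smul f k ⟨a, ha⟩

end Aux

/-! ### Unbounded operators on a Hilbert space -/

section Operators

variable {H : Type*} [NormedAddCommGroup H] [InnerProductSpace ℂ H]

/-- `A` is densely defined and `Im ⟨A h, h⟩ ≥ 0` on its domain.
(Mathlib's inner product is linear in the second variable.) -/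
def IsDissipative (A : H →ₗ.[ℂ] H) : Prop :=
  Dense (A.domain : Set H) ∧ ∀ h : A.domain, 0 ≤ (inner ℂ (h : H) (A h)).im

/-- Maximal dissipative operator: dissipative, without non-trivial dissipative extensions. -/
def IsMaximalDissipative (A : H →ₗ.[ℂ] H) : Prop :=
  IsDissipative A ∧ ∀ B : H →ₗ.[ℂ] H, IsDissipative B → A ≤ B → B = A

/-- `R` is the bounded everywhere defined inverse of `A - z`. -/
def IsResolventAt (A : H →ₗ.[ℂ] H) (z : ℂ) (R : H →L[ℂ] H) : Prop :=
  (∀ f : H, ∃ u : A.domain, (u : H) = R f ∧ A u - z • (u : H) = f) ∧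
    ∀ u : A.domain, R (A u - z • (u : H)) = u

open Classical in
/-- The resolvent `(A - z)⁻¹` (zero if `z` is not in the resolvent set). -/
def resolventOp (A : H →ₗ.[ℂ] H) (z : ℂ) : H →L[ℂ] H :=
  if h : ∃ R, IsResolventAt A z R then h.choose else 0

/-- `K` is invariant for `A`: `P_K D(A) ⊆ D(A)` and `A P_K h ∈ K` for all `h ∈ D(A)`. -/
def IsInvariantFor (A : H →ₗ.[ℂ] H) (K : Submodule ℂ H) [K.HasOrthogonalProjection] : Prop :=
  ∀ h : A.domain, ∃ hp : K.starProjection (h : H) ∈ A.domain, A ⟨K.starProjection (h : H), hp⟩ ∈ K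

/-- `K` reduces `A`: both `K` and its orthogonal complement are invariant for `A`. -/
def IsReducingFor (A : H →ₗ.[ℂ] H) (K : Submodule ℂ H) [K.HasOrthogonalProjection] : Prop :=
  IsInvariantFor A K ∧ IsInvariantFor A Kᗮ

/-- The restriction of `A` to `K`, as an operator in `K`, with domain `{x ∈ K ∩ D(A) | A x ∈ K}`.
If `K` is invariant for `A`, the domain is `K ∩ D(A)`. -/
def restrictTo (A : H →ₗ.[ℂ] H) (K : Submodule ℂ H) : K →ₗ.[ℂ] K where
  domain :=
    { carrier := {x | ∃ hx : (x : H) ∈ A.domain, A ⟨x, hx⟩ ∈ K}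
      zero_mem' := ⟨A.domain.zero_mem, by
        have h : (⟨((0 : K) : H), A.domain.zero_mem⟩ : A.domain) = 0 := rfl
        rw [h, A.map_zero]; exact K.zero_mem⟩
      add_mem' := by
        rintro x y ⟨hx, hx'⟩ ⟨hy, hy'⟩
        refine ⟨A.domain.add_mem hx hy, ?_⟩
        have h := A.map_add ⟨x, hx⟩ ⟨y, hy⟩
        exact h ▸ K.add_mem hx' hy'
      smul_mem' := by
        rintro c x ⟨hx, hx'⟩
        refine ⟨A.domain.smul_mem c hx, ?_⟩
        have h := A.map_smul c ⟨x, hx⟩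
        exact h ▸ K.smul_mem c hx' }
  toFun :=
    { toFun := fun x => ⟨A ⟨(x : K), x.2.choose⟩, x.2.choose_spec⟩
      map_add' := fun x y => Subtype.ext (A.map_add ⟨(x : K), x.2.choose⟩ ⟨(y : K), y.2.choose⟩)
      map_smul' := fun c x => Subtype.ext (A.map_smul c ⟨(x : K), x.2.choose⟩) }

/-- `A` is a completely non-selfadjoint maximal dissipative operator: no non-zero closed reducing
subspace carries a selfadjoint restriction of `A`. -/
def IsCompletelyNonSelfadjoint (A : H →ₗ.[ℂ] H) : Prop :=
  IsMaximalDissipative A ∧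
    ∀ (K : Submodule ℂ H) [CompleteSpace K],
      IsReducingFor A K → IsSelfAdjoint (restrictTo A K) → K = ⊥

variable {𝓚 : Type*} [NormedAddCommGroup 𝓚] [InnerProductSpace ℂ 𝓚] [CompleteSpace 𝓚]

/-- `L` is a selfadjoint dilation of `A`, where `H` is regarded as a subspace of `𝓚` through the
isometry `J`: `L` is selfadjoint and `(A - z)⁻¹ = P_H (L - z)⁻¹ |_H` for all `z` in the open lower
half-plane. The adjoint of `J` is the orthogonal projection onto `H`. -/
def IsSelfadjointDilation [CompleteSpace H] (A : H →ₗ.[ℂ] H) (L : 𝓚 →ₗ.[ℂ] 𝓚)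
    (J : H →ₗᵢ[ℂ] 𝓚) : Prop :=
  IsSelfAdjoint L ∧ ∀ z : ℂ, z.im < 0 →
    IsResolventAt A z
      (J.toContinuousLinearMap.adjoint ∘L resolventOp L z ∘L J.toContinuousLinearMap)

/-- A selfadjoint dilation is minimal if the only reducing subspace `K ⊇ H` of `L` such that the
restriction of `L` to `K` is itself a selfadjoint dilation of `A` is the whole space. -/
def IsMinimalSelfadjointDilation [CompleteSpace H] (A : H →ₗ.[ℂ] H) (L : 𝓚 →ₗ.[ℂ] 𝓚)
    (J : H →ₗᵢ[ℂ] 𝓚) : Prop :=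
  IsSelfadjointDilation A L J ∧
    ∀ (K : Submodule ℂ 𝓚) [CompleteSpace K] (hK : ∀ h : H, J h ∈ K),
      IsReducingFor L K →
      IsSelfadjointDilation A (restrictTo L K)
        ⟨J.toLinearMap.codRestrict K hK, fun h => J.norm_map h⟩ →
      K = ⊤

end Operators

/-! ### Boundary operators and the characteristic function -/

section Boundary

variable {H : Type*} [NormedAddCommGroup H] [InnerProductSpace ℂ H]
variable {E : Type*} [NormedAddCommGroup E] [InnerProductSpace ℂ E]
variable {Es : Type*} [NormedAddCommGroup Es] [InnerProductSpace ℂ Es]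

/-- `Γ : D(B) → E` is bounded in the graph norm of `B`, has dense range, and satisfies the Lagrange
identity `⟨B u, v⟩ - ⟨u, B v⟩ = c ⟨Γ u, Γ v⟩`, the inner products being linear in the first
variable. It is used with `B = A`, `c = i` and with `B = A*`, `c = -i`. -/
structure IsLagrangeMap (B : H →ₗ.[ℂ] H) (Γ : B.domain →ₗ[ℂ] E) (c : ℂ) : Prop where
  bounded : ∃ C : ℝ, ∀ u : B.domain, ‖Γ u‖ ≤ C * (‖(u : H)‖ + ‖B u‖)
  dense_range : DenseRange Γ
  lagrange : ∀ u v : B.domain,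
    inner ℂ (v : H) (B u) - inner ℂ (B v) (u : H) = c * inner ℂ (Γ v) (Γ u)

open Classical in
/-- The bounded operator `Γ (B - z)⁻¹ : H → E`. -/
def compResolvent (B : H →ₗ.[ℂ] H) (Γ : B.domain →ₗ[ℂ] E) (z : ℂ) : H →L[ℂ] E :=
  if h : ∃ G : H →L[ℂ] E, ∀ f : H, ∃ u : B.domain, (u : H) = resolventOp B z f ∧ G f = Γ u
  then h.choose else 0

open Classical in
/-- The Štraus characteristic function `S(z) : E → E_*`: the bounded operator with
`S(z) Γ u = Γ_* (A* - z)⁻¹ (A - z) u` for all `u ∈ D(A)`. -/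
def strausFunction [CompleteSpace H] (A : H →ₗ.[ℂ] H) (Γ : A.domain →ₗ[ℂ] E)
    (Γs : A.adjoint.domain →ₗ[ℂ] Es) (z : ℂ) : E →L[ℂ] Es :=
  if h : ∃ S : E →L[ℂ] Es, ∀ u : A.domain,
      S (Γ u) = compResolvent A.adjoint Γs z (A u - z • (u : H))
  then h.choose else 0

variable [CompleteSpace H] [CompleteSpace E] [CompleteSpace Es]

/-- `Ran (Γ (A + i)⁻¹)* ∪ Ran (Γ_* (A* - i)⁻¹)*`. -/
def generatingSet (A : H →ₗ.[ℂ] H) (Γ : A.domain →ₗ[ℂ] E) (Γs : A.adjoint.domain →ₗ[ℂ] Es) :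
    Set H :=
  range (compResolvent A Γ (-Complex.I)).adjoint ∪
    range (compResolvent A.adjoint Γs Complex.I).adjoint

/-- The subspace `H_cns`. Its orthogonal complement is `H_sa`. -/
def Hcns (A : H →ₗ.[ℂ] H) (Γ : A.domain →ₗ[ℂ] E) (Γs : A.adjoint.domain →ₗ[ℂ] Es) :
    Submodule ℂ H :=
  (Submodule.span ℂ (⋃ z ∈ {z : ℂ | z.im < 0}, resolventOp A z '' generatingSet A Γ Γs) ⊔
    Submodule.span ℂ
      (⋃ z ∈ {z : ℂ | 0 < z.im}, resolventOp A.adjoint z '' generatingSet A Γ Γs)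
    ).topologicalClosure

instance (A : H →ₗ.[ℂ] H) (Γ : A.domain →ₗ[ℂ] E) (Γs : A.adjoint.domain →ₗ[ℂ] Es) :
    CompleteSpace (Hcns A Γ Γs) :=
  inferInstanceAs (CompleteSpace (Submodule.topologicalClosure _))

end Boundary

/-! ### The space `H¹` of a half-line with values in a Hilbert space -/

section Sobolev

variable {F : Type*} [NormedAddCommGroup F] [InnerProductSpace ℂ F] [CompleteSpace F]

/-- `L²(s, F)`. -/
abbrev L2On (s : Set ℝ) (F : Type*) [NormedAddCommGroup F] : Type _ :=
  Lp F 2 (volume.restrict s)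

/-- `v(x) = c + ∫₀ˣ w` for almost every `x ∈ s`. For a half-line `s` with endpoint `0` this says
that `v` has a locally absolutely continuous representative on the closure of `s` with value `c`
at `0` and derivative `w`. -/
def HasDerivTrace (s : Set ℝ) (v w : L2On s F) (c : F) : Prop :=
  ∀ᵐ x ∂volume.restrict s, v x = c + ∫ t in (0 : ℝ)..x, w t ∂volume.restrict s

lemma locallyIntegrable_restrict (s : Set ℝ) (w : L2On s F) :
    LocallyIntegrable w (volume.restrict s) :=
  (Lp.memLp w).locallyIntegrable (by norm_num)

lemma intervalIntegrable_restrict (s : Set ℝ) (w : L2On s F) (a b : ℝ) :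
    IntervalIntegrable w (volume.restrict s) a b :=
  intervalIntegrable_iff.mpr
    (((locallyIntegrable_restrict s w).integrableOn_isCompact isCompact_uIcc).mono_set
      uIoc_subset_uIcc)

lemma HasDerivTrace.add {s : Set ℝ} {v w v' w' : L2On s F} {c c' : F}
    (h : HasDerivTrace s v w c) (h' : HasDerivTrace s v' w' c') :
    HasDerivTrace s (v + v') (w + w') (c + c') := by
  have hw : ∀ x : ℝ, ∫ t in (0 : ℝ)..x, (w + w' : L2On s F) t ∂volume.restrict s =
      (∫ t in (0 : ℝ)..x, w t ∂volume.restrict s) + ∫ t in (0 : ℝ)..x, w' t ∂volume.restrict s := by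
    intro x
    rw [← intervalIntegral.integral_add (intervalIntegrable_restrict s w 0 x)
      (intervalIntegrable_restrict s w' 0 x)]
    exact intervalIntegral.integral_congr_ae ((Lp.coeFn_add w w').mono fun t ht _ => ht)
  filter_upwards [h, h', Lp.coeFn_add v v'] with x h1 h2 h3
  rw [h3, Pi.add_apply, h1, h2, hw]
  abel

lemma HasDerivTrace.smul {s : Set ℝ} {v w : L2On s F} {c : F} (a : ℂ)
    (h : HasDerivTrace s v w c) : HasDerivTrace s (a • v) (a • w) (a • c) := by
  have hw : ∀ x : ℝ, ∫ t in (0 : ℝ)..x, (a • w : L2On s F) t ∂volume.restrict s =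
      a • ∫ t in (0 : ℝ)..x, w t ∂volume.restrict s := by
    intro x
    rw [← intervalIntegral.integral_smul]
    exact intervalIntegral.integral_congr_ae ((Lp.coeFn_smul a w).mono fun t ht _ => ht)
  filter_upwards [h, Lp.coeFn_smul a v] with x h1 h3
  rw [h3, Pi.smul_apply, h1, hw, smul_add]

lemma HasDerivTrace.zero (s : Set ℝ) : HasDerivTrace s (0 : L2On s F) 0 0 := by
  have hw : ∀ x : ℝ, ∫ t in (0 : ℝ)..x, (0 : L2On s F) t ∂volume.restrict s = 0 := by
    intro x
    rw [intervalIntegral.integral_congr_ae (g := fun _ => (0 : F))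
      ((Lp.coeFn_zero F 2 (volume.restrict s)).mono fun t ht _ => ht)]
    simp
  filter_upwards [Lp.coeFn_zero F 2 (volume.restrict s)] with x h1
  rw [h1, hw]; simp

lemma HasDerivTrace.eq_zero {s : Set ℝ} (hs : IsOpen s) (h0 : (0 : ℝ) ∈ closure s)
    {w : L2On s F} {c : F} (h : HasDerivTrace s 0 w c) : w = 0 ∧ c = 0 := by
  set g : ℝ → F := s.indicator w with hg
  have hgl : LocallyIntegrable g volume :=
    ((memLp_indicator_iff_restrict hs.measurableSet).mpr (Lp.memLp w)).locallyIntegrable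
      (by norm_num)
  have hI : ∀ x : ℝ, ∫ t in (0 : ℝ)..x, w t ∂volume.restrict s = ∫ t in (0 : ℝ)..x, g t := by
    intro x
    simp only [intervalIntegral, hg, Measure.restrict_restrict measurableSet_Ioc,
      setIntegral_indicator hs.measurableSet]
  have hgi : ∀ a b : ℝ, IntervalIntegrable g volume a b := fun a b =>
    intervalIntegrable_iff.mpr
      ((hgl.integrableOn_isCompact isCompact_uIcc).mono_set uIoc_subset_uIcc)
  have hcont : Continuous fun x : ℝ => c + ∫ t in (0 : ℝ)..x, g t :=
    continuous_const.add (intervalIntegral.continuous_primitive hgi 0)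
  have hae : ∀ᵐ x ∂volume.restrict s, c + ∫ t in (0 : ℝ)..x, g t = 0 := by
    filter_upwards [h, Lp.coeFn_zero F 2 (volume.restrict s)] with x h1 h2
    rw [← hI, ← h1, h2, Pi.zero_apply]
  have hzero : ∀ x ∈ s, c + ∫ t in (0 : ℝ)..x, g t = 0 := by
    have := Measure.eqOn_open_of_ae_eq (μ := volume) (f := fun x : ℝ => c + ∫ t in (0 : ℝ)..x, g t)
      (g := fun _ => (0 : F)) hae hs hcont.continuousOn continuousOn_const
    exact fun x hx => this hx
  have hclos : closure s ⊆ {x : ℝ | c + ∫ t in (0 : ℝ)..x, g t = 0} :=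
    closure_minimal hzero (isClosed_eq hcont continuous_const)
  have hc : c = 0 := by simpa using hclos h0
  refine ⟨?_, hc⟩
  rw [Lp.eq_zero_iff_ae_eq_zero]
  have hd := ae_restrict_of_ae (s := s) (LocallyIntegrable.ae_hasDerivAt_integral hgl)
  filter_upwards [hd, ae_restrict_mem hs.measurableSet] with x hx hxs
  have h1 : HasDerivAt (fun y : ℝ => ∫ t in (0 : ℝ)..y, g t) 0 x := by
    refine (hasDerivAt_const x (0 : F)).congr_of_eventuallyEq ?_
    filter_upwards [hs.mem_nhds hxs] with y hy
    simpa [hc] using hzero y hy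
  have h2 := (hx 0).unique h1
  simpa [hg, indicator_of_mem hxs] using h2

/-- `H¹(s, F)` for an open half-line `s` with endpoint `0`. -/
def H1On (s : Set ℝ) (F : Type*) [NormedAddCommGroup F] [InnerProductSpace ℂ F]
    [CompleteSpace F] : Submodule ℂ (L2On s F) where
  carrier := {v | ∃ w c, HasDerivTrace s v w c}
  zero_mem' := ⟨0, 0, HasDerivTrace.zero s⟩
  add_mem' := by
    rintro v v' ⟨w, c, h⟩ ⟨w', c', h'⟩
    exact ⟨w + w', c + c', h.add h'⟩
  smul_mem' := by
    rintro a v ⟨w, c, h⟩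
    exact ⟨a • w, a • c, h.smul a⟩

lemma HasDerivTrace.unique {s : Set ℝ} (hs : IsOpen s) (h0 : (0 : ℝ) ∈ closure s)
    {v w w' : L2On s F} {c c' : F} (h : HasDerivTrace s v w c) (h' : HasDerivTrace s v w' c') :
    w = w' ∧ c = c' := by
  have h1 := h.add (h'.smul (-1))
  rw [neg_one_smul, neg_one_smul, neg_one_smul, add_neg_cancel] at h1
  obtain ⟨h2, h3⟩ := h1.eq_zero hs h0
  exact ⟨add_neg_eq_zero.mp h2, add_neg_eq_zero.mp h3⟩

/-- The derivative `v'` of `v ∈ H¹(s, F)`. -/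
def H1On.deriv {s : Set ℝ} (hs : IsOpen s) (h0 : (0 : ℝ) ∈ closure s) :
    H1On s F →ₗ[ℂ] L2On s F where
  toFun v := v.2.choose
  map_add' v v' := ((v + v').2.choose_spec.choose_spec.unique hs h0
    (v.2.choose_spec.choose_spec.add v'.2.choose_spec.choose_spec)).1
  map_smul' a v := ((a • v).2.choose_spec.choose_spec.unique hs h0
    (v.2.choose_spec.choose_spec.smul a)).1

/-- The value `v(0)` of `v ∈ H¹(s, F)` at the endpoint `0`. -/
def H1On.trace {s : Set ℝ} (hs : IsOpen s) (h0 : (0 : ℝ) ∈ closure s) :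
    H1On s F →ₗ[ℂ] F where
  toFun v := v.2.choose_spec.choose
  map_add' v v' := ((v + v').2.choose_spec.choose_spec.unique hs h0
    (v.2.choose_spec.choose_spec.add v'.2.choose_spec.choose_spec)).2
  map_smul' a v := ((a • v).2.choose_spec.choose_spec.unique hs h0
    (v.2.choose_spec.choose_spec.smul a)).2

lemma zero_mem_closure_Ioi : (0 : ℝ) ∈ closure (Ioi (0 : ℝ)) := by simp

lemma zero_mem_closure_Iio : (0 : ℝ) ∈ closure (Iio (0 : ℝ)) := by simp

/-- Derivative on `H¹(ℝ⁺, F)`. -/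
abbrev derivPos : H1On (Ioi 0) F →ₗ[ℂ] L2On (Ioi 0) F :=
  H1On.deriv isOpen_Ioi zero_mem_closure_Ioi

/-- Value at `0` on `H¹(ℝ⁺, F)`. -/
abbrev tracePos : H1On (Ioi 0) F →ₗ[ℂ] F := H1On.trace isOpen_Ioi zero_mem_closure_Ioi

/-- Derivative on `H¹(ℝ⁻, F)`. -/
abbrev derivNeg : H1On (Iio 0) F →ₗ[ℂ] L2On (Iio 0) F :=
  H1On.deriv isOpen_Iio zero_mem_closure_Iio

/-- Value at `0` on `H¹(ℝ⁻, F)`. -/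
abbrev traceNeg : H1On (Iio 0) F →ₗ[ℂ] F := H1On.trace isOpen_Iio zero_mem_closure_Iio

end Sobolev

/-! ### The dilation -/

section Dilation

/-- The Hilbert space `L²(ℝ⁻, E_*) ⊕ H ⊕ L²(ℝ⁺, E)`. -/
abbrev DilationSpace (H E Es : Type*) [NormedAddCommGroup H] [InnerProductSpace ℂ H]
    [NormedAddCommGroup E] [InnerProductSpace ℂ E]
    [NormedAddCommGroup Es] [InnerProductSpace ℂ Es] : Type _ :=
  WithLp 2 (L2On (Iio 0) Es × WithLp 2 (H × L2On (Ioi 0) E))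

variable {H : Type*} [NormedAddCommGroup H] [InnerProductSpace ℂ H]
variable {E : Type*} [NormedAddCommGroup E] [InnerProductSpace ℂ E]
variable {Es : Type*} [NormedAddCommGroup Es] [InnerProductSpace ℂ Es]

/-- The column vector `(v₋, u, v₊)`. -/
def column (vm : L2On (Iio 0) Es) (u : H) (vp : L2On (Ioi 0) E) : DilationSpace H E Es :=
  WithLp.toLp 2 (vm, WithLp.toLp 2 (u, vp))

/-- The component `v₋` of `U = (v₋, u, v₊)`. -/
abbrev compNeg (U : DilationSpace H E Es) : L2On (Iio 0) Es := U.fst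

/-- The component `u` of `U = (v₋, u, v₊)`. -/
abbrev compMid (U : DilationSpace H E Es) : H := U.snd.fst

/-- The component `v₊` of `U = (v₋, u, v₊)`. -/
abbrev compPos (U : DilationSpace H E Es) : L2On (Ioi 0) E := U.snd.snd

lemma column_congr {vm vm' : L2On (Iio 0) Es} {u u' : H} {vp vp' : L2On (Ioi 0) E}
    (h1 : vm = vm') (h2 : u = u') (h3 : vp = vp') : column vm u vp = column vm' u' vp' := by
  rw [h1, h2, h3]

lemma column_add (vm vm' : L2On (Iio 0) Es) (u u' : H) (vp vp' : L2On (Ioi 0) E) :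
    column (vm + vm') (u + u') (vp + vp') = column vm u vp + column vm' u' vp' := rfl

lemma column_smul (c : ℂ) (vm : L2On (Iio 0) Es) (u : H) (vp : L2On (Ioi 0) E) :
    column (c • vm) (c • u) (c • vp) = c • column vm u vp := rfl

/-- The subspace `P ⊕ Q ⊕ R` of `L²(ℝ⁻, E_*) ⊕ H ⊕ L²(ℝ⁺, E)`. -/
def sumSubspace (P : Submodule ℂ (L2On (Iio 0) Es)) (Q : Submodule ℂ H)
    (R : Submodule ℂ (L2On (Ioi 0) E)) : Submodule ℂ (DilationSpace H E Es) where
  carrier := {U | compNeg U ∈ P ∧ compMid U ∈ Q ∧ compPos U ∈ R}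
  zero_mem' := ⟨P.zero_mem, Q.zero_mem, R.zero_mem⟩
  add_mem' hU hV := ⟨P.add_mem hU.1 hV.1, Q.add_mem hU.2.1 hV.2.1, R.add_mem hU.2.2 hV.2.2⟩
  smul_mem' c _ hU := ⟨P.smul_mem c hU.1, Q.smul_mem c hU.2.1, R.smul_mem c hU.2.2⟩

lemma completeSpace_sumSubspace [CompleteSpace H] [CompleteSpace E] [CompleteSpace Es]
    (P : Submodule ℂ (L2On (Iio 0) Es)) (Q : Submodule ℂ H) (R : Submodule ℂ (L2On (Ioi 0) E))
    (h1 : IsClosed (P : Set (L2On (Iio 0) Es))) (h2 : IsClosed (Q : Set H))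
    (h3 : IsClosed (R : Set (L2On (Ioi 0) E))) : CompleteSpace (sumSubspace P Q R) := by
  have hm : Continuous fun U : DilationSpace H E Es => compNeg U :=
    (WithLp.fstL 2 ℂ _ _).continuous
  have hn : Continuous fun U : DilationSpace H E Es => U.snd := (WithLp.sndL 2 ℂ _ _).continuous
  have hu : Continuous fun U : DilationSpace H E Es => compMid U :=
    (WithLp.fstL 2 ℂ _ _).continuous.comp hn
  have hp : Continuous fun U : DilationSpace H E Es => compPos U :=
    (WithLp.sndL 2 ℂ _ _).continuous.comp hn
  have hcl : IsClosed (sumSubspace P Q R : Set (DilationSpace H E Es)) :=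
    (h1.preimage hm).inter ((h2.preimage hu).inter (h3.preimage hp))
  exact hcl.completeSpace_coe

instance [CompleteSpace H] [CompleteSpace E] [CompleteSpace Es] (Q : Submodule ℂ H)
    [CompleteSpace Q] :
    CompleteSpace (sumSubspace ⊤ Q ⊤ : Submodule ℂ (DilationSpace H E Es)) :=
  completeSpace_sumSubspace ⊤ Q ⊤ isClosed_univ
    (completeSpace_coe_iff_isComplete.mp inferInstance).isClosed isClosed_univ

instance [CompleteSpace H] [CompleteSpace E] [CompleteSpace Es] (Q : Submodule ℂ H)
    [CompleteSpace Q] :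
    CompleteSpace (sumSubspace ⊥ Q ⊥ : Submodule ℂ (DilationSpace H E Es)) :=
  completeSpace_sumSubspace ⊥ Q ⊥ isClosed_singleton
    (completeSpace_coe_iff_isComplete.mp inferInstance).isClosed isClosed_singleton

/-- The embedding `u ↦ (0, u, 0)` of a subspace `Q` of `H` into
`L²(ℝ⁻, E_*) ⊕ Q ⊕ L²(ℝ⁺, E)`. -/
def embedMid (Q : Submodule ℂ H) :
    Q →ₗᵢ[ℂ] (sumSubspace ⊤ Q ⊤ : Submodule ℂ (DilationSpace H E Es)) where
  toFun u := ⟨column 0 (u : H) 0, Submodule.mem_top, u.2, Submodule.mem_top⟩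
  map_add' u v := Subtype.ext <| by
    simpa using column_add (0 : L2On (Iio 0) Es) 0 (u : H) (v : H) (0 : L2On (Ioi 0) E) 0
  map_smul' c u := Subtype.ext <| by
    simpa using column_smul c (0 : L2On (Iio 0) Es) (u : H) (0 : L2On (Ioi 0) E)
  norm_map' u := by
    change ‖(column 0 (u : H) 0 : DilationSpace H E Es)‖ = ‖(u : H)‖
    simp [column]

variable [CompleteSpace H] [CompleteSpace E] [CompleteSpace Es]

/-- The vector `u + (Γ_* (A* + μ)⁻¹)* e`. -/
def shiftNeg (A : H →ₗ.[ℂ] H) (Γs : A.adjoint.domain →ₗ[ℂ] Es) (μ : ℂ) (u : H) (e : Es) : H :=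
  u + (compResolvent A.adjoint Γs (-μ)).adjoint e

/-- The vector `u + (Γ (A + ν)⁻¹)* e`. -/
def shiftPos (A : H →ₗ.[ℂ] H) (Γ : A.domain →ₗ[ℂ] E) (ν : ℂ) (u : H) (e : E) : H :=
  u + (compResolvent A Γ (-ν)).adjoint e

lemma shiftNeg_add (A : H →ₗ.[ℂ] H) (Γs : A.adjoint.domain →ₗ[ℂ] Es) (μ : ℂ) (u u' : H)
    (e e' : Es) :
    shiftNeg A Γs μ (u + u') (e + e') = shiftNeg A Γs μ u e + shiftNeg A Γs μ u' e' := by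
  simp only [shiftNeg, map_add]; abel

lemma shiftNeg_smul (A : H →ₗ.[ℂ] H) (Γs : A.adjoint.domain →ₗ[ℂ] Es) (μ c : ℂ) (u : H)
    (e : Es) : shiftNeg A Γs μ (c • u) (c • e) = c • shiftNeg A Γs μ u e := by
  simp only [shiftNeg, map_smul, smul_add]

lemma shiftPos_add (A : H →ₗ.[ℂ] H) (Γ : A.domain →ₗ[ℂ] E) (ν : ℂ) (u u' : H) (e e' : E) :
    shiftPos A Γ ν (u + u') (e + e') = shiftPos A Γ ν u e + shiftPos A Γ ν u' e' := by
  simp only [shiftPos, map_add]; abel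

lemma shiftPos_smul (A : H →ₗ.[ℂ] H) (Γ : A.domain →ₗ[ℂ] E) (ν c : ℂ) (u : H) (e : E) :
    shiftPos A Γ ν (c • u) (c • e) = c • shiftPos A Γ ν u e := by
  simp only [shiftPos, map_smul, smul_add]

/-- The conditions on `u`, `v₋(0) = em` and `v₊(0) = ep` in the domain of the dilation, with
regularisation parameters `μ` in the open lower and `ν` in the open upper half-plane. -/
def BoundaryCondition (A : H →ₗ.[ℂ] H) (Γ : A.domain →ₗ[ℂ] E) (Γs : A.adjoint.domain →ₗ[ℂ] Es)
    (μ ν : ℂ) (em : Es) (u : H) (ep : E) : Prop :=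
  ∃ (hA : shiftNeg A Γs μ u em ∈ A.domain) (hA' : shiftPos A Γ ν u ep ∈ A.adjoint.domain),
    ep = (strausFunction A Γ Γs (-μ)).adjoint em + Complex.I • Γ ⟨shiftNeg A Γs μ u em, hA⟩ ∧
    em = strausFunction A Γ Γs (-starRingEnd ℂ ν) ep -
      Complex.I • Γs ⟨shiftPos A Γ ν u ep, hA'⟩

lemma BoundaryCondition.zero (A : H →ₗ.[ℂ] H) (Γ : A.domain →ₗ[ℂ] E)
    (Γs : A.adjoint.domain →ₗ[ℂ] Es) (μ ν : ℂ) : BoundaryCondition A Γ Γs μ ν 0 0 0 := by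
  have h1 : shiftNeg A Γs μ (0 : H) 0 = 0 := by simp [shiftNeg]
  have h2 : shiftPos A Γ ν (0 : H) 0 = 0 := by simp [shiftPos]
  refine ⟨h1.symm ▸ A.domain.zero_mem, h2.symm ▸ A.adjoint.domain.zero_mem, ?_, ?_⟩
  · have hz : ∀ h, Γ ⟨shiftNeg A Γs μ 0 0, h⟩ = 0 := fun h => map_mk_zero Γ h h1
    rw [hz]; simp
  · have hz : ∀ h, Γs ⟨shiftPos A Γ ν 0 0, h⟩ = 0 := fun h => map_mk_zero Γs h h2
    rw [hz]; simp

lemma BoundaryCondition.add {A : H →ₗ.[ℂ] H} {Γ : A.domain →ₗ[ℂ] E}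
    {Γs : A.adjoint.domain →ₗ[ℂ] Es} {μ ν : ℂ} {em em' : Es} {u u' : H} {ep ep' : E}
    (h : BoundaryCondition A Γ Γs μ ν em u ep) (h' : BoundaryCondition A Γ Γs μ ν em' u' ep') :
    BoundaryCondition A Γ Γs μ ν (em + em') (u + u') (ep + ep') := by
  obtain ⟨hA, hA', h1, h2⟩ := h
  obtain ⟨kA, kA', k1, k2⟩ := h'
  have sm := shiftNeg_add A Γs μ u u' em em'
  have sp := shiftPos_add A Γ ν u u' ep ep'
  refine ⟨sm.symm ▸ A.domain.add_mem hA kA, sp.symm ▸ A.adjoint.domain.add_mem hA' kA', ?_, ?_⟩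
  · rw [map_mk_add Γ hA kA _ sm]
    conv_lhs => rw [h1, k1]
    simp only [map_add, smul_add]; abel
  · rw [map_mk_add Γs hA' kA' _ sp]
    conv_lhs => rw [h2, k2]
    simp only [map_add, smul_add]; abel

lemma BoundaryCondition.smul {A : H →ₗ.[ℂ] H} {Γ : A.domain →ₗ[ℂ] E}
    {Γs : A.adjoint.domain →ₗ[ℂ] Es} {μ ν : ℂ} {em : Es} {u : H} {ep : E} (c : ℂ)
    (h : BoundaryCondition A Γ Γs μ ν em u ep) :
    BoundaryCondition A Γ Γs μ ν (c • em) (c • u) (c • ep) := by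
  obtain ⟨hA, hA', h1, h2⟩ := h
  have sm := shiftNeg_smul A Γs μ c u em
  have sp := shiftPos_smul A Γ ν c u ep
  refine ⟨sm.symm ▸ A.domain.smul_mem c hA, sp.symm ▸ A.adjoint.domain.smul_mem c hA', ?_, ?_⟩
  · rw [map_mk_smul Γ c hA _ sm]
    conv_lhs => rw [h1]
    simp only [map_smul, smul_add, smul_comm c Complex.I]
  · rw [map_mk_smul Γs c hA' _ sp]
    conv_lhs => rw [h2]
    simp only [map_smul, smul_sub, smul_comm c Complex.I]

/-- The domain of the dilation: all `(v₋, u, v₊)` with `v₋ ∈ H¹(ℝ⁻, E_*)`, `v₊ ∈ H¹(ℝ⁺, E)` whose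
boundary values satisfy the boundary condition. -/
def dilationDomain (A : H →ₗ.[ℂ] H) (Γ : A.domain →ₗ[ℂ] E) (Γs : A.adjoint.domain →ₗ[ℂ] Es)
    (μ ν : ℂ) : Submodule ℂ (DilationSpace H E Es) where
  carrier := {U | ∃ (hm : compNeg U ∈ H1On (Iio 0) Es) (hp : compPos U ∈ H1On (Ioi 0) E),
    BoundaryCondition A Γ Γs μ ν (traceNeg ⟨compNeg U, hm⟩) (compMid U)
      (tracePos ⟨compPos U, hp⟩)}
  zero_mem' := by
    refine ⟨(H1On _ _).zero_mem, (H1On _ _).zero_mem, ?_⟩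
    have h := BoundaryCondition.zero A Γ Γs μ ν
    rw [← map_zero (traceNeg (F := Es)), ← map_zero (tracePos (F := E))] at h
    exact h
  add_mem' := by
    rintro U V ⟨hm, hp, h⟩ ⟨km, kp, k⟩
    refine ⟨(H1On _ _).add_mem hm km, (H1On _ _).add_mem hp kp, ?_⟩
    have hk := h.add k
    rw [← map_add, ← map_add] at hk
    exact hk
  smul_mem' := by
    rintro c U ⟨hm, hp, h⟩
    refine ⟨(H1On _ _).smul_mem c hm, (H1On _ _).smul_mem c hp, ?_⟩
    have hk := h.smul c
    rw [← map_smul, ← map_smul] at hk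
    exact hk

/-- `A* (u + (Γ (A + ν)⁻¹)* e) + ν̄ (Γ (A + ν)⁻¹)* e`. -/
def midAction (A : H →ₗ.[ℂ] H) (Γ : A.domain →ₗ[ℂ] E) (ν : ℂ) (u : H) (e : E)
    (h : shiftPos A Γ ν u e ∈ A.adjoint.domain) : H :=
  A.adjoint ⟨shiftPos A Γ ν u e, h⟩ + starRingEnd ℂ ν • (compResolvent A Γ (-ν)).adjoint e

lemma midAction_add (A : H →ₗ.[ℂ] H) (Γ : A.domain →ₗ[ℂ] E) (ν : ℂ) {u u' u'' : H} {e e' e'' : E}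
    (hu : u'' = u + u') (he : e'' = e + e')
    (h : shiftPos A Γ ν u e ∈ A.adjoint.domain)
    (h' : shiftPos A Γ ν u' e' ∈ A.adjoint.domain)
    (h'' : shiftPos A Γ ν u'' e'' ∈ A.adjoint.domain) :
    midAction A Γ ν u'' e'' h'' = midAction A Γ ν u e h + midAction A Γ ν u' e' h' := by
  subst hu he
  unfold midAction
  rw [(Subtype.ext (shiftPos_add A Γ ν u u' e e') :
    (⟨_, h''⟩ : A.adjoint.domain) = ⟨_, h⟩ + ⟨_, h'⟩), LinearPMap.map_add, map_add, smul_add]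
  abel

lemma midAction_smul (A : H →ₗ.[ℂ] H) (Γ : A.domain →ₗ[ℂ] E) (ν c : ℂ) {u u' : H} {e e' : E}
    (hu : u' = c • u) (he : e' = c • e) (h : shiftPos A Γ ν u e ∈ A.adjoint.domain)
    (h' : shiftPos A Γ ν u' e' ∈ A.adjoint.domain) :
    midAction A Γ ν u' e' h' = c • midAction A Γ ν u e h := by
  subst hu he
  unfold midAction
  rw [(Subtype.ext (shiftPos_smul A Γ ν c u e) :
    (⟨_, h'⟩ : A.adjoint.domain) = c • ⟨_, h⟩), LinearPMap.map_smul, map_smul, smul_add,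
    smul_comm c (starRingEnd ℂ ν)]

/-- The dilation `𝓛 (v₋, u, v₊) = (i v₋', T U, i v₊')`, where
`T U = A* (u + (Γ (A + ν)⁻¹)* v₊(0)) + ν̄ (Γ (A + ν)⁻¹)* v₊(0)`. -/
def dilation (A : H →ₗ.[ℂ] H) (Γ : A.domain →ₗ[ℂ] E) (Γs : A.adjoint.domain →ₗ[ℂ] Es)
    (μ ν : ℂ) : DilationSpace H E Es →ₗ.[ℂ] DilationSpace H E Es where
  domain := dilationDomain A Γ Γs μ ν
  toFun :=
    { toFun := fun U => column
        (Complex.I • derivNeg ⟨compNeg (U : DilationSpace H E Es), U.2.choose⟩)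
        (midAction A Γ ν (compMid (U : DilationSpace H E Es))
          (tracePos ⟨compPos (U : DilationSpace H E Es), U.2.choose_spec.choose⟩)
          U.2.choose_spec.choose_spec.choose_spec.choose)
        (Complex.I • derivPos ⟨compPos (U : DilationSpace H E Es), U.2.choose_spec.choose⟩)
      map_add' := by
        rintro ⟨U, hU⟩ ⟨V, hV⟩
        refine (column_congr ?_ ?_ ?_).trans (column_add _ _ _ _ _ _)
        · rw [← smul_add]
          exact congrArg (Complex.I • ·) (map_mk_add derivNeg _ _ _ rfl)
        · exact midAction_add A Γ ν rfl (map_mk_add tracePos _ _ _ rfl) _ _ _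
        · rw [← smul_add]
          exact congrArg (Complex.I • ·) (map_mk_add derivPos _ _ _ rfl)
      map_smul' := by
        rintro c ⟨U, hU⟩
        refine (column_congr ?_ ?_ ?_).trans (column_smul c _ _ _)
        · rw [smul_comm c Complex.I]
          exact congrArg (Complex.I • ·) (map_mk_smul derivNeg c _ _ rfl)
        · exact midAction_smul A Γ ν c rfl (map_mk_smul tracePos c _ _ rfl) _ _
        · rw [smul_comm c Complex.I]
          exact congrArg (Complex.I • ·) (map_mk_smul derivPos c _ _ rfl) }

end Dilation

end DissipativeDilation

end

open DissipativeDilation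

/-!
Write `B = A*`. The formulas defining the dilation contain two regularisation parameters, but the
boundary condition and the middle component of the action have a weak form without them: for
`U = (v₋, u, v₊)` with values `e₋ = v₋(0)`, `e₊ = v₊(0)`, the middle component of `𝓛 U` is `f` if
and only if

* `⟨f, w⟩ - ⟨u, B w⟩ = ⟨e₋, Γ_* w⟩` for all `w ∈ D(B)`, and
* `⟨f, v⟩ - ⟨u, A v⟩ = ⟨e₊, Γ v⟩` for all `v ∈ D(A)`

(`NodeRel`, `BoundaryPair.nodeRel_iff`). The relation is symmetric under the exchange of `(A, Γ)`
with `(B, Γ_*)` and a change of sign, so that most facts are proved once, for a `BoundaryPair`, and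
used twice. It can be parametrised by `e₋` and a vector of `D(A)`, or by `e₊` and a vector of
`D(B)`, through the characteristic function (`BoundaryPair.nodeRel_mk`,
`BoundaryPair.exists_of_nodeRel`), and it satisfies Green's formula (`BoundaryPair.green`).

Green's formula and integration by parts on the half-lines show that `𝓛` is symmetric. The equation
`(𝓛 - z) U = F` is solved component by component, following the signal: for `Im z < 0` the
equation on `ℝ⁻` has a unique solution, which gives `e₋`; the node then gives `u` and `e₊`, and
`e₊` is the initial value on `ℝ⁺`. For `Im z > 0` one goes backwards. Hence `𝓛` is selfadjoint
(`BoundaryPair.isSelfAdjoint_dilation`), and `e₋ = 0` shows that it dilates `A`.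

A vector `w` is orthogonal to `H_cns` if and only if `Γ (A - z)⁻¹ w = 0` for `Im z < 0` and
`Γ_* (B - z)⁻¹ w = 0` for `Im z > 0` (`mem_Hcns_orthogonal_iff`). For such `w` the vector
`(A - z)⁻¹ w` lies in `D(A) ∩ D(B)`, the operators `A` and `B` agree on it, and the node relation
holds with `e₋ = e₊ = 0`. This makes `H_sa` invariant for the resolvents of `A` and `B`, `A`
selfadjoint on `H_sa`, and `0 ⊕ H_sa ⊕ 0` invariant for the resolvents of `𝓛`. Conversely, wherever
`A` acts as a selfadjoint operator, `Im ⟨A u, u⟩ = 0` forces `Γ u = 0`, so that the vector is in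
`H_sa`; thus `A` is completely non-selfadjoint on `H_cns`. Similarly, `U` is orthogonal to the
resolvents of `𝓛` on the channels if and only if all `(𝓛 - z)⁻¹ U` have the form `(0, u, 0)`, which
means `U ∈ 0 ⊕ H_sa ⊕ 0`.

For minimality, let `U` be orthogonal to a reducing subspace which contains `H_cns`. Then the middle
components of `U` and of all `(𝓛 - z)⁻¹ U` vanish, and so do the boundary values of `(𝓛 - z)⁻¹ U`.
Integration by parts with `z = ± i s` shows that the outer components of `U` are orthogonal to all
exponentials `e^{-s|t|} d`, and `U = 0` by the uniqueness theorem for the Laplace transform.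
-/

namespace DissipativeDilation

section OperatorTheory

variable {H : Type*} [NormedAddCommGroup H] [InnerProductSpace ℂ H]
variable {A : H →ₗ.[ℂ] H} {z : ℂ} {R : H →L[ℂ] H}

/-! ### Resolvents -/

lemma IsResolventAt.unique {R' : H →L[ℂ] H} (h : IsResolventAt A z R) (h' : IsResolventAt A z R') :
    R = R' := by
  ext f
  obtain ⟨u, hu, hf⟩ := h.1 f
  rw [← hu, ← hf, h'.2 u]

lemma IsResolventAt.resolventOp_eq (h : IsResolventAt A z R) : resolventOp A z = R := by
  have hex : ∃ R, IsResolventAt A z R := ⟨R, h⟩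
  unfold resolventOp
  rw [dif_pos hex]
  exact hex.choose_spec.unique h

lemma IsResolventAt.resolventOp (h : IsResolventAt A z R) :
    IsResolventAt A z (resolventOp A z) := by
  rwa [h.resolventOp_eq]

lemma IsResolventAt.exists_sub_eq (h : IsResolventAt A z R) (f : H) :
    ∃ u : A.domain, A u - z • (u : H) = f :=
  let ⟨u, _, hf⟩ := h.1 f; ⟨u, hf⟩

lemma IsResolventAt.mem_domain (h : IsResolventAt A z R) (f : H) : R f ∈ A.domain :=
  let ⟨u, hu, _⟩ := h.1 f; hu ▸ u.2

lemma IsResolventAt.apply (h : IsResolventAt A z R) (f : H) :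
    A ⟨R f, h.mem_domain f⟩ = f + z • R f := by
  obtain ⟨u, hu, hf⟩ := h.1 f
  have : (⟨R f, h.mem_domain f⟩ : A.domain) = u := Subtype.ext hu.symm
  rw [this, ← hu, ← hf]; abel

/-- A vector `x` with `(x, y)` in the graph of `A` is `(A - z)⁻¹ (y - z x)`. -/
lemma IsResolventAt.eq_of_graph (h : IsResolventAt A z R) {x y : H} (hx : (x, y) ∈ A.graph) :
    R (y - z • x) = x := by
  obtain ⟨u, hu, hy⟩ := A.mem_graph_iff.mp hx
  dsimp only at hu hy
  rw [← hu, ← hy]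
  exact h.2 u

lemma IsResolventAt.mem_graph (h : IsResolventAt A z R) (f : H) :
    (R f, f + z • R f) ∈ A.graph :=
  A.mem_graph_iff.mpr ⟨⟨R f, h.mem_domain f⟩, rfl, h.apply f⟩

/-- If `A - z` is onto and `‖(A - z) u‖ ≥ a ‖u‖` with `a > 0`, its inverse is a bounded operator. -/
lemma exists_isResolventAt_of_surjective {a : ℝ} (ha : 0 < a)
    (hlow : ∀ u : A.domain, a * ‖(u : H)‖ ≤ ‖A u - z • (u : H)‖)
    (hsurj : ∀ f : H, ∃ u : A.domain, A u - z • (u : H) = f) : ∃ R, IsResolventAt A z R := by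
  have hinj : ∀ u v : A.domain, A u - z • (u : H) = A v - z • (v : H) → u = v := by
    intro u v huv
    have h := hlow (u - v)
    have h0 : A (u - v) - z • ((u - v : A.domain) : H) = 0 := by
      rw [A.map_sub, Submodule.coe_sub, smul_sub, sub_sub_sub_comm, huv, sub_self]
    rw [h0, norm_zero] at h
    have h1 : ‖((u - v : A.domain) : H)‖ = 0 :=
      le_antisymm (by nlinarith [norm_nonneg ((u - v : A.domain) : H)]) (norm_nonneg _)
    have h2 := norm_eq_zero.mp h1
    exact Subtype.ext (by rwa [Submodule.coe_sub, sub_eq_zero] at h2)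
  choose g hg using hsurj
  let R₀ : H →ₗ[ℂ] H :=
    { toFun := fun f => g f
      map_add' := fun f f' => by
        have : g (f + f') = g f + g f' := hinj _ _ (by
          rw [hg, A.map_add, Submodule.coe_add, smul_add, add_sub_add_comm, hg, hg])
        rw [this, Submodule.coe_add]
      map_smul' := fun c f => by
        have : g (c • f) = c • g f := hinj _ _ (by
          rw [hg, A.map_smul, Submodule.coe_smul, smul_comm, ← smul_sub, hg])
        rw [this, Submodule.coe_smul, RingHom.id_apply] }
  refine ⟨R₀.mkContinuous a⁻¹ fun f => ?_, fun f => ⟨g f, rfl, hg f⟩, fun u => ?_⟩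
  · have h := hlow (g f)
    rw [hg] at h
    rw [inv_mul_eq_div, le_div_iff₀ ha, mul_comm]
    exact h
  · exact congrArg Subtype.val (hinj _ _ (hg _))

/-! ### Dissipative operators -/

lemma im_inner_smul_self (x : H) (z : ℂ) : (inner ℂ x (z • x)).im = z.im * ‖x‖ ^ 2 := by
  have h1 : (inner ℂ x x : ℂ).im = 0 := inner_self_im (𝕜 := ℂ) x
  have h2 : (inner ℂ x x : ℂ).re = ‖x‖ ^ 2 := inner_self_eq_norm_sq (𝕜 := ℂ) x
  rw [inner_smul_right, Complex.mul_im, h1, h2]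
  ring

lemma abs_im_inner_le (x y : H) : |(inner ℂ x y : ℂ).im| ≤ ‖x‖ * ‖y‖ :=
  (Complex.abs_im_le_norm _).trans (norm_inner_le_norm x y)

/-- The basic resolvent estimate `‖(A - z) u‖ ≥ |Im z| ‖u‖`, `Im z < 0`, for dissipative operators. -/
lemma IsDissipative.lower_bound (hA : IsDissipative A) (z : ℂ) (u : A.domain) :
    -z.im * ‖(u : H)‖ ≤ ‖A u - z • (u : H)‖ := by
  rcases eq_or_ne ‖(u : H)‖ 0 with h0 | h0
  · rw [h0, mul_zero]; exact norm_nonneg _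
  have h1 := hA.2 u
  have h2 := abs_im_inner_le (u : H) (A u - z • (u : H))
  rw [inner_sub_right, Complex.sub_im, im_inner_smul_self] at h2
  have h3 := (le_abs_self _).trans h2
  have hpos : 0 < ‖(u : H)‖ := lt_of_le_of_ne (norm_nonneg _) (Ne.symm h0)
  refine le_of_mul_le_mul_left ?_ hpos
  nlinarith

/-- A quadratic expression `c + Im (t̄ a) + |t|² b` that stays non-negative for all complex `t` has no
linear part `a`, provided that one of the constant and the quadratic term is zero. -/
lemma eq_zero_of_forall_im_nonneg {a : ℂ} {b c : ℝ} (hc : ∀ t : ℂ,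
    0 ≤ c + (starRingEnd ℂ t * a).im + ‖t‖ ^ 2 * b) (hbc : c = 0 ∨ b = 0) : a = 0 := by
  by_contra ha
  have hpos : 0 < ‖a‖ ^ 2 := by positivity
  -- for `t = i r a` the linear part is `-r |a|²`
  have key : ∀ r : ℝ, 0 ≤ c - r * ‖a‖ ^ 2 + r ^ 2 * ‖a‖ ^ 2 * b := by
    intro r
    have h := hc (Complex.I * r * a)
    have h1 : (starRingEnd ℂ (Complex.I * r * a) * a).im = -r * ‖a‖ ^ 2 := by
      rw [← Complex.normSq_eq_norm_sq, Complex.normSq_apply]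
      simp
      ring
    have h2 : ‖Complex.I * r * a‖ ^ 2 = r ^ 2 * ‖a‖ ^ 2 := by
      simp [mul_pow]
    rw [h1, h2] at h
    linarith
  rcases hbc with rfl | rfl
  · have h := key (1 / (2 * (|b| + 1)))
    have hb : 0 < |b| + 1 := by positivity
    have h3 : (1 / (2 * (|b| + 1))) * b ≤ 1 / 2 := by
      rw [div_mul_eq_mul_div, div_le_div_iff₀ (by positivity) (by norm_num)]
      nlinarith [le_abs_self b]
    have h4 : 0 < 1 / (2 * (|b| + 1)) := by positivity
    have h5 := mul_pos h4 hpos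
    nlinarith
  · have h := key ((c + 1) / ‖a‖ ^ 2)
    rw [div_mul_cancel₀ _ hpos.ne'] at h
    linarith

variable [CompleteSpace H]

/-- The image of a closed subspace under an operator which is bounded below on it is closed. -/
lemma isClosed_map_of_bound {X Y : Type*} [NormedAddCommGroup X] [NormedSpace ℂ X]
    [CompleteSpace X] [NormedAddCommGroup Y] [NormedSpace ℂ Y] (T : X →L[ℂ] Y)
    {p : Submodule ℂ X} (hp : IsClosed (p : Set X)) {C : ℝ} (hC : 0 ≤ C)
    (h : ∀ x ∈ p, ‖x‖ ≤ C * ‖T x‖) : IsClosed (p.map T.toLinearMap : Set Y) := by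
  have : CompleteSpace p := hp.completeSpace_coe
  have hb : AntilipschitzWith ⟨C, hC⟩ (T ∘L p.subtypeL) :=
    (T ∘L p.subtypeL).antilipschitz_of_bound fun x => h x x.2
  have hr := hb.isClosed_range (T ∘L p.subtypeL).uniformContinuous
  convert hr using 1
  ext y
  simp

/-- A closed operator for which `A - z` is bounded below with dense range is onto. -/
lemma surjective_sub_of_isClosed (hcl : A.IsClosed) {a : ℝ} (ha : 0 < a)
    (hlow : ∀ u : A.domain, a * ‖(u : H)‖ ≤ ‖A u - z • (u : H)‖)
    (hdense : ∀ f : H, (∀ u : A.domain, inner ℂ (A u - z • (u : H)) f = 0) → f = 0) (f : H) :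
    ∃ u : A.domain, A u - z • (u : H) = f := by
  set T : H × H →L[ℂ] H := ContinuousLinearMap.snd ℂ H H - z • ContinuousLinearMap.fst ℂ H H
  have hbound : ∀ p ∈ A.graph, ‖p‖ ≤ (1 / a + (1 + ‖z‖ / a)) * ‖T p‖ := by
    intro p hp
    obtain ⟨u, h1, h2⟩ := A.mem_graph_iff.mp hp
    have hT : T p = A u - z • (u : H) := by simp [T, h1, h2]
    have hx : ‖p.1‖ ≤ 1 / a * ‖T p‖ := by
      rw [hT, ← h1, one_div, inv_mul_eq_div, le_div_iff₀ ha, mul_comm]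
      exact hlow u
    have hy : ‖p.2‖ ≤ (1 + ‖z‖ / a) * ‖T p‖ := by
      have e : p.2 = T p + z • p.1 := by simp [T]
      calc ‖p.2‖ ≤ ‖T p‖ + ‖z‖ * ‖p.1‖ := by
            conv_lhs => rw [e]
            exact (norm_add_le _ _).trans_eq (by rw [norm_smul])
        _ ≤ ‖T p‖ + ‖z‖ * (1 / a * ‖T p‖) := by gcongr
        _ = _ := by ring
    have p1 : 0 ≤ 1 / a * ‖T p‖ := by positivity
    have p2 : 0 ≤ (1 + ‖z‖ / a) * ‖T p‖ := by positivity
    rw [Prod.norm_def, add_mul]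
    exact max_le (by linarith) (by linarith)
  have hclosed := isClosed_map_of_bound T hcl (by positivity) hbound
  have : CompleteSpace (A.graph.map T.toLinearMap) := hclosed.completeSpace_coe
  have htop : A.graph.map T.toLinearMap = ⊤ := by
    rw [← Submodule.orthogonal_eq_bot_iff, Submodule.eq_bot_iff]
    intro g hg
    refine hdense g fun u => ?_
    rw [Submodule.mem_orthogonal] at hg
    exact hg _ ⟨((u : H), A u), A.mem_graph u, by simp [T]⟩
  have hf : f ∈ A.graph.map T.toLinearMap := htop ▸ Submodule.mem_top
  obtain ⟨p, hp, hpf⟩ := hf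
  obtain ⟨u, h1, h2⟩ := A.mem_graph_iff.mp hp
  exact ⟨u, by rw [← hpf, h1, h2]; simp [T]⟩

/-- A maximal dissipative operator is closed: the closure of its graph is the graph of a
dissipative operator. -/
lemma IsMaximalDissipative.isClosed (hA : IsMaximalDissipative A) : A.IsClosed := by
  set g := A.graph.topologicalClosure with hg
  have hpos : ∀ p ∈ g, 0 ≤ (inner ℂ p.1 p.2 : ℂ).im := by
    have hc : IsClosed {p : H × H | 0 ≤ (inner ℂ p.1 p.2 : ℂ).im} :=
      isClosed_le continuous_const
        (Complex.continuous_im.comp (continuous_fst.inner continuous_snd))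
    refine fun p hp => closure_minimal ?_ hc hp
    rintro q hq
    obtain ⟨u, h1, h2⟩ := A.mem_graph_iff.mp hq
    have := hA.1.2 u
    rwa [h1, h2] at this
  have hle : A.graph ≤ g := A.graph.le_topologicalClosure
  have hfun : ∀ p ∈ g, p.1 = 0 → p.2 = 0 := by
    rintro ⟨x, y⟩ hp hx
    dsimp only at hx ⊢
    subst hx
    refine hA.1.1.eq_zero_of_inner_right ℂ fun v hv => ?_
    refine eq_zero_of_forall_im_nonneg (b := (inner ℂ v (A ⟨v, hv⟩) : ℂ).im) (c := 0)
      (fun t => ?_) (Or.inl rfl)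
    have h := hpos _ (g.add_mem hp (g.smul_mem t (hle (A.mem_graph ⟨v, hv⟩))))
    simp only [Prod.smul_mk, Prod.mk_add_mk, zero_add, inner_add_right, inner_smul_left,
      inner_smul_right, ← mul_assoc, Complex.mul_conj', Complex.add_im] at h
    norm_cast at h
    rw [Complex.im_ofReal_mul] at h
    simpa using h
  have hgraph : g.toLinearPMap.graph = g := g.toLinearPMap_graph_eq hfun
  have hAle : A ≤ g.toLinearPMap := by
    rw [← LinearPMap.le_graph_iff, hgraph]; exact hle
  have hdis : IsDissipative g.toLinearPMap := by
    refine ⟨hA.1.1.mono hAle.1, fun u => ?_⟩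
    have := g.toLinearPMap.mem_graph u
    rw [hgraph] at this
    exact hpos _ this
  have := hA.2 _ hdis hAle
  unfold LinearPMap.IsClosed
  rw [← this, hgraph]
  exact A.graph.isClosed_topologicalClosure

/-- The lower half-plane belongs to the resolvent set of a maximal dissipative operator: a vector
`f` orthogonal to the range of `A - z` could be added to the domain of `A` by `A f = z̄ f`. -/
theorem IsMaximalDissipative.exists_isResolventAt (hA : IsMaximalDissipative A) (hz : z.im < 0) :
    ∃ R, IsResolventAt A z R := by
  refine exists_isResolventAt_of_surjective (neg_pos.mpr hz) (hA.1.lower_bound z)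
    (surjective_sub_of_isClosed hA.isClosed (neg_pos.mpr hz) (hA.1.lower_bound z) ?_)
  intro f hf
  have hAf : ∀ u : A.domain, inner ℂ (A u) f = starRingEnd ℂ z * inner ℂ (u : H) f := by
    intro u
    have := hf u
    rwa [inner_sub_left, inner_smul_left, sub_eq_zero] at this
  by_contra hf0
  by_cases hmem : f ∈ A.domain
  · have h1 := hA.1.2 ⟨f, hmem⟩
    have h2 := hAf ⟨f, hmem⟩
    rw [← inner_conj_symm, h2, map_mul, Complex.conj_conj, inner_conj_symm, ← inner_smul_right,
      im_inner_smul_self] at h1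
    have : 0 < ‖f‖ ^ 2 := by positivity
    nlinarith
  · -- if `f ∉ D(A)`, the extension is dissipative: it adds `-Im z ‖c f‖²` to `Im ⟨A u, u⟩`
    set B := A.supSpanSingleton f (starRingEnd ℂ z • f) hmem with hB
    have hAB : A ≤ B := A.left_le_sup _ _
    have hdis : IsDissipative B := by
      refine ⟨hA.1.1.mono hAB.1, ?_⟩
      rintro ⟨w, hw⟩
      obtain ⟨u, hu, v, hv, rfl⟩ := Submodule.mem_sup.mp
        (show w ∈ A.domain ⊔ Submodule.span ℂ {f} from hw)
      obtain ⟨c, rfl⟩ := Submodule.mem_span_singleton.mp hv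
      have e : B ⟨u + c • f, hw⟩ = A ⟨u, hu⟩ + c • starRingEnd ℂ z • f :=
        A.supSpanSingleton_apply_mk f _ hmem u hu c
      rw [e]
      have h1 := hAf ⟨u, hu⟩
      have h2 := hA.1.2 ⟨u, hu⟩
      have h3 : inner ℂ f (A ⟨u, hu⟩) = z * inner ℂ f u := by
        rw [← inner_conj_symm, h1, map_mul, Complex.conj_conj, inner_conj_symm]
      have h4 : (inner ℂ (u + c • f) (A ⟨u, hu⟩ + c • starRingEnd ℂ z • f) : ℂ).im =
          (inner ℂ u (A ⟨u, hu⟩) : ℂ).im + -z.im * ‖c • f‖ ^ 2 := by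
        have h5 := im_inner_smul_self (c • f) (starRingEnd ℂ z)
        rw [Complex.conj_im] at h5
        rw [← h5, smul_comm c, inner_add_left, inner_add_right, inner_add_right,
          inner_smul_left f (A ⟨u, hu⟩) c, h3, inner_smul_right u, inner_smul_right u]
        have h6 : starRingEnd ℂ c * (z * inner ℂ f u) =
            starRingEnd ℂ (starRingEnd ℂ z * (c * inner ℂ u f)) := by
          simp only [map_mul, Complex.conj_conj, inner_conj_symm]; ring
        rw [h6]
        simp only [Complex.add_im, Complex.conj_im]
        ring
      rw [h4]
      have : 0 ≤ -z.im * ‖c • f‖ ^ 2 := mul_nonneg (by linarith) (by positivity)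
      linarith
    have hBA := hA.2 B hdis hAB
    refine hmem ?_
    rw [← hBA]
    exact Submodule.mem_sup_right (Submodule.mem_span_singleton_self f)

/-- A dissipative operator `A` such that `A - z` is onto for some `z` in the lower half-plane is
maximal. -/
lemma IsDissipative.isMaximalDissipative (hA : IsDissipative A) (hz : z.im < 0)
    (hsurj : ∀ f : H, ∃ u : A.domain, A u - z • (u : H) = f) : IsMaximalDissipative A := by
  refine ⟨hA, fun B hB hAB => le_antisymm ?_ hAB⟩
  have hdom : B.domain ≤ A.domain := by
    intro x hx
    obtain ⟨u, hu⟩ := hsurj (B ⟨x, hx⟩ - z • x)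
    have hux := hAB.2 (x := u) (y := ⟨u, hAB.1 u.2⟩) rfl
    have h := hB.lower_bound z (⟨u, hAB.1 u.2⟩ - ⟨x, hx⟩)
    rw [B.map_sub, ← hux, Submodule.coe_sub, smul_sub, sub_sub_sub_comm, hu, sub_self,
      norm_zero] at h
    have h1 : ‖(u : H) - x‖ = 0 :=
      le_antisymm (by nlinarith [norm_nonneg ((u : H) - x)]) (norm_nonneg _)
    rw [← sub_eq_zero.mp (norm_eq_zero.mp h1)]
    exact u.2
  exact ⟨hdom, fun x y hxy => (hAB.2 hxy.symm).symm⟩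

end OperatorTheory

section OperatorTheory

variable {H : Type*} [NormedAddCommGroup H] [InnerProductSpace ℂ H]
variable {A L : H →ₗ.[ℂ] H} {z : ℂ} {R : H →L[ℂ] H}

lemma isResolventAt_iff_graph : IsResolventAt A z R ↔
    (∀ f, (R f, f + z • R f) ∈ A.graph) ∧ ∀ x y, (x, y) ∈ A.graph → R (y - z • x) = x := by
  refine ⟨fun h => ⟨h.mem_graph, fun x y => h.eq_of_graph⟩, fun h => ⟨fun f => ?_, fun u => ?_⟩⟩
  · obtain ⟨u, hu, hy⟩ := A.mem_graph_iff.mp (h.1 f)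
    dsimp only at hu hy
    exact ⟨u, hu, by rw [hy, hu, add_sub_cancel_right]⟩
  · exact h.2 _ _ (A.mem_graph u)

section Adjoint

variable [CompleteSpace H]

lemma IsResolventAt.adjoint (hd : Dense (A.domain : Set H)) (h : IsResolventAt A z R) :
    IsResolventAt A.adjoint (starRingEnd ℂ z) R.adjoint := by
  have hR : ∀ x : A.domain, R (A x) = x + z • R x := by
    intro x
    have := h.2 x
    rwa [map_sub, map_smul, sub_eq_iff_eq_add] at this
  have key : ∀ f : H, ∀ x : A.domain,
      inner ℂ (f + starRingEnd ℂ z • R.adjoint f) (x : H) = inner ℂ (R.adjoint f) (A x) := by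
    intro f x
    rw [ContinuousLinearMap.adjoint_inner_left, hR, inner_add_left, inner_smul_left,
      Complex.conj_conj, ContinuousLinearMap.adjoint_inner_left, inner_add_right, inner_smul_right]
  refine ⟨fun f => ?_, fun u => ?_⟩
  · have hm : R.adjoint f ∈ A.adjoint.domain :=
      LinearPMap.mem_adjoint_domain_of_exists _ ⟨_, key f⟩
    refine ⟨⟨_, hm⟩, rfl, ?_⟩
    rw [LinearPMap.adjoint_apply_eq hd ⟨_, hm⟩ (key f), add_sub_cancel_right]
  · refine ext_inner_right ℂ fun g => ?_
    obtain ⟨v, rfl⟩ := h.exists_sub_eq g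
    rw [ContinuousLinearMap.adjoint_inner_left, h.2, inner_sub_left, inner_smul_left,
      Complex.conj_conj, LinearPMap.adjoint_isFormalAdjoint hd, inner_sub_right, inner_smul_right]

/-! ### Selfadjoint operators -/

lemma _root_.IsSelfAdjoint.inner_apply (hL : IsSelfAdjoint L) (u v : L.domain) :
    inner ℂ (L u) (v : H) = inner ℂ (u : H) (L v) := by
  have h := LinearPMap.adjoint_isFormalAdjoint hL.dense_domain
  rw [LinearPMap.isSelfAdjoint_def.mp hL] at h
  exact h u v

lemma im_inner_eq_zero_of_symmetric (h : ∀ u v : L.domain,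
    inner ℂ (L u) (v : H) = inner ℂ (u : H) (L v)) (u : L.domain) :
    (inner ℂ (u : H) (L u) : ℂ).im = 0 := by
  rw [← Complex.conj_eq_iff_im, inner_conj_symm, h]

/-- For a dissipative extension `B` of a selfadjoint `L`, the quadratic form `Im ⟨B y, y⟩` vanishes
on `D(L)`, so its linear part in the direction of `D(L)` vanishes as well; hence `B` is contained in
the adjoint of `L`. -/
lemma _root_.IsSelfAdjoint.isMaximalDissipative (hL : IsSelfAdjoint L) :
    IsMaximalDissipative L := by
  have hre := im_inner_eq_zero_of_symmetric hL.inner_apply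
  refine ⟨⟨hL.dense_domain, fun u => (hre u).ge⟩, fun B hB hLB => ?_⟩
  have hBL : ∀ (x : B.domain) (v : L.domain),
      inner ℂ (v : H) (B x) - inner ℂ (L v) (x : H) = 0 := by
    intro x v
    refine eq_zero_of_forall_im_nonneg (c := (inner ℂ (x : H) (B x) : ℂ).im) (b := 0)
      (fun t => ?_) (Or.inr rfl)
    have e : B ⟨v, hLB.1 v.2⟩ = L v := (hLB.2 rfl).symm
    have h := hB.2 (x + t • ⟨v, hLB.1 v.2⟩)
    rw [B.map_add, B.map_smul, e, Submodule.coe_add, Submodule.coe_smul, inner_add_left,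
      inner_add_right, inner_add_right, inner_smul_left, inner_smul_right, inner_smul_left,
      inner_smul_right] at h
    have h1 : t * inner ℂ (x : H) (L v) =
        starRingEnd ℂ (starRingEnd ℂ t * inner ℂ (L v) (x : H)) := by
      rw [map_mul, Complex.conj_conj, inner_conj_symm]
    have h2 : (starRingEnd ℂ t * (t * inner ℂ (v : H) (L v))).im = 0 := by
      rw [← mul_assoc, Complex.conj_mul', ← Complex.ofReal_pow, Complex.im_ofReal_mul, hre,
        mul_zero]
    have h3 := congrArg Complex.im h1
    rw [Complex.conj_im] at h3
    simp only [Complex.add_im, h2, h3] at h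
    rw [mul_sub, Complex.sub_im]
    linarith
  refine le_antisymm ?_ hLB
  have hdom : ∀ x : B.domain, ∃ hx : (x : H) ∈ L.domain, L ⟨x, hx⟩ = B x := by
    intro x
    have hx : ∀ v : L.domain, inner ℂ (B x) (v : H) = inner ℂ (x : H) (L v) := by
      intro v
      rw [← inner_conj_symm, sub_eq_zero.mp (hBL x v), inner_conj_symm]
    have hm := LinearPMap.mem_adjoint_domain_of_exists _ ⟨_, hx⟩
    have ha := LinearPMap.adjoint_apply_eq hL.dense_domain ⟨_, hm⟩ hx
    have hg : ((x : H), B x) ∈ L.graph := by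
      rw [← LinearPMap.isSelfAdjoint_def.mp hL]
      exact LinearPMap.mem_graph_iff _ |>.mpr ⟨⟨_, hm⟩, rfl, ha⟩
    obtain ⟨w, h1, h2⟩ := L.mem_graph_iff.mp hg
    dsimp only at h1 h2
    have hxL : (x : H) ∈ L.domain := h1 ▸ w.2
    have : w = ⟨(x : H), hxL⟩ := Subtype.ext h1
    exact ⟨hxL, by rw [← this]; exact h2⟩
  refine ⟨fun x hx => (hdom ⟨x, hx⟩).1, fun x y hxy => ?_⟩
  obtain ⟨h1, h2⟩ := hdom x
  have : y = ⟨(x : H), h1⟩ := Subtype.ext hxy.symm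
  rw [this, h2]

/-- Non-real numbers belong to the resolvent set of a selfadjoint operator. -/
theorem _root_.IsSelfAdjoint.isResolventAt (hL : IsSelfAdjoint L) (hz : z.im ≠ 0) :
    IsResolventAt L z (resolventOp L z) := by
  rcases lt_or_gt_of_ne hz with h | h
  · obtain ⟨R, hR⟩ := hL.isMaximalDissipative.exists_isResolventAt h
    exact hR.resolventOp
  · obtain ⟨R, hR⟩ := hL.isMaximalDissipative.exists_isResolventAt (z := starRingEnd ℂ z)
      (by simpa using h)
    have := hR.adjoint hL.dense_domain
    rw [LinearPMap.isSelfAdjoint_def.mp hL, Complex.conj_conj] at this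
    exact this.resolventOp

lemma _root_.IsSelfAdjoint.adjoint_resolventOp (hL : IsSelfAdjoint L) (hz : z.im ≠ 0) :
    (resolventOp L z).adjoint = resolventOp L (starRingEnd ℂ z) := by
  have h := (hL.isResolventAt hz).adjoint hL.dense_domain
  rw [LinearPMap.isSelfAdjoint_def.mp hL] at h
  exact h.resolventOp_eq.symm

/-- A symmetric operator `L` for which `L - z` and `L - z̄` are onto is selfadjoint. -/
theorem isSelfAdjoint_of_symmetric (hsym : ∀ u v : L.domain,
    inner ℂ (L u) (v : H) = inner ℂ (u : H) (L v)) (hz : z.im ≠ 0)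
    (h1 : ∀ f : H, ∃ u : L.domain, L u - z • (u : H) = f)
    (h2 : ∀ f : H, ∃ u : L.domain, L u - starRingEnd ℂ z • (u : H) = f) : IsSelfAdjoint L := by
  have hd : Dense (L.domain : Set H) := by
    rw [Submodule.dense_iff_topologicalClosure_eq_top, Submodule.topologicalClosure_eq_top_iff,
      Submodule.eq_bot_iff]
    intro g hg
    obtain ⟨u, rfl⟩ := h1 g
    have h := (Submodule.mem_orthogonal _ _).mp hg u u.2
    have him := congrArg Complex.im h
    rw [inner_sub_right, Complex.sub_im, im_inner_eq_zero_of_symmetric hsym, im_inner_smul_self,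
      zero_sub, Complex.zero_im, neg_eq_zero, mul_eq_zero, or_iff_right hz] at him
    have hu : u = 0 := Subtype.ext (norm_eq_zero.mp (pow_eq_zero_iff two_ne_zero |>.mp him))
    rw [hu]; simp
  have hle : L ≤ L.adjoint := LinearPMap.IsFormalAdjoint.le_adjoint hd hsym
  have hge : ∀ y : L.adjoint.domain, (y : H) ∈ L.domain := by
    intro y
    obtain ⟨u, hu⟩ := h1 (L.adjoint y - z • (y : H))
    have h0 : (y : H) - u = 0 := by
      obtain ⟨v, hv⟩ := h2 ((y : H) - u)
      rw [← inner_self_eq_zero (𝕜 := ℂ)]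
      suffices h : inner ℂ ((y : H) - u) (L v - starRingEnd ℂ z • (v : H)) = 0 by rwa [hv] at h
      have e1 := LinearPMap.adjoint_isFormalAdjoint hd y v
      have e2 := hsym u v
      have e3 := congrArg (fun x => inner ℂ x (v : H)) hu
      simp only [inner_sub_left, inner_smul_left] at e3
      simp only [inner_sub_left, inner_sub_right, inner_smul_right]
      linear_combination e2 - e1 - e3
    rw [sub_eq_zero.mp h0]
    exact u.2
  rw [LinearPMap.isSelfAdjoint_def]
  have hge' : L.adjoint ≤ L :=
    ⟨fun y hy => hge ⟨y, hy⟩, fun x y hxy => (hle.2 hxy.symm).symm⟩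
  exact le_antisymm hge' hle

end Adjoint

/-! ### Reducing subspaces and restrictions -/

section Restriction

variable {K : Submodule ℂ H}

lemma mem_graph_restrictTo {x y : K} :
    (x, y) ∈ (restrictTo A K).graph ↔ ((x : H), (y : H)) ∈ A.graph := by
  constructor
  · intro h
    obtain ⟨u, rfl, rfl⟩ := (LinearPMap.mem_graph_iff _).mp h
    exact A.mem_graph ⟨_, u.2.choose⟩
  · intro h
    obtain ⟨u, h1, h2⟩ := A.mem_graph_iff.mp h
    dsimp only at h1 h2
    have hx : (x : H) ∈ A.domain := h1 ▸ u.2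
    have hu : u = ⟨(x : H), hx⟩ := Subtype.ext h1
    rw [hu] at h2
    exact (LinearPMap.mem_graph_iff _).mpr
      ⟨⟨x, ⟨hx, h2 ▸ y.2⟩⟩, rfl, Subtype.ext h2⟩

lemma restrictTo_apply_mem_graph (x : (restrictTo A K).domain) :
    (((x : K) : H), ((restrictTo A K x : K) : H)) ∈ A.graph :=
  mem_graph_restrictTo.mp ((restrictTo A K).mem_graph x)

/-- A resolvent leaving `K` invariant restricts to a resolvent of the restriction to `K`. -/
lemma IsResolventAt.restrictTo (h : IsResolventAt A z R) (hK : ∀ x ∈ K, R x ∈ K) :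
    IsResolventAt (restrictTo A K) z ((R ∘L K.subtypeL).codRestrict K fun x => hK x x.2) := by
  rw [isResolventAt_iff_graph] at h ⊢
  refine ⟨fun f => mem_graph_restrictTo.mpr (h.1 f), fun x y hxy => Subtype.ext ?_⟩
  exact h.2 _ _ (mem_graph_restrictTo.mp hxy)

variable [K.HasOrthogonalProjection]

lemma IsResolventAt.isInvariantFor (h : IsResolventAt A z R) (hK : ∀ x ∈ K, R x ∈ K)
    (hK' : ∀ x ∈ Kᗮ, R x ∈ Kᗮ) : IsInvariantFor A K := by
  intro u
  have hu := h.2 u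
  set f := A u - z • (u : H)
  have hdec : K.starProjection f + (f - K.starProjection f) = f := by abel
  have h1 := hK _ (K.starProjection_apply_mem f)
  have h2 := hK' _ (K.sub_starProjection_mem_orthogonal f)
  have hP : K.starProjection (u : H) = R (K.starProjection f) := by
    refine Submodule.eq_starProjection_of_mem_orthogonal h1 ?_
    rw [← hu]
    rwa [← map_sub]
  rw [hP]
  refine ⟨h.mem_domain _, ?_⟩
  rw [h.apply]
  exact K.add_mem (K.starProjection_apply_mem f) (K.smul_mem z h1)

/-- A closed subspace which, together with its orthogonal complement, is invariant for one
resolvent of `A` reduces `A`. -/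
lemma IsResolventAt.isReducingFor (h : IsResolventAt A z R) (hK : ∀ x ∈ K, R x ∈ K)
    (hK' : ∀ x ∈ Kᗮ, R x ∈ Kᗮ) : IsReducingFor A K :=
  ⟨h.isInvariantFor hK hK', h.isInvariantFor hK' fun x hx => by
    rw [Submodule.orthogonal_orthogonal] at hx ⊢; exact hK x hx⟩

/-- A reducing subspace is invariant for every resolvent. -/
lemma IsReducingFor.resolvent_mem (hK : IsReducingFor A K) (h : IsResolventAt A z R) {x : H}
    (hx : x ∈ K) : R x ∈ K := by
  obtain ⟨u, hu, hf⟩ := h.1 x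
  obtain ⟨hp, hAp⟩ := hK.1 u
  obtain ⟨hq, hAq⟩ := hK.2 u
  set p : A.domain := ⟨_, hp⟩
  set q : A.domain := ⟨_, hq⟩
  have hpq : u = p + q := Subtype.ext (K.starProjection_add_starProjection_orthogonal u).symm
  have hqK : A q - z • (q : H) ∈ K := by
    have : A q - z • (q : H) = x - (A p - z • (p : H)) := by
      rw [← hf, hpq, A.map_add, Submodule.coe_add, smul_add]; abel
    rw [this]
    exact K.sub_mem hx (K.sub_mem hAp (K.smul_mem z (K.starProjection_apply_mem _)))
  have hqK' : A q - z • (q : H) ∈ Kᗮ :=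
    Kᗮ.sub_mem hAq (Kᗮ.smul_mem z (Kᗮ.starProjection_apply_mem _))
  have h0 : A q - z • (q : H) = 0 :=
    inner_self_eq_zero.mp ((Submodule.mem_orthogonal _ _).mp hqK' _ hqK)
  have hq0 : (q : H) = 0 := by rw [← h.2 q, h0, map_zero]
  rw [← hu, hpq, Submodule.coe_add, hq0, add_zero]
  exact K.starProjection_apply_mem _

lemma IsReducingFor.orthogonal (hK : IsReducingFor A K) : IsReducingFor A Kᗮ := by
  refine ⟨hK.2, ?_⟩
  intro u
  obtain ⟨hp, h⟩ := hK.1 u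
  have e : Kᗮᗮ.starProjection (u : H) = K.starProjection (u : H) := by
    simp only [Submodule.orthogonal_orthogonal]
  rw [e]
  exact ⟨hp, by rwa [Submodule.orthogonal_orthogonal]⟩

end Restriction

/-- The restriction of a selfadjoint operator to a closed subspace which is invariant for the
resolvents at `z` and `z̄` is selfadjoint. -/
lemma _root_.IsSelfAdjoint.restrictTo [CompleteSpace H] (hL : IsSelfAdjoint L) {K : Submodule ℂ H}
    [CompleteSpace K] (hz : z.im ≠ 0) (h1 : ∀ x ∈ K, resolventOp L z x ∈ K)
    (h2 : ∀ x ∈ K, resolventOp L (starRingEnd ℂ z) x ∈ K) : IsSelfAdjoint (restrictTo L K) := by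
  refine isSelfAdjoint_of_symmetric (fun u v => ?_) hz ?_ ?_
  · obtain ⟨u', h1, h2⟩ := L.mem_graph_iff.mp (restrictTo_apply_mem_graph u)
    obtain ⟨v', h3, h4⟩ := L.mem_graph_iff.mp (restrictTo_apply_mem_graph v)
    have := hL.inner_apply u' v'
    rwa [h1, h2, h3, h4] at this
  · exact ((hL.isResolventAt hz).restrictTo h1).exists_sub_eq
  · exact ((hL.isResolventAt (z := starRingEnd ℂ z) (by simpa using hz)).restrictTo
      h2).exists_sub_eq

end OperatorTheory

/-! ### Integration by parts on the half-line -/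

section HalfLine

open Filter Topology AbsolutelyContinuousOnInterval

variable {F : Type*} [NormedAddCommGroup F] [InnerProductSpace ℂ F] [CompleteSpace F]

/-- A function whose increments are dominated by those of an absolutely continuous function is
absolutely continuous. -/
lemma absolutelyContinuousOnInterval_of_dist_le {X Y : Type*} [PseudoMetricSpace X]
    [PseudoMetricSpace Y] {f : ℝ → X} {g : ℝ → Y} {a b K : ℝ}
    (hg : AbsolutelyContinuousOnInterval g a b)
    (h : ∀ x ∈ uIcc a b, ∀ y ∈ uIcc a b, dist (f x) (f y) ≤ K * dist (g x) (g y)) :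
    AbsolutelyContinuousOnInterval f a b := by
  unfold AbsolutelyContinuousOnInterval at hg ⊢
  have hg' := hg.const_mul K
  rw [mul_zero] at hg'
  refine squeeze_zero' (Eventually.of_forall fun E => Finset.sum_nonneg fun _ _ => dist_nonneg)
    ?_ hg'
  refine Eventually.filter_mono inf_le_right (eventually_principal.mpr fun E hE => ?_)
  rw [Finset.mul_sum]
  exact Finset.sum_le_sum fun i hi => h _ (hE.1 i hi).1 _ (hE.1 i hi).2

lemma intervalIntegral_restrict_Ioi {w : ℝ → F} {x : ℝ} (hx : 0 ≤ x) :
    ∫ t in (0 : ℝ)..x, w t ∂volume.restrict (Ioi 0) = ∫ t in (0 : ℝ)..x, w t := by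
  rw [intervalIntegral.integral_of_le hx, intervalIntegral.integral_of_le hx,
    Measure.restrict_restrict measurableSet_Ioc, inter_eq_left.mpr Ioc_subset_Ioi_self]

/-- `HasDerivTrace` on the positive half-line in terms of Lebesgue measure. -/
lemma hasDerivTrace_Ioi_iff {v w : L2On (Ioi 0) F} {c : F} : HasDerivTrace (Ioi 0) v w c ↔
    ∀ᵐ x ∂volume.restrict (Ioi (0 : ℝ)), v x = c + ∫ t in (0 : ℝ)..x, w t := by
  refine eventually_congr ?_
  filter_upwards [ae_restrict_mem measurableSet_Ioi] with x hx
  rw [intervalIntegral_restrict_Ioi (le_of_lt hx)]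

/-- `2 Re ⟨v', v⟩ = -‖v(0)‖²` on the positive half-line: `‖v‖²` is absolutely continuous and
integrable. -/
lemma HasDerivTrace.re_inner {v w : L2On (Ioi 0) F} {c : F} (h : HasDerivTrace (Ioi 0) v w c) :
    2 * (inner ℂ v w : ℂ).re = -‖c‖ ^ 2 := by
  rw [hasDerivTrace_Ioi_iff] at h
  set g : ℝ → F := (Ioi (0 : ℝ)).indicator w with hg
  have hgl : LocallyIntegrable g volume :=
    ((memLp_indicator_iff_restrict measurableSet_Ioi).mpr (Lp.memLp w)).locallyIntegrable
      (by norm_num)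
  have hgi : ∀ a b : ℝ, IntervalIntegrable g volume a b := fun a b =>
    intervalIntegrable_iff.mpr
      ((hgl.integrableOn_isCompact isCompact_uIcc).mono_set uIoc_subset_uIcc)
  have hwg : ∀ x : ℝ, 0 < x → ∫ t in (0 : ℝ)..x, w t = ∫ t in (0 : ℝ)..x, g t := by
    intro x hx
    refine intervalIntegral.integral_congr_uIoo fun t ht => ?_
    rw [uIoo_of_le hx.le] at ht
    exact (indicator_of_mem (show t ∈ Ioi 0 from ht.1) _).symm
  set V : ℝ → F := fun x => c + ∫ t in (0 : ℝ)..x, g t with hV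
  have hvV : ∀ᵐ x ∂volume.restrict (Ioi (0 : ℝ)), v x = V x := by
    filter_upwards [h, ae_restrict_mem measurableSet_Ioi] with x h1 hx
    rw [h1, hwg x hx]
  have hVc : Continuous V :=
    continuous_const.add (intervalIntegral.continuous_primitive hgi 0)
  have hVd : ∀ᵐ x : ℝ, HasDerivAt V (g x) x := by
    filter_upwards [LocallyIntegrable.ae_hasDerivAt_integral hgl] with x hx
    exact (hx 0).const_add c
  set q : ℝ → ℝ := fun x => 2 * (inner ℂ (v x) (w x) : ℂ).re with hq
  have hqint : IntegrableOn q (Ioi 0) := (L2.integrable_inner (𝕜 := ℂ) v w).re.const_mul 2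
  -- the fundamental theorem of calculus for `‖V‖²`
  have hftc : ∀ b : ℝ, 0 < b → ∫ x in (0 : ℝ)..b, q x = ‖V b‖ ^ 2 - ‖c‖ ^ 2 := by
    intro b hb
    have hac1 : AbsolutelyContinuousOnInterval (fun x : ℝ => ∫ t in (0 : ℝ)..x, ‖g t‖) 0 b :=
      (hgi 0 b).norm.absolutelyContinuousOnInterval_intervalIntegral (by simp)
    obtain ⟨M, hM⟩ := (isCompact_uIcc (a := (0 : ℝ)) (b := b)).exists_bound_of_continuousOn
      hVc.continuousOn
    have hac : AbsolutelyContinuousOnInterval (fun x => ‖V x‖ ^ 2) 0 b := by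
      refine absolutelyContinuousOnInterval_of_dist_le (K := M + M) hac1 fun x hx y hy => ?_
      have h1 : ‖V x - V y‖ ≤ |(∫ t in (0 : ℝ)..x, ‖g t‖) - ∫ t in (0 : ℝ)..y, ‖g t‖| := by
        rw [hV]
        simp only [add_sub_add_left_eq_sub]
        rw [intervalIntegral.integral_interval_sub_left (hgi 0 x) (hgi 0 y),
          intervalIntegral.integral_interval_sub_left (hgi 0 x).norm (hgi 0 y).norm]
        exact intervalIntegral.norm_integral_le_abs_integral_norm
      rw [Real.dist_eq, Real.dist_eq]
      have h2 : |‖V x‖ - ‖V y‖| ≤ ‖V x - V y‖ := abs_norm_sub_norm_le _ _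
      have h3 : |‖V x‖ + ‖V y‖| ≤ M + M := by
        rw [abs_of_nonneg (by positivity)]
        exact add_le_add (hM x hx) (hM y hy)
      rw [sq_sub_sq, abs_mul]
      exact mul_le_mul h3 (h2.trans h1) (abs_nonneg _) ((abs_nonneg _).trans h3)
    have hd := hac.integral_deriv_eq_sub
    have hV0 : V 0 = c := by simp [hV]
    rw [hV0] at hd
    rw [← hd, intervalIntegral.integral_of_le hb.le, intervalIntegral.integral_of_le hb.le]
    refine setIntegral_congr_ae measurableSet_Ioc ?_
    have hvV' := (ae_restrict_iff' measurableSet_Ioi).mp hvV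
    filter_upwards [hVd, hvV'] with x h1 h2 hx
    have h3 : HasDerivAt (fun x => ‖V x‖ ^ 2) (2 * (inner ℂ (V x) (g x) : ℂ).re) x := by
      have h4 := Complex.reCLM.hasFDerivAt.comp_hasDerivAt x (h1.inner ℂ h1)
      have h5 : (inner ℂ (g x) (V x) : ℂ).re = (inner ℂ (V x) (g x) : ℂ).re :=
        inner_re_symm (𝕜 := ℂ) _ _
      simp only [Complex.reCLM_apply, Complex.add_re, h5, ← two_mul] at h4
      exact h4.congr_of_eventuallyEq
        (Eventually.of_forall fun y => (inner_self_eq_norm_sq (𝕜 := ℂ) (V y)).symm)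
    rw [h3.deriv, hq]
    simp only
    rw [h2 hx.1, hg, indicator_of_mem (show x ∈ Ioi 0 from hx.1)]
  have ht : Tendsto (fun b : ℝ => ∫ x in (0 : ℝ)..b, q x) atTop (𝓝 (∫ x in Ioi (0 : ℝ), q x)) :=
    intervalIntegral_tendsto_integral_Ioi 0 hqint tendsto_id
  have ht' : Tendsto (fun b : ℝ => ‖V b‖ ^ 2) atTop (𝓝 ((∫ x in Ioi (0 : ℝ), q x) + ‖c‖ ^ 2)) := by
    refine (ht.add_const (‖c‖ ^ 2)).congr' ?_
    filter_upwards [eventually_gt_atTop (0 : ℝ)] with b hb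
    rw [hftc b hb]; ring
  have hVint : IntegrableOn (fun x => ‖V x‖ ^ 2) (Ioi 0) := by
    have h1 : Integrable (fun x => ‖v x‖ ^ 2) (volume.restrict (Ioi (0 : ℝ))) :=
      (Lp.memLp v).integrable_norm_pow (by norm_num)
    refine h1.congr ?_
    filter_upwards [hvV] with x hx
    rw [hx]
  have hzero := IntegrableAtFilter.eq_zero_of_tendsto (μ := volume)
    ⟨Ioi 0, Ioi_mem_atTop 0, hVint⟩ (fun s hs => by
      rcases mem_atTop_sets.1 hs with ⟨b, hb⟩
      rw [← top_le_iff, ← Real.volume_Ici (a := b)]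
      exact measure_mono hb) ht'
  have hre : ∫ x in Ioi (0 : ℝ), q x = 2 * (inner ℂ v w : ℂ).re := by
    have h2 : ∫ x in Ioi (0 : ℝ), (inner ℂ (v x) (w x) : ℂ).re =
        (∫ x in Ioi (0 : ℝ), inner ℂ (v x) (w x) : ℂ).re :=
      integral_re (L2.integrable_inner (𝕜 := ℂ) v w)
    rw [hq, integral_const_mul, h2, L2.inner_def]
  linarith

/-- Integration by parts on the positive half-line. -/
lemma HasDerivTrace.inner_add_inner {v w v' w' : L2On (Ioi 0) F} {c c' : F}
    (h : HasDerivTrace (Ioi 0) v w c) (h' : HasDerivTrace (Ioi 0) v' w' c') :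
    inner ℂ v w' + inner ℂ w v' = -inner ℂ c c' := by
  have h0 := h.re_inner
  have h0' := h'.re_inner
  have h1 := (h.add h').re_inner
  have h2 := (h.add (h'.smul Complex.I)).re_inner
  have e : ∀ x : F, ‖x‖ ^ 2 = (inner ℂ x x : ℂ).re := fun x =>
    (inner_self_eq_norm_sq (𝕜 := ℂ) x).symm
  simp only [e, inner_add_left, inner_add_right, inner_smul_left, inner_smul_right,
    Complex.add_re, Complex.mul_re, Complex.mul_im, Complex.conj_re, Complex.conj_im, Complex.I_re,
    Complex.I_im, Complex.add_im] at h0 h0' h1 h2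
  rw [← inner_conj_symm v' w, ← inner_conj_symm c' c] at h1 h2
  simp only [Complex.conj_re, Complex.conj_im] at h1 h2
  apply Complex.ext
  · simp only [Complex.add_re, Complex.neg_re]
    have := congrArg Complex.re (inner_conj_symm (𝕜 := ℂ) w v')
    simp only [Complex.conj_re] at this
    linarith
  · simp only [Complex.add_im, Complex.neg_im]
    linarith

end HalfLine

section HalfLine

open Filter Topology

variable {F : Type*} [NormedAddCommGroup F] [InnerProductSpace ℂ F] [CompleteSpace F]

/-! ### Exponentials -/

lemma memLp_cexp_smul {s : ℂ} (hs : 0 < s.re) (d : F) :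
    MemLp (fun t : ℝ => Complex.exp (-s * t) • d) 2 (volume.restrict (Ioi 0)) := by
  rw [memLp_two_iff_integrable_sq_norm (by fun_prop)]
  have h := (exp_neg_integrableOn_Ioi 0 (b := 2 * s.re) (by linarith)).mul_const (‖d‖ ^ 2)
  refine h.congr (Eventually.of_forall fun t => ?_)
  simp only [norm_smul, Complex.norm_exp, mul_pow, ← Real.exp_nat_mul]
  congr 2
  simp
  ring

/-- The function `t ↦ e^{-st} d` on the positive half-line. -/
noncomputable def expo {s : ℂ} (hs : 0 < s.re) (d : F) : L2On (Ioi 0) F :=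
  (memLp_cexp_smul hs d).toLp _

lemma coeFn_expo {s : ℂ} (hs : 0 < s.re) (d : F) :
    expo hs d =ᵐ[volume.restrict (Ioi 0)] fun t : ℝ => Complex.exp (-s * t) • d :=
  MemLp.coeFn_toLp _

lemma hasDerivTrace_expo {s : ℂ} (hs : 0 < s.re) (d : F) :
    HasDerivTrace (Ioi 0) (expo hs d) (-s • expo hs d) d := by
  rw [hasDerivTrace_Ioi_iff]
  have he := (ae_restrict_iff' measurableSet_Ioi).mp
    ((Lp.coeFn_smul (-s) (expo hs d)).and (coeFn_expo hs d))
  filter_upwards [coeFn_expo hs d, ae_restrict_mem measurableSet_Ioi] with x hx hx0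
  have hd : ∀ t : ℝ, HasDerivAt (fun t : ℝ => Complex.exp (-s * t) • d)
      (-s • Complex.exp (-s * t) • d) t := by
    intro t
    have h1 : HasDerivAt (fun t : ℝ => -s * (t : ℂ)) (-s) t := by
      simpa using ((hasDerivAt_id t).ofReal_comp).const_mul (-s)
    have h2 := (h1.cexp).smul_const d
    rwa [mul_comm, mul_smul] at h2
  have hI : ∫ t in (0 : ℝ)..x, (-s • expo hs d : L2On (Ioi 0) F) t =
      ∫ t in (0 : ℝ)..x, -s • Complex.exp (-s * t) • d := by
    refine intervalIntegral.integral_congr_ae ?_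
    filter_upwards [he] with t ht htx
    rw [uIoc_of_le (le_of_lt hx0)] at htx
    obtain ⟨h1, h2⟩ := ht htx.1
    rw [h1, Pi.smul_apply, h2]
  rw [hx, hI, intervalIntegral.integral_eq_sub_of_hasDerivAt (fun t _ => hd t)
    (Continuous.intervalIntegrable (by fun_prop) _ _)]
  simp

lemma integrable_exp_mul_smul (h : L2On (Ioi 0) F) {s : ℝ} (hs : 0 < s) :
    Integrable (fun t : ℝ => Real.exp (-s * t) • h t) (volume.restrict (Ioi 0)) := by
  have h1 : MemLp (fun t : ℝ => Real.exp (-s * t)) 2 (volume.restrict (Ioi 0)) := by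
    rw [memLp_two_iff_integrable_sq_norm (by fun_prop)]
    refine (exp_neg_integrableOn_Ioi 0 (b := 2 * s) (by linarith)).congr
      (Eventually.of_forall fun t => ?_)
    simp only [Real.norm_eq_abs, sq_abs, ← Real.exp_nat_mul]
    congr 1
    push_cast
    ring
  have h2 := MemLp.smul (r := 1) (Lp.memLp h) h1
  exact memLp_one_iff_integrable.mp h2

lemma inner_expo {s : ℝ} (hs : 0 < ((s : ℝ) : ℂ).re) (d : F) (h : L2On (Ioi 0) F) :
    inner ℂ (expo hs d) h = inner ℂ d (∫ t in Ioi (0 : ℝ), Real.exp (-s * t) • h t) := by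
  rw [L2.inner_def, ← integral_inner (integrable_exp_mul_smul h (by simpa using hs))]
  refine integral_congr_ae ?_
  filter_upwards [coeFn_expo hs d] with t ht
  rw [ht, inner_smul_left, ← Complex.exp_conj, ← Complex.coe_smul, inner_smul_right,
    Complex.ofReal_exp]
  simp

/-- Uniqueness for the Laplace transform, from its values at real `s > s₀`. With `a(t) = e^{y(b-t)}` the exponential series of
`1 - e^{-a}` shows that `∫ (1 - e^{-a(t)}) h(t) dt = 0`, and as `y → ∞` the weight
`1 - e^{-a(t)}` tends to the indicator function of `t < b`. -/
lemma eq_zero_of_forall_integral_exp_smul_eq_zero {h : L2On (Ioi 0) F} {s₀ : ℝ}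
    (hh : ∀ s > s₀, ∫ t in Ioi (0 : ℝ), Real.exp (-s * t) • h t = 0) : h = 0 := by
  -- the weighted integrals vanish
  have key : ∀ b y : ℝ, 0 < y → s₀ < y →
      ∫ t in Ioi (0 : ℝ), (1 - Real.exp (-Real.exp (y * (b - t)))) • h t = 0 := by
    intro b y hy hy'
    set a : ℝ → ℝ := fun t => Real.exp (y * (b - t)) with ha
    have hapos : ∀ t, 0 < a t := fun t => Real.exp_pos _
    have hexp : ∀ x : ℝ, HasSum (fun k : ℕ => x ^ (k + 1) / ((k + 1).factorial : ℝ))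
        (Real.exp x - 1) := by
      intro x
      have h1 := NormedSpace.expSeries_div_hasSum_exp (𝔸 := ℝ) x
      rw [← Real.exp_eq_exp_ℝ] at h1
      have h2 := (hasSum_nat_add_iff' 1).mpr h1
      simpa using h2
    have hmeas : ∀ k : ℕ, AEStronglyMeasurable
        (fun t => -((-a t) ^ (k + 1) / ((k + 1).factorial : ℝ))) (volume.restrict (Ioi (0 : ℝ))) :=
      fun k => by fun_prop
    have hsum := hasSum_integral_of_dominated_convergence (μ := volume.restrict (Ioi (0 : ℝ)))
      (F := fun (k : ℕ) t => (-((-a t) ^ (k + 1) / ((k + 1).factorial : ℝ))) • h t)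
      (f := fun t => (1 - Real.exp (-a t)) • h t)
      (fun k t => a t ^ (k + 1) / ((k + 1).factorial : ℝ) * ‖h t‖)
      (fun k => (hmeas k).smul (Lp.aestronglyMeasurable h))
      (fun k => Eventually.of_forall fun t => by
        rw [norm_smul, norm_neg, norm_div, norm_pow, norm_neg, Real.norm_of_nonneg (hapos t).le]
        simp)
      (Eventually.of_forall fun t => ((hexp (a t)).mul_right ‖h t‖).summable)
      (by
        simp_rw [fun t => ((hexp (a t)).mul_right ‖h t‖).tsum_eq]
        have hdom := (integrable_exp_mul_smul h hy).norm.const_mul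
          (Real.exp (y * b) * Real.exp (Real.exp (y * b)))
        refine hdom.mono' ?_ ?_
        · exact AEStronglyMeasurable.mul (by fun_prop) (Lp.aestronglyMeasurable h).norm
        · filter_upwards [ae_restrict_mem measurableSet_Ioi] with t ht
          have h1 : Real.exp (a t) - 1 ≤ a t * Real.exp (a t) := by
            have h2 := Real.add_one_le_exp (-a t)
            have h3 := mul_le_mul_of_nonneg_right h2 (Real.exp_pos (a t)).le
            rw [← Real.exp_add, neg_add_cancel, Real.exp_zero] at h3
            linarith
          have h2 : a t = Real.exp (y * b) * Real.exp (-y * t) := by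
            rw [ha, ← Real.exp_add]; ring_nf
          have h3 : a t ≤ Real.exp (y * b) := by
            rw [ha]
            refine Real.exp_le_exp.mpr ?_
            have : 0 < y * t := mul_pos hy ht
            linarith
          have h0 : 0 ≤ Real.exp (a t) - 1 := by
            have := Real.one_le_exp (hapos t).le
            linarith
          rw [norm_mul, norm_norm, Real.norm_of_nonneg h0, norm_smul,
            Real.norm_of_nonneg (Real.exp_pos _).le]
          calc (Real.exp (a t) - 1) * ‖h t‖ ≤ (a t * Real.exp (Real.exp (y * b))) * ‖h t‖ := by
                refine mul_le_mul_of_nonneg_right (h1.trans ?_) (norm_nonneg _)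
                exact mul_le_mul_of_nonneg_left (Real.exp_le_exp.mpr h3) (hapos t).le
            _ = _ := by rw [h2]; ring)
      (Eventually.of_forall fun t => by
        have h1 := ((hexp (-a t)).neg).smul_const (h t)
        rwa [neg_sub] at h1)
    have hzero : ∀ k : ℕ, ∫ t in Ioi (0 : ℝ),
        (-((-a t) ^ (k + 1) / ((k + 1).factorial : ℝ))) • h t = 0 := by
      intro k
      have hk : s₀ < (k + 1 : ℕ) * y := by
        push_cast
        have : 0 ≤ (k : ℝ) * y := by positivity
        linarith
      have e : ∀ t : ℝ, (-((-a t) ^ (k + 1) / ((k + 1).factorial : ℝ))) • h t =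
          (-((-1) ^ (k + 1) * Real.exp ((k + 1 : ℕ) * (y * b)) / ((k + 1).factorial : ℝ))) •
            Real.exp (-((k + 1 : ℕ) * y) * t) • h t := by
        intro t
        rw [smul_smul, neg_pow, ha, ← Real.exp_nat_mul]
        congr 1
        have : Real.exp ((k + 1 : ℕ) * (y * (b - t))) =
            Real.exp ((k + 1 : ℕ) * (y * b)) * Real.exp (-((k + 1 : ℕ) * y) * t) := by
          rw [← Real.exp_add]; congr 1; ring
        rw [this]
        ring
      simp_rw [e]
      rw [integral_smul, hh _ hk, smul_zero]
    simp_rw [hzero] at hsum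
    exact hsum.unique hasSum_zero
  -- the limit `y → ∞`
  have hprim : ∀ b : ℝ, 0 < b → ∫ t in (0 : ℝ)..b, h t = 0 := by
    intro b hb
    have hmeas : ∀ n : ℕ, AEStronglyMeasurable
        (fun t : ℝ => 1 - Real.exp (-Real.exp (n * (b - t)))) (volume.restrict (Ioi (0 : ℝ))) :=
      fun n => by fun_prop
    have hlim := tendsto_integral_filter_of_dominated_convergence
      (μ := volume.restrict (Ioi (0 : ℝ))) (l := atTop)
      (F := fun (n : ℕ) t => (1 - Real.exp (-Real.exp (n * (b - t)))) • h t)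
      (f := fun t => (Iio b).indicator h t)
      (fun t => ‖Real.exp b • Real.exp (-1 * t) • h t‖)
      (Eventually.of_forall fun n => (hmeas n).smul (Lp.aestronglyMeasurable h))
      (by
        filter_upwards [eventually_ge_atTop 1] with n hn
        refine Eventually.of_forall fun t => ?_
        have hn' : (1 : ℝ) ≤ n := by exact_mod_cast hn
        rw [smul_smul, ← Real.exp_add, norm_smul, norm_smul]
        refine mul_le_mul_of_nonneg_right ?_ (norm_nonneg _)
        have h0 : 0 < Real.exp (n * (b - t)) := Real.exp_pos _
        have h1 : Real.exp (-Real.exp (n * (b - t))) ≤ 1 := by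
          rw [Real.exp_le_one_iff]; linarith
        rw [Real.norm_of_nonneg (by linarith), Real.norm_of_nonneg (Real.exp_pos _).le]
        rcases le_total t b with htb | htb
        · have h2 : 1 ≤ Real.exp (b + -1 * t) := Real.one_le_exp (by linarith)
          have h3 := Real.exp_pos (-Real.exp (n * (b - t)))
          linarith
        · have h2 : Real.exp (n * (b - t)) ≤ Real.exp (b + -1 * t) :=
            Real.exp_le_exp.mpr (by nlinarith)
          have h3 := Real.add_one_le_exp (-Real.exp (n * (b - t)))
          linarith)
      ((integrable_exp_mul_smul h one_pos).smul (Real.exp b)).norm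
      (by
        have hne : ∀ᵐ t ∂volume.restrict (Ioi (0 : ℝ)), t ≠ b := by
          refine ae_restrict_of_ae ?_
          rw [ae_iff]
          simp
        filter_upwards [hne] with t ht
        have hcast : Tendsto (fun n : ℕ => (n : ℝ)) atTop atTop := tendsto_natCast_atTop_atTop
        rcases lt_or_gt_of_ne ht with htb | htb
        · rw [indicator_of_mem (show t ∈ Iio b from htb)]
          have h1 : Tendsto (fun n : ℕ => Real.exp (-Real.exp (n * (b - t)))) atTop (𝓝 0) :=
            Real.tendsto_exp_neg_atTop_nhds_zero.comp
              (Real.tendsto_exp_atTop.comp (hcast.atTop_mul_const (by linarith)))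
          simpa using (h1.const_sub 1).smul_const (h t)
        · rw [indicator_of_notMem (by simp [htb.le])]
          have h1 : Tendsto (fun n : ℕ => Real.exp (n * (b - t))) atTop (𝓝 0) :=
            Real.tendsto_exp_atBot.comp (hcast.atTop_mul_const_of_neg (by linarith))
          have h2 := (Real.continuous_exp.tendsto (-0)).comp h1.neg
          simpa using (h2.const_sub 1).smul_const (h t))
    have hev : ∀ᶠ n : ℕ in atTop,
        ∫ t in Ioi (0 : ℝ), (1 - Real.exp (-Real.exp (n * (b - t)))) • h t = 0 := by
      have hcast : Tendsto (fun n : ℕ => (n : ℝ)) atTop atTop := tendsto_natCast_atTop_atTop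
      filter_upwards [hcast.eventually_gt_atTop 0, hcast.eventually_gt_atTop s₀] with n h1 h2
      exact key b n h1 h2
    have h0 := tendsto_nhds_unique (hlim.congr' hev) tendsto_const_nhds
    rw [integral_indicator measurableSet_Iio, Measure.restrict_restrict measurableSet_Iio,
      Iio_inter_Ioi] at h0
    rw [intervalIntegral.integral_of_le hb.le, integral_Ioc_eq_integral_Ioo, h0]
  have htrace : HasDerivTrace (Ioi 0) (0 : L2On (Ioi 0) F) h 0 := by
    rw [hasDerivTrace_Ioi_iff]
    filter_upwards [Lp.coeFn_zero F 2 (volume.restrict (Ioi (0 : ℝ))),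
      ae_restrict_mem measurableSet_Ioi] with x hx hx0
    rw [hx, hprim x hx0]
    simp
  exact (htrace.eq_zero isOpen_Ioi zero_mem_closure_Ioi).1

end HalfLine

section HalfLine

open Filter Topology

variable {F : Type*} [NormedAddCommGroup F] [InnerProductSpace ℂ F] [CompleteSpace F]

/-- Exponentials `e^{-st} d` with large real `s` span a dense subspace of `L²(ℝ⁺, F)`. -/
lemma eq_zero_of_forall_inner_expo {h : L2On (Ioi 0) F} (s₀ : ℝ)
    (hh : ∀ (s : ℝ) (hs : 0 < ((s : ℝ) : ℂ).re), s₀ < s → ∀ d : F, inner ℂ (expo hs d) h = 0) :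
    h = 0 := by
  refine eq_zero_of_forall_integral_exp_smul_eq_zero (s₀ := max s₀ 0) fun s hs => ?_
  have hs0 : 0 < ((s : ℝ) : ℂ).re := by simpa using (le_max_right s₀ 0).trans_lt hs
  refine inner_self_eq_zero (𝕜 := ℂ).mp ?_
  rw [← inner_expo hs0]
  exact hh s hs0 ((le_max_left _ _).trans_lt hs) _

/-! ### The differential equation `v' = ζ v + g` -/

/-- All `(v, v', v(0))` with `v ∈ H¹(ℝ⁺, F)`. -/
def derivTraceGraph (F : Type*) [NormedAddCommGroup F] [InnerProductSpace ℂ F] [CompleteSpace F] :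
    Submodule ℂ (L2On (Ioi 0) F × L2On (Ioi 0) F × F) where
  carrier := {p | HasDerivTrace (Ioi 0) p.1 p.2.1 p.2.2}
  zero_mem' := HasDerivTrace.zero _
  add_mem' h h' := h.add h'
  smul_mem' a _ h := h.smul a

lemma isClosed_derivTraceGraph :
    IsClosed (derivTraceGraph F : Set (L2On (Ioi 0) F × L2On (Ioi 0) F × F)) := by
  refine IsSeqClosed.isClosed fun p q hp hpq => ?_
  have h1 : Tendsto (fun n => (p n).1) atTop (𝓝 q.1) := (continuous_fst.tendsto q).comp hpq
  have h2 : Tendsto (fun n => (p n).2.1) atTop (𝓝 q.2.1) :=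
    ((continuous_fst.comp continuous_snd).tendsto q).comp hpq
  have h3 : Tendsto (fun n => (p n).2.2) atTop (𝓝 q.2.2) :=
    ((continuous_snd.comp continuous_snd).tendsto q).comp hpq
  obtain ⟨ns, hns, hae⟩ := (tendstoInMeasure_of_tendsto_Lp h1).exists_seq_tendsto_ae
  have hall : ∀ᵐ x ∂volume.restrict (Ioi (0 : ℝ)), ∀ n, (p n).1 x =
      (p n).2.2 + ∫ t in (0 : ℝ)..x, (p n).2.1 t :=
    ae_all_iff.mpr fun n => hasDerivTrace_Ioi_iff.mp (hp n)
  refine hasDerivTrace_Ioi_iff.mpr ?_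
  filter_upwards [hae, hall, ae_restrict_mem measurableSet_Ioi] with x hx hx' hx0
  refine ext_inner_left ℂ fun d => ?_
  -- the value of the primitive at `x`, tested against `d`, is a continuous functional
  have hfun : ∀ w : L2On (Ioi 0) F, inner ℂ d (∫ t in (0 : ℝ)..x, w t) =
      inner ℂ (indicatorConstLp 2 (μ := volume.restrict (Ioi (0 : ℝ))) (measurableSet_Ioc (a := 0)
        (b := x)) (by simp) d) w := by
    intro w
    rw [L2.inner_indicatorConstLp_eq_inner_setIntegral, intervalIntegral.integral_of_le hx0.le,
      Measure.restrict_restrict measurableSet_Ioc, inter_eq_left.mpr Ioc_subset_Ioi_self]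
  have l1 : Tendsto (fun n => inner ℂ d ((p (ns n)).1 x)) atTop (𝓝 (inner ℂ d (q.1 x))) :=
    tendsto_const_nhds.inner hx
  have l2 : Tendsto (fun n => inner ℂ d ((p (ns n)).1 x)) atTop
      (𝓝 (inner ℂ d (q.2.2 + ∫ t in (0 : ℝ)..x, q.2.1 t))) := by
    simp_rw [hx', inner_add_right, hfun]
    exact (tendsto_const_nhds.inner (h3.comp hns.tendsto_atTop)).add
      (tendsto_const_nhds.inner (h2.comp hns.tendsto_atTop))
  exact tendsto_nhds_unique l1 l2

/-- The energy estimate for `v' = ζ v + g`. -/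
lemma norm_le_of_energy {v w : L2On (Ioi 0) F} {c : F} {ζ : ℂ} {a : ℝ} (ha : 0 < a)
    (h : 2 * a * ‖v‖ ^ 2 + ‖c‖ ^ 2 ≤ 2 * ‖v‖ * ‖w - ζ • v‖) :
    ‖(v, w, c)‖ ≤ (1 / a + (‖ζ‖ / a + 1) + (1 + 1 / a)) * ‖w - ζ • v‖ := by
  set g := w - ζ • v with hg
  have hv : ‖v‖ ≤ 1 / a * ‖g‖ := by
    rcases eq_or_ne ‖v‖ 0 with h0 | h0
    · rw [h0]; positivity
    have hpos : 0 < ‖v‖ := lt_of_le_of_ne (norm_nonneg _) (Ne.symm h0)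
    rw [one_div, inv_mul_eq_div, le_div_iff₀ ha]
    refine le_of_mul_le_mul_left ?_ hpos
    nlinarith [sq_nonneg ‖c‖]
  have hw : ‖w‖ ≤ (‖ζ‖ / a + 1) * ‖g‖ := by
    calc ‖w‖ = ‖ζ • v + g‖ := by rw [hg, add_sub_cancel]
      _ ≤ ‖ζ‖ * ‖v‖ + ‖g‖ := (norm_add_le _ _).trans_eq (by rw [norm_smul])
      _ ≤ ‖ζ‖ * (1 / a * ‖g‖) + ‖g‖ := by gcongr
      _ = _ := by ring
  have hc : ‖c‖ ≤ (1 + 1 / a) * ‖g‖ := by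
    refine le_of_sq_le_sq ?_ (by positivity)
    have h1 : ‖c‖ ^ 2 ≤ 2 * (1 / a * ‖g‖) * ‖g‖ := by
      have h2 : 2 * ‖v‖ * ‖g‖ ≤ 2 * (1 / a * ‖g‖) * ‖g‖ := by gcongr
      have h3 : 0 ≤ 2 * a * ‖v‖ ^ 2 := by positivity
      linarith
    nlinarith [sq_nonneg ‖g‖, mul_nonneg (sq_nonneg (1 / a)) (sq_nonneg ‖g‖)]
  have p1 : 0 ≤ 1 / a * ‖g‖ := by positivity
  have p2 : 0 ≤ (‖ζ‖ / a + 1) * ‖g‖ := by positivity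
  have p3 : 0 ≤ (1 + 1 / a) * ‖g‖ := by positivity
  rw [Prod.norm_def, Prod.norm_def, add_mul, add_mul]
  exact max_le (by linarith) (max_le (by linarith) (by linarith))

lemma HasDerivTrace.energy {v w : L2On (Ioi 0) F} {c : F} (h : HasDerivTrace (Ioi 0) v w c)
    (ζ : ℂ) : 2 * ζ.re * ‖v‖ ^ 2 + ‖c‖ ^ 2 = -2 * (inner ℂ v (w - ζ • v) : ℂ).re := by
  have h1 := h.re_inner
  have h2 : (inner ℂ v v : ℂ).re = ‖v‖ ^ 2 := inner_self_eq_norm_sq (𝕜 := ℂ) v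
  have h3 : (inner ℂ v v : ℂ).im = 0 := inner_self_im (𝕜 := ℂ) v
  rw [inner_sub_right, inner_smul_right, Complex.sub_re, Complex.mul_re, h2, h3]
  linarith

lemma abs_re_inner_le {H : Type*} [NormedAddCommGroup H] [InnerProductSpace ℂ H] (x y : H) :
    |(inner ℂ x y : ℂ).re| ≤ ‖x‖ * ‖y‖ :=
  (Complex.abs_re_le_norm _).trans (norm_inner_le_norm x y)

/-- If a closed space `p` of triples `(v, v', v(0))` contains solutions of `v' = ζ v + g` for
all exponentials `g`, and the energy estimate holds on `p`, then it contains solutions for all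
`g`. -/
lemma exists_solution_of_closed {p : Submodule ℂ (L2On (Ioi 0) F × L2On (Ioi 0) F × F)}
    (hp : IsClosed (p : Set (L2On (Ioi 0) F × L2On (Ioi 0) F × F))) {ζ : ℂ} {a : ℝ} (ha : 0 < a)
    (hen : ∀ q ∈ p, 2 * a * ‖q.1‖ ^ 2 + ‖q.2.2‖ ^ 2 ≤ 2 * ‖q.1‖ * ‖q.2.1 - ζ • q.1‖) (s₀ : ℝ)
    (hexp : ∀ (s : ℝ) (hs : 0 < ((s : ℝ) : ℂ).re), s₀ < s → ∀ d : F,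
      ∃ q ∈ p, q.2.1 - ζ • q.1 = expo hs d) (g : L2On (Ioi 0) F) :
    ∃ q ∈ p, q.2.1 = ζ • q.1 + g := by
  set T : L2On (Ioi 0) F × L2On (Ioi 0) F × F →L[ℂ] L2On (Ioi 0) F :=
    ContinuousLinearMap.fst ℂ _ _ ∘L ContinuousLinearMap.snd ℂ _ _ -
      ζ • ContinuousLinearMap.fst ℂ _ _
  have hclosed := isClosed_map_of_bound T hp
    (C := 1 / a + (‖ζ‖ / a + 1) + (1 + 1 / a)) (by positivity)
    fun q hq => norm_le_of_energy ha (hen q hq)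
  have : CompleteSpace (p.map T.toLinearMap) := hclosed.completeSpace_coe
  have htop : p.map T.toLinearMap = ⊤ := by
    rw [← Submodule.orthogonal_eq_bot_iff, Submodule.eq_bot_iff]
    intro h hh
    refine eq_zero_of_forall_inner_expo s₀ fun s hs hss d => ?_
    obtain ⟨q, hq, he⟩ := hexp s hs hss d
    exact (Submodule.mem_orthogonal _ _).mp hh _ ⟨q, hq, he⟩
  have hg : g ∈ p.map T.toLinearMap := htop ▸ Submodule.mem_top
  obtain ⟨q, hq, he⟩ := hg
  refine ⟨q, hq, ?_⟩
  rw [← he]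
  simp [T]

/-- For `Re ζ > 0` the equation `v' = ζ v + g` has a solution in `H¹(ℝ⁺, F)`. -/
lemma exists_hasDerivTrace_of_re_pos {ζ : ℂ} (hζ : 0 < ζ.re) (g : L2On (Ioi 0) F) :
    ∃ v c, HasDerivTrace (Ioi 0) v (ζ • v + g) c := by
  suffices h : ∃ q ∈ derivTraceGraph F, q.2.1 = ζ • q.1 + g by
    obtain ⟨q, hq, he⟩ := h
    exact ⟨q.1, q.2.2, he ▸ hq⟩
  refine exists_solution_of_closed isClosed_derivTraceGraph hζ (fun q hq => ?_) 0
    (fun s hs _ d => ?_) g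
  · have h1 := HasDerivTrace.energy hq ζ
    have h2 := neg_abs_le (inner ℂ q.1 (q.2.1 - ζ • q.1) : ℂ).re
    have h3 := abs_re_inner_le q.1 (q.2.1 - ζ • q.1)
    linarith
  · have hne : (s : ℂ) + ζ ≠ 0 := by
      intro h
      have := congrArg Complex.re h
      rw [Complex.add_re, Complex.zero_re] at this
      linarith
    -- `v = -(s + ζ)⁻¹ e^{-st} d` solves `v' = ζ v + e^{-st} d`
    refine ⟨(-((s : ℂ) + ζ)⁻¹) • (expo hs d, -(s : ℂ) • expo hs d, d),
      (derivTraceGraph F).smul_mem _ (hasDerivTrace_expo hs d), ?_⟩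
    simp only [Prod.smul_mk]
    rw [smul_comm ζ, ← smul_sub, ← sub_smul, smul_smul]
    have : -((s : ℂ) + ζ)⁻¹ * (-(s : ℂ) - ζ) = 1 := by field_simp; ring
    rw [this, one_smul]

/-- For `Re ζ < 0` the equation `v' = ζ v + g` has a solution in `H¹(ℝ⁺, F)` with any prescribed
value at `0`. -/
lemma exists_hasDerivTrace_of_re_neg {ζ : ℂ} (hζ : ζ.re < 0) (g : L2On (Ioi 0) F) (c : F) :
    ∃ v, HasDerivTrace (Ioi 0) v (ζ • v + g) c := by
  set p : Submodule ℂ (L2On (Ioi 0) F × L2On (Ioi 0) F × F) := derivTraceGraph F ⊓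
    ((ContinuousLinearMap.snd ℂ _ _ ∘L ContinuousLinearMap.snd ℂ _ _ :
      L2On (Ioi 0) F × L2On (Ioi 0) F × F →L[ℂ] F).ker) with hpdef
  have hp : IsClosed (p : Set (L2On (Ioi 0) F × L2On (Ioi 0) F × F)) :=
    isClosed_derivTraceGraph.inter (ContinuousLinearMap.isClosed_ker _)
  have hζ' : 0 < (-ζ).re := by simpa using hζ
  have hc : HasDerivTrace (Ioi 0) (expo hζ' c) (ζ • expo hζ' c) c := by
    simpa using hasDerivTrace_expo hζ' c
  -- a solution with value `0`, corrected by the homogeneous solution `e^{ζt} c`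
  suffices h : ∃ q ∈ p, q.2.1 = ζ • q.1 + g by
    obtain ⟨q, hq, he⟩ := h
    have hq0 : q.2.2 = 0 := hq.2
    refine ⟨q.1 + expo hζ' c, ?_⟩
    have h1 : HasDerivTrace (Ioi 0) q.1 (ζ • q.1 + g) 0 := he ▸ hq0 ▸ hq.1
    have h2 := h1.add hc
    rw [zero_add] at h2
    convert h2 using 1
    rw [smul_add]; abel
  refine exists_solution_of_closed hp hζ' (fun q hq => ?_) ‖ζ‖ (fun s hs hss d => ?_) g
  · have hq0 : q.2.2 = 0 := hq.2
    have h1 := HasDerivTrace.energy hq.1 ζ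
    have h2 := le_abs_self (inner ℂ q.1 (q.2.1 - ζ • q.1) : ℂ).re
    have h3 := abs_re_inner_le q.1 (q.2.1 - ζ • q.1)
    rw [hq0, norm_zero] at h1 ⊢
    rw [Complex.neg_re]
    linarith
  · have hne : (s : ℂ) + ζ ≠ 0 := by
      intro h
      have h1 : (s : ℂ) = -ζ := eq_neg_of_add_eq_zero_left h
      have h2 := congrArg norm h1
      rw [norm_neg, Complex.norm_real] at h2
      exact absurd hss (not_lt.mpr (h2 ▸ Real.le_norm_self s))
    have hd : HasDerivTrace (Ioi 0) (expo hζ' d) (ζ • expo hζ' d) d := by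
      simpa using hasDerivTrace_expo hζ' d
    -- subtracting the homogeneous solution `e^{ζt} d` makes the value at `0` vanish
    refine ⟨(-((s : ℂ) + ζ)⁻¹) • ((expo hs d, -(s : ℂ) • expo hs d, d) -
      (expo hζ' d, ζ • expo hζ' d, d)), p.smul_mem _ ⟨?_, ?_⟩, ?_⟩
    · exact (derivTraceGraph F).sub_mem (hasDerivTrace_expo hs d) hd
    · simp
    · simp only [Prod.smul_mk, Prod.mk_sub_mk]
      rw [smul_comm ζ, ← smul_sub, smul_sub ζ, sub_sub_sub_cancel_right, ← sub_smul, smul_smul]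
      have : -((s : ℂ) + ζ)⁻¹ * (-(s : ℂ) - ζ) = 1 := by field_simp; ring
      rw [this, one_smul]

/-! ### Reflection -/

lemma measurePreserving_neg_Ioi :
    MeasurePreserving (Neg.neg : ℝ → ℝ) (volume.restrict (Ioi 0)) (volume.restrict (Iio 0)) := by
  have h := (Measure.measurePreserving_neg (volume : Measure ℝ)).restrict_preimage
    (measurableSet_Iio (a := (0 : ℝ)))
  rwa [show (Neg.neg : ℝ → ℝ) ⁻¹' Iio 0 = Ioi 0 by ext x; simp] at h

lemma measurePreserving_neg_Iio :
    MeasurePreserving (Neg.neg : ℝ → ℝ) (volume.restrict (Iio 0)) (volume.restrict (Ioi 0)) := by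
  have h := (Measure.measurePreserving_neg (volume : Measure ℝ)).restrict_preimage
    (measurableSet_Ioi (a := (0 : ℝ)))
  rwa [show (Neg.neg : ℝ → ℝ) ⁻¹' Ioi 0 = Iio 0 by ext x; simp] at h

/-- The reflection `v ↦ v(-·)` from `L²(t, F)` to `L²(s, F)`, where `t = -s`. -/
noncomputable def reflect {s t : Set ℝ}
    (h : MeasurePreserving (Neg.neg : ℝ → ℝ) (volume.restrict s) (volume.restrict t)) :
    L2On t F →ₗᵢ[ℂ] L2On s F :=
  Lp.compMeasurePreservingₗᵢ ℂ Neg.neg h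

lemma coeFn_reflect {s t : Set ℝ}
    (h : MeasurePreserving (Neg.neg : ℝ → ℝ) (volume.restrict s) (volume.restrict t))
    (v : L2On t F) : reflect h v =ᵐ[volume.restrict s] fun x => v (-x) :=
  Lp.coeFn_compMeasurePreserving v h

lemma HasDerivTrace.reflect {s t : Set ℝ}
    (h : MeasurePreserving (Neg.neg : ℝ → ℝ) (volume.restrict s) (volume.restrict t))
    {v w : L2On t F} {c : F} (hv : HasDerivTrace t v w c) :
    HasDerivTrace s (reflect h v) (-reflect h w) c := by
  have hI : ∀ a b : ℝ, ∫ x in Ioc a b, w (-x) ∂volume.restrict s =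
      ∫ x in Ioc (-b) (-a), w x ∂volume.restrict t := by
    intro a b
    have h1 := h.setIntegral_preimage_emb (Homeomorph.neg ℝ).measurableEmbedding w (Ico (-b) (-a))
    have h2 : (Neg.neg : ℝ → ℝ) ⁻¹' Ico (-b) (-a) = Ioc a b := by
      ext x; simp [and_comm]
    rw [h2] at h1
    rw [h1]
    exact setIntegral_congr_set Ico_ae_eq_Ioc
  filter_upwards [coeFn_reflect h v, h.quasiMeasurePreserving.ae hv] with x hx hx'
  rw [hx, hx']
  congr 1
  have h3 : ∫ y in (0 : ℝ)..x, (-DissipativeDilation.reflect h w : L2On s F) y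
      ∂volume.restrict s = ∫ y in (0 : ℝ)..x, -w (-y) ∂volume.restrict s := by
    refine intervalIntegral.integral_congr_ae ?_
    filter_upwards [Lp.coeFn_neg (DissipativeDilation.reflect h w), coeFn_reflect h w]
      with y h1 h2 _
    rw [h1, Pi.neg_apply, h2]
  rw [h3, intervalIntegral.integral_neg, intervalIntegral, intervalIntegral, hI, hI, neg_zero,
    neg_sub]

lemma reflect_reflect (v : L2On (Iio 0) F) :
    reflect measurePreserving_neg_Iio (reflect measurePreserving_neg_Ioi v) = v := by
  refine Lp.ext ?_
  filter_upwards [coeFn_reflect measurePreserving_neg_Iio (reflect measurePreserving_neg_Ioi v),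
    measurePreserving_neg_Iio.quasiMeasurePreserving.ae
      (coeFn_reflect measurePreserving_neg_Ioi v)] with x h1 h2
  rw [h1, h2, neg_neg]

/-- Integration by parts on the negative half-line. -/
lemma HasDerivTrace.inner_add_inner_neg {v w v' w' : L2On (Iio 0) F} {c c' : F}
    (h : HasDerivTrace (Iio 0) v w c) (h' : HasDerivTrace (Iio 0) v' w' c') :
    inner ℂ v w' + inner ℂ w v' = inner ℂ c c' := by
  have := (h.reflect measurePreserving_neg_Ioi).inner_add_inner
    (h'.reflect measurePreserving_neg_Ioi)
  simp only [inner_neg_right, inner_neg_left, LinearIsometry.inner_map_map] at this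
  linear_combination -this

lemma HasDerivTrace.of_reflect {v : L2On (Ioi 0) F} {c : F} {ζ : ℂ} {g : L2On (Iio 0) F}
    (h : HasDerivTrace (Ioi 0) v (-ζ • v + -DissipativeDilation.reflect measurePreserving_neg_Ioi g)
      c) :
    HasDerivTrace (Iio 0) (DissipativeDilation.reflect measurePreserving_neg_Iio v)
      (ζ • DissipativeDilation.reflect measurePreserving_neg_Iio v + g) c := by
  have := h.reflect measurePreserving_neg_Iio
  simpa only [map_add, map_smul, map_neg, neg_smul, neg_add, neg_neg, reflect_reflect] using this

lemma exists_hasDerivTrace_Iio_of_re_neg {ζ : ℂ} (hζ : ζ.re < 0) (g : L2On (Iio 0) F) :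
    ∃ v c, HasDerivTrace (Iio 0) v (ζ • v + g) c := by
  obtain ⟨v, c, h⟩ := exists_hasDerivTrace_of_re_pos (ζ := -ζ) (by simpa using hζ)
    (-reflect measurePreserving_neg_Ioi g)
  exact ⟨_, c, h.of_reflect⟩

lemma exists_hasDerivTrace_Iio_of_re_pos {ζ : ℂ} (hζ : 0 < ζ.re) (g : L2On (Iio 0) F) (c : F) :
    ∃ v, HasDerivTrace (Iio 0) v (ζ • v + g) c := by
  obtain ⟨v, h⟩ := exists_hasDerivTrace_of_re_neg (ζ := -ζ) (by simpa using hζ)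
    (-reflect measurePreserving_neg_Ioi g) c
  exact ⟨_, h.of_reflect⟩

end HalfLine

/-! ### Boundary pairs and the node relation -/

section BoundaryPairs

variable {H : Type*} [NormedAddCommGroup H] [InnerProductSpace ℂ H]
variable {E : Type*} [NormedAddCommGroup E] [InnerProductSpace ℂ E]
variable {Es : Type*} [NormedAddCommGroup Es] [InnerProductSpace ℂ Es]

lemma IsLagrangeMap.two_mul_im_inner {B : H →ₗ.[ℂ] H} {Γ : B.domain →ₗ[ℂ] E} {r : ℝ}
    (hΓ : IsLagrangeMap B Γ (r * Complex.I)) (u : B.domain) :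
    2 * (inner ℂ (u : H) (B u) : ℂ).im = r * ‖Γ u‖ ^ 2 := by
  have h := congrArg Complex.im (hΓ.lagrange u u)
  have h1 : (inner ℂ (Γ u) (Γ u) : ℂ).re = ‖Γ u‖ ^ 2 := inner_self_eq_norm_sq (𝕜 := ℂ) _
  rw [← inner_conj_symm (B u) (u : H), Complex.sub_im, Complex.conj_im, mul_assoc,
    Complex.im_ofReal_mul, Complex.I_mul_im, h1] at h
  linarith

/-- The graph norm bound of `Γ` makes `Γ (B - z)⁻¹` a bounded operator. -/
lemma IsLagrangeMap.compResolvent_apply {B : H →ₗ.[ℂ] H} {Γ : B.domain →ₗ[ℂ] E} {c z : ℂ}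
    (hΓ : IsLagrangeMap B Γ c) (hz : IsResolventAt B z (resolventOp B z)) (u : B.domain) :
    compResolvent B Γ z (B u - z • (u : H)) = Γ u := by
  obtain ⟨C, hC⟩ := hΓ.bounded
  set R := resolventOp B z
  let G₀ : H →ₗ[ℂ] E := Γ ∘ₗ (R.toLinearMap.codRestrict B.domain hz.mem_domain)
  have hb : ∀ f, ‖G₀ f‖ ≤ (|C| * (‖R‖ + (1 + ‖z‖ * ‖R‖))) * ‖f‖ := by
    intro f
    have h1 := hC ⟨R f, hz.mem_domain f⟩
    rw [hz.apply] at h1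
    have h2 : ‖R f‖ ≤ ‖R‖ * ‖f‖ := R.le_opNorm f
    have h3 : ‖f + z • R f‖ ≤ ‖f‖ + ‖z‖ * (‖R‖ * ‖f‖) := by
      refine (norm_add_le _ _).trans ?_
      rw [norm_smul]
      gcongr
    calc ‖G₀ f‖ ≤ C * (‖R f‖ + ‖f + z • R f‖) := h1
      _ ≤ |C| * (‖R‖ * ‖f‖ + (‖f‖ + ‖z‖ * (‖R‖ * ‖f‖))) := by
        gcongr
        exact le_abs_self C
      _ = _ := by ring
  have hex : ∃ G : H →L[ℂ] E, ∀ f : H, ∃ u : B.domain,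
      (u : H) = resolventOp B z f ∧ G f = Γ u :=
    ⟨G₀.mkContinuous _ hb, fun f => ⟨⟨R f, hz.mem_domain f⟩, rfl, rfl⟩⟩
  unfold compResolvent
  rw [dif_pos hex]
  obtain ⟨v, hv, hG⟩ := hex.choose_spec (B u - z • (u : H))
  rw [hG]
  congr 1
  exact Subtype.ext (hv.trans (hz.2 u))

lemma DenseRange.eq_of_inner_eq {X : Type*} {f : X → E} (hf : DenseRange f) {x y : E}
    (h : ∀ u, inner ℂ (f u) x = inner ℂ (f u) y) : x = y :=
  Dense.eq_of_inner_right ℂ (S := Set.range f) hf (by rintro _ ⟨u, rfl⟩; exact h u)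

/-- Two operators `A`, `B` adjoint to each other, with Lagrange maps `Γ`, `Γ_*`, such that the
half-plane `σ Im z < 0` belongs to the resolvent set of `A` and `σ Im z > 0` to that of `B`. For
`σ = 1` this is a maximal dissipative operator `A` with `B = A*`; the notion is symmetric under the
exchange of `(A, Γ)` and `(B, Γ_*)` together with a change of sign of `σ`. -/
structure BoundaryPair (σ : ℝ) (A B : H →ₗ.[ℂ] H) (Γ : A.domain →ₗ[ℂ] E)
    (Γs : B.domain →ₗ[ℂ] Es) : Prop where
  sign : σ = 1 ∨ σ = -1
  formal : ∀ (u : A.domain) (w : B.domain), inner ℂ (A u) (w : H) = inner ℂ (u : H) (B w)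
  resA : ∀ z : ℂ, σ * z.im < 0 → IsResolventAt A z (resolventOp A z)
  resB : ∀ z : ℂ, 0 < σ * z.im → IsResolventAt B z (resolventOp B z)
  lagA : IsLagrangeMap A Γ (σ * Complex.I)
  lagB : IsLagrangeMap B Γs ((-σ : ℝ) * Complex.I)

lemma IsMaximalDissipative.boundaryPair [CompleteSpace H] {A : H →ₗ.[ℂ] H}
    (hA : IsMaximalDissipative A) {Γ : A.domain →ₗ[ℂ] E} (hΓ : IsLagrangeMap A Γ Complex.I)
    {Γs : A.adjoint.domain →ₗ[ℂ] Es} (hΓs : IsLagrangeMap A.adjoint Γs (-Complex.I)) :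
    BoundaryPair 1 A A.adjoint Γ Γs where
  sign := Or.inl rfl
  formal := (LinearPMap.adjoint_isFormalAdjoint hA.1.1).symm
  resA z hz := by
    obtain ⟨R, hR⟩ := hA.exists_isResolventAt (by simpa using hz)
    exact hR.resolventOp
  resB z hz := by
    obtain ⟨R, hR⟩ := hA.exists_isResolventAt (z := starRingEnd ℂ z) (by simpa using hz)
    have := hR.adjoint hA.1.1
    rw [Complex.conj_conj] at this
    exact this.resolventOp
  lagA := by simpa using hΓ
  lagB := by simpa using hΓs

/-- The relation between the values `e₋`, `e₊` at `0` of the outer components of a vector in the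
domain of the dilation, its middle component `u`, and the middle component `f` of its image, in weak
form: Green's formula against `D(B)` and against `D(A)`. -/
def NodeRel (A B : H →ₗ.[ℂ] H) (Γ : A.domain →ₗ[ℂ] E) (Γs : B.domain →ₗ[ℂ] Es) (em : Es) (u : H)
    (ep : E) (f : H) : Prop :=
  (∀ w : B.domain, inner ℂ (w : H) f - inner ℂ (B w) u = inner ℂ (Γs w) em) ∧
    ∀ v : A.domain, inner ℂ (v : H) f - inner ℂ (A v) u = inner ℂ (Γ v) ep

variable {σ : ℝ} {A B : H →ₗ.[ℂ] H} {Γ : A.domain →ₗ[ℂ] E} {Γs : B.domain →ₗ[ℂ] Es} {z : ℂ}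

lemma NodeRel.symm {em : Es} {u : H} {ep : E} {f : H} (h : NodeRel A B Γ Γs em u ep f) :
    NodeRel B A Γs Γ ep u em f := And.symm h

namespace BoundaryPair

lemma symm (P : BoundaryPair σ A B Γ Γs) : BoundaryPair (-σ) B A Γs Γ where
  sign := by rcases P.sign with h | h <;> simp [h]
  formal u w := by rw [← inner_conj_symm, ← P.formal w u, inner_conj_symm]
  resA z hz := P.resB z (by linarith)
  resB z hz := P.resA z (by linarith)
  lagA := P.lagB
  lagB := by rw [neg_neg]; exact P.lagA

lemma compA (P : BoundaryPair σ A B Γ Γs) (hz : σ * z.im < 0) (u : A.domain) :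
    compResolvent A Γ z (A u - z • (u : H)) = Γ u :=
  P.lagA.compResolvent_apply (P.resA z hz) u

lemma compB (P : BoundaryPair σ A B Γ Γs) (hz : 0 < σ * z.im) (w : B.domain) :
    compResolvent B Γs z (B w - z • (w : H)) = Γs w :=
  P.lagB.compResolvent_apply (P.resB z hz) w

lemma existsA (P : BoundaryPair σ A B Γ Γs) (hz : σ * z.im < 0) (f : H) :
    ∃ u : A.domain, A u - z • (u : H) = f := (P.resA z hz).exists_sub_eq f

lemma existsB (P : BoundaryPair σ A B Γ Γs) (hz : 0 < σ * z.im) (f : H) :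
    ∃ w : B.domain, B w - z • (w : H) = f := (P.resB z hz).exists_sub_eq f

lemma conj_pos (hz : σ * z.im < 0) : 0 < σ * (starRingEnd ℂ z).im := by
  rw [Complex.conj_im]; linarith

lemma conj_neg (hz : 0 < σ * z.im) : σ * (starRingEnd ℂ z).im < 0 := by
  rw [Complex.conj_im]; linarith

/-- If `(A - z) u = (B - z) w`, then `‖Γ_* w‖² = ‖Γ u‖² - 2 σ Im z ‖u - w‖²`; the map
`Γ u ↦ Γ_* w` is a contraction. -/
lemma norm_le (P : BoundaryPair σ A B Γ Γs) (hz : 0 < σ * z.im) {u : A.domain} {w : B.domain}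
    (h : A u - z • (u : H) = B w - z • (w : H)) : ‖Γs w‖ ≤ ‖Γ u‖ := by
  have h1 := P.lagA.two_mul_im_inner u
  have h2 := P.lagB.two_mul_im_inner w
  have h3 := im_inner_smul_self ((u : H) - w) z
  have h4 : z • ((u : H) - w) = A u - B w := by
    rw [smul_sub]
    exact (sub_eq_sub_iff_sub_eq_sub.mp h).symm
  have h5 := congrArg Complex.im (P.formal u w)
  have h6 := congrArg Complex.im (inner_conj_symm (𝕜 := ℂ) (w : H) (A u))
  rw [Complex.conj_im] at h6
  rw [h4] at h3
  simp only [inner_sub_left, inner_sub_right, Complex.sub_im] at h3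
  refine le_of_sq_le_sq ?_ (norm_nonneg _)
  have h7 : σ * (‖Γ u‖ ^ 2 - ‖Γs w‖ ^ 2) = 2 * z.im * ‖(u : H) - w‖ ^ 2 := by linarith
  have hσ : σ * σ = 1 := by rcases P.sign with h | h <;> simp [h]
  have h8 : ‖Γ u‖ ^ 2 - ‖Γs w‖ ^ 2 = 2 * (σ * z.im) * ‖(u : H) - w‖ ^ 2 := by
    linear_combination σ * h7 - (‖Γ u‖ ^ 2 - ‖Γs w‖ ^ 2) * hσ
  have h9 : 0 ≤ 2 * (σ * z.im) * ‖(u : H) - w‖ ^ 2 := by positivity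
  linarith

/-- Existence of the Štraus characteristic function. -/
lemma exists_straus [CompleteSpace E] [CompleteSpace Es] (P : BoundaryPair σ A B Γ Γs)
    (hz : 0 < σ * z.im) : ∃ S : E →L[ℂ] Es, ∀ u : A.domain,
      S (Γ u) = compResolvent B Γs z (A u - z • (u : H)) := by
  let f : A.domain →ₗ[ℂ] Es :=
    (compResolvent B Γs z).toLinearMap ∘ₗ (A.toFun - z • A.domain.subtype)
  have hf : ∀ u, f u = compResolvent B Γs z (A u - z • (u : H)) := fun u => rfl
  refine ⟨f.extendOfNorm Γ, fun u => ?_⟩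
  refine (LinearMap.extendOfNorm_eq P.lagA.dense_range ⟨1, fun u => ?_⟩ u).trans (hf u)
  obtain ⟨w, hw⟩ := P.existsB hz (A u - z • (u : H))
  rw [hf, ← hw, P.compB hz, one_mul]
  exact P.norm_le hz hw.symm

/-- The adjoint of the characteristic function of a boundary pair is the characteristic function
of the exchanged pair. -/
lemma straus_adjoint [CompleteSpace E] [CompleteSpace Es] (P : BoundaryPair σ A B Γ Γs)
    (hz : 0 < σ * z.im) {S : E →L[ℂ] Es}
    (hS : ∀ u : A.domain, S (Γ u) = compResolvent B Γs z (A u - z • (u : H))) (w : B.domain) :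
    S.adjoint (Γs w) =
      compResolvent A Γ (starRingEnd ℂ z) (B w - starRingEnd ℂ z • (w : H)) := by
  refine DenseRange.eq_of_inner_eq P.lagA.dense_range fun u => ?_
  obtain ⟨w₁, hw₁⟩ := P.existsB hz (A u - z • (u : H))
  obtain ⟨x, hx⟩ := P.existsA (conj_neg hz) (B w - starRingEnd ℂ z • (w : H))
  rw [ContinuousLinearMap.adjoint_inner_right, hS, ← hw₁, P.compB hz, ← hx, P.compA (conj_neg hz)]
  have l1 := P.lagB.lagrange w w₁
  have l2 := P.lagA.lagrange x u
  have e1 := congrArg (fun y => inner ℂ y (x : H)) hw₁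
  have e2 := congrArg (fun y => inner ℂ y (w : H)) hw₁
  have e3 := congrArg (fun y => inner ℂ (w₁ : H) y) hx
  have e4 := congrArg (fun y => inner ℂ (u : H) y) hx
  have f1 := P.formal u w
  have f2 := P.symm.formal w₁ x
  simp only [inner_sub_left, inner_sub_right, inner_smul_left, inner_smul_right] at e1 e2 e3 e4
  have hσ : (σ : ℂ) * Complex.I ≠ 0 := by
    rcases P.sign with h | h <;> simp [h]
  refine mul_left_cancel₀ hσ ?_
  push_cast at l1
  linear_combination l1 + l2 - e1 + e2 + e3 - e4 + f1 + f2

/-- The node relation parametrised by `(e₋, u₀)`, `u₀ ∈ D(A)`. -/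
lemma nodeRel_mk [CompleteSpace H] [CompleteSpace E] [CompleteSpace Es]
    (P : BoundaryPair σ A B Γ Γs) (hz : σ * z.im < 0) {S : E →L[ℂ] Es}
    (hS : ∀ u : A.domain, S (Γ u) =
      compResolvent B Γs (starRingEnd ℂ z) (A u - starRingEnd ℂ z • (u : H)))
    (u₀ : A.domain) (em : Es) :
    NodeRel A B Γ Γs em ((u₀ : H) - (compResolvent B Γs (starRingEnd ℂ z)).adjoint em)
      (S.adjoint em + ((σ : ℂ) * Complex.I) • Γ u₀)
      (A u₀ - z • (compResolvent B Γs (starRingEnd ℂ z)).adjoint em) := by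
  set k := (compResolvent B Γs (starRingEnd ℂ z)).adjoint em with hk
  refine ⟨fun w => ?_, fun v => ?_⟩
  · have h1 : inner ℂ (B w - starRingEnd ℂ z • (w : H)) k = inner ℂ (Γs w) em := by
      rw [hk, ContinuousLinearMap.adjoint_inner_right, P.compB (conj_pos hz)]
    have h2 := P.symm.formal w u₀
    simp only [inner_sub_left, inner_sub_right, inner_smul_left, inner_smul_right,
      Complex.conj_conj] at h1 ⊢
    linear_combination h1 - h2
  · have h1 : inner ℂ (A v - starRingEnd ℂ z • (v : H)) k = inner ℂ (Γ v) (S.adjoint em) := by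
      rw [hk, ContinuousLinearMap.adjoint_inner_right, ContinuousLinearMap.adjoint_inner_right, hS]
    have h2 := P.lagA.lagrange u₀ v
    simp only [inner_sub_left, inner_sub_right, inner_smul_left, inner_smul_right,
      Complex.conj_conj, inner_add_right] at h1 ⊢
    linear_combination h1 + h2

lemma eq_of_nodeRel (P : BoundaryPair σ A B Γ Γs) {em em' : Es} {u f : H} {ep ep' : E}
    (h : NodeRel A B Γ Γs em u ep f) (h' : NodeRel A B Γ Γs em' u ep' f) : em = em' ∧ ep = ep' :=
  ⟨DenseRange.eq_of_inner_eq P.lagB.dense_range fun w => (h.1 w).symm.trans (h'.1 w),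
    DenseRange.eq_of_inner_eq P.lagA.dense_range fun v => (h.2 v).symm.trans (h'.2 v)⟩

/-- `A` is the adjoint of `B`. -/
lemma mem_graph_of_forall_inner (P : BoundaryPair σ A B Γ Γs) {x y : H}
    (h : ∀ w : B.domain, inner ℂ (w : H) y = inner ℂ (B w) x) : (x, y) ∈ A.graph := by
  have hz : σ * (-(σ : ℂ) * Complex.I).im < 0 := by
    rcases P.sign with h | h <;> simp [h]
  generalize -(σ : ℂ) * Complex.I = z at hz
  obtain ⟨u, hu⟩ := P.existsA hz (y - z • x)
  have hux : (u : H) = x := by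
    rw [← sub_eq_zero]
    obtain ⟨w, hw⟩ := P.existsB (conj_pos hz) ((u : H) - x)
    rw [← inner_self_eq_zero (𝕜 := ℂ)]
    suffices h0 : inner ℂ (B w - starRingEnd ℂ z • (w : H)) ((u : H) - x) = 0 by rwa [hw] at h0
    have e1 := congrArg (fun v => inner ℂ (w : H) v) hu
    have e2 := P.symm.formal w u
    have e3 := h w
    simp only [inner_sub_left, inner_sub_right, inner_smul_left, inner_smul_right,
      Complex.conj_conj] at e1 ⊢
    linear_combination e1 + e2 + e3
  refine A.mem_graph_iff.mpr ⟨u, hux, ?_⟩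
  rw [hux] at hu
  exact sub_left_inj.mp hu

/-- The converse of `nodeRel_mk`: every solution of the node relation is of that form. -/
lemma exists_of_nodeRel [CompleteSpace H] [CompleteSpace E] [CompleteSpace Es]
    (P : BoundaryPair σ A B Γ Γs) (hz : σ * z.im < 0) {S : E →L[ℂ] Es}
    (hS : ∀ u : A.domain, S (Γ u) =
      compResolvent B Γs (starRingEnd ℂ z) (A u - starRingEnd ℂ z • (u : H)))
    {em : Es} {u f : H} {ep : E} (h : NodeRel A B Γ Γs em u ep f) :
    ∃ u₀ : A.domain, (u₀ : H) = u + (compResolvent B Γs (starRingEnd ℂ z)).adjoint em ∧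
      ep = S.adjoint em + ((σ : ℂ) * Complex.I) • Γ u₀ ∧
      A u₀ = f + z • (compResolvent B Γs (starRingEnd ℂ z)).adjoint em := by
  set k := (compResolvent B Γs (starRingEnd ℂ z)).adjoint em with hk
  have hg : (u + k, f + z • k) ∈ A.graph := by
    refine P.mem_graph_of_forall_inner fun w => ?_
    have h1 : inner ℂ (B w - starRingEnd ℂ z • (w : H)) k = inner ℂ (Γs w) em := by
      rw [hk, ContinuousLinearMap.adjoint_inner_right, P.compB (conj_pos hz)]
    have h2 := h.1 w
    simp only [inner_sub_left, inner_add_right, inner_smul_left, inner_smul_right,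
      Complex.conj_conj] at h1 ⊢
    linear_combination h2 - h1
  obtain ⟨u₀, h1, h2⟩ := A.mem_graph_iff.mp hg
  dsimp only at h1 h2
  have h3 := P.nodeRel_mk hz hS u₀ em
  rw [← hk, h1, h2, add_sub_cancel_right, add_sub_cancel_right] at h3
  exact ⟨u₀, h1, (P.eq_of_nodeRel h h3).2, h2⟩

/-- Green's formula for the node relation. -/
lemma green [CompleteSpace H] [CompleteSpace E] [CompleteSpace Es]
    (P : BoundaryPair σ A B Γ Γs) {em em' : Es} {u f u' f' : H} {ep ep' : E}
    (h : NodeRel A B Γ Γs em u ep f) (h' : NodeRel A B Γ Γs em' u' ep' f') :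
    inner ℂ u' f - inner ℂ f' u =
      (σ * Complex.I) * (inner ℂ ep' ep - inner ℂ em' em) := by
  have hz : σ * (-(σ : ℂ) * Complex.I).im < 0 := by
    rcases P.sign with h | h <;> simp [h]
  generalize -(σ : ℂ) * Complex.I = z at hz
  obtain ⟨S, hS⟩ := P.exists_straus (conj_pos hz)
  obtain ⟨u₀, hu, hep, hf⟩ := P.exists_of_nodeRel hz hS h
  set k := (compResolvent B Γs (starRingEnd ℂ z)).adjoint em with hk
  have hS' := P.straus_adjoint (conj_pos hz) hS
  have hz' : -σ * (starRingEnd ℂ z).im < 0 := by linarith [conj_pos hz]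
  obtain ⟨y, hy, hem, hf'⟩ := P.symm.exists_of_nodeRel hz' hS' h'.symm
  rw [ContinuousLinearMap.adjoint_adjoint] at hem
  rw [Complex.conj_conj] at hy hf'
  set k' := (compResolvent A Γ z).adjoint ep' with hk'
  -- the part of `u` in `D(A)` against the second vector, and the remaining part of `u` against
  -- the part of `u'` in `D(B)`; the contributions of `k` and `k'` cancel
  have e1 := congrArg (starRingEnd ℂ) (h'.2 u₀)
  have e2 := h.1 y
  have e3 : inner ℂ (y : H) (A u₀) = inner ℂ (B y) (u₀ : H) := (P.symm.formal y u₀).symm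
  have hu' : u = u₀ - k := by rw [hu]; abel
  have hf2 : f = A u₀ - z • k := by rw [hf]; abel
  have hu2 : u' = y - k' := by rw [hy]; abel
  have hf3 : f' = B y - starRingEnd ℂ z • k' := by rw [hf']; abel
  simp only [map_sub, inner_conj_symm] at e1
  rw [hep, hem]
  rw [hf2, hu'] at e2
  rw [hf2, hu', hu2, hf3]
  rw [hu2, hf3] at e1
  simp only [inner_sub_left, inner_sub_right, inner_add_left, inner_add_right, inner_smul_left,
    inner_smul_right, Complex.conj_conj, ContinuousLinearMap.adjoint_inner_right, map_mul,
    Complex.conj_I, Complex.conj_ofReal] at e1 e2 ⊢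
  push_cast
  have hσ : (σ : ℂ) * σ = 1 := by rcases P.sign with h | h <;> simp [h]
  linear_combination e2 - e1 - e3 - (inner ℂ ep' (Γ u₀) - inner ℂ (Γs y) em) *
    (Complex.I ^ 2 * hσ + Complex.I_sq)

end BoundaryPair

end BoundaryPairs

/-! ### Vectors without boundary values -/

section SelfadjointPart

variable {H : Type*} [NormedAddCommGroup H] [InnerProductSpace ℂ H]
variable {E : Type*} [NormedAddCommGroup E] [InnerProductSpace ℂ E]
variable {Es : Type*} [NormedAddCommGroup Es] [InnerProductSpace ℂ Es]

/-- The vectors `w` with `Γ (A - z)⁻¹ w = 0` for `σ Im z < 0` and `Γ_* (B - z)⁻¹ w = 0` for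
`σ Im z > 0`. They form the selfadjoint part of `A`. -/
def IsBoundaryFree (σ : ℝ) (A B : H →ₗ.[ℂ] H) (Γ : A.domain →ₗ[ℂ] E) (Γs : B.domain →ₗ[ℂ] Es)
    (w : H) : Prop :=
  (∀ z : ℂ, σ * z.im < 0 → compResolvent A Γ z w = 0) ∧
    ∀ z : ℂ, 0 < σ * z.im → compResolvent B Γs z w = 0

variable {σ : ℝ} {A B : H →ₗ.[ℂ] H} {Γ : A.domain →ₗ[ℂ] E} {Γs : B.domain →ₗ[ℂ] Es} {z ζ : ℂ}

lemma IsBoundaryFree.symm {w : H} (hw : IsBoundaryFree σ A B Γ Γs w) :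
    IsBoundaryFree (-σ) B A Γs Γ w :=
  ⟨fun z hz => hw.2 z (by linarith), fun z hz => hw.1 z (by linarith)⟩

namespace BoundaryPair

variable (P : BoundaryPair σ A B Γ Γs)
include P

lemma inner_resolventOp (hz : σ * z.im < 0) (f g : H) :
    inner ℂ (resolventOp A z f) g = inner ℂ f (resolventOp B (starRingEnd ℂ z) g) := by
  obtain ⟨u, rfl⟩ := P.existsA hz f
  obtain ⟨w, rfl⟩ := P.existsB (conj_pos hz) g
  rw [(P.resA z hz).2, (P.resB _ (conj_pos hz)).2, inner_sub_left, inner_sub_right,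
    inner_smul_left, inner_smul_right, P.formal]

/-- The energy estimate behind the bounds for `(A - z)⁻¹` and `Γ (A - z)⁻¹`. -/
lemma energy_le (hz : σ * z.im < 0) (u : A.domain) :
    -(σ * z.im) * ‖(u : H)‖ ^ 2 + ‖Γ u‖ ^ 2 / 2 ≤ ‖(u : H)‖ * ‖A u - z • (u : H)‖ := by
  have h1 := P.lagA.two_mul_im_inner u
  have h2 := abs_im_inner_le (u : H) (A u - z • (u : H))
  rw [inner_sub_right, Complex.sub_im, im_inner_smul_self] at h2
  have h3 := abs_le.mp h2
  rcases P.sign with h | h <;> subst h <;> linarith [h3.1, h3.2]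

lemma norm_resolvent_le (hz : σ * z.im < 0) (u : A.domain) :
    -(σ * z.im) * ‖(u : H)‖ ≤ ‖A u - z • (u : H)‖ := by
  rcases eq_or_ne ‖(u : H)‖ 0 with h0 | h0
  · rw [h0, mul_zero]; exact norm_nonneg _
  have hpos : 0 < ‖(u : H)‖ := lt_of_le_of_ne (norm_nonneg _) (Ne.symm h0)
  refine le_of_mul_le_mul_left ?_ hpos
  nlinarith [P.energy_le hz u, sq_nonneg ‖Γ u‖]

/-- The resolvent identity for `Γ (A - z)⁻¹`. -/
lemma sub_smul_compResolvent (hz : σ * z.im < 0) (hζ : σ * ζ.im < 0) (w : H) :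
    (z - ζ) • compResolvent A Γ z (resolventOp A ζ w) =
      compResolvent A Γ z w - compResolvent A Γ ζ w := by
  obtain ⟨q, rfl⟩ := P.existsA hζ w
  rw [(P.resA ζ hζ).2, P.compA hζ]
  have h := P.compA hz q
  have e : A q - ζ • (q : H) = (A q - z • (q : H)) + (z - ζ) • (q : H) := by
    rw [sub_smul]; abel
  rw [e, map_add, h, map_smul, add_sub_cancel_left]

/-- If `Γ (A - z)⁻¹ w` does not depend on `z`, it is zero, since
`‖Γ (A - z)⁻¹ w‖² ≤ 2 ‖w‖² / |Im z|`. -/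
lemma eq_zero_of_compResolvent_const {w : H} {c : E}
    (h : ∀ z : ℂ, σ * z.im < 0 → compResolvent A Γ z w = c) : c = 0 := by
  have key : ∀ t : ℝ, 0 < t → t * ‖c‖ ^ 2 ≤ 2 * ‖w‖ ^ 2 := by
    intro t ht
    have him : σ * (-(σ : ℂ) * t * Complex.I).im = -t := by
      rcases P.sign with h | h <;> simp [h]
    have hz : σ * (-(σ : ℂ) * t * Complex.I).im < 0 := by rw [him]; linarith
    obtain ⟨u, hu⟩ := P.existsA hz w
    have h1 := P.energy_le hz u
    have h2 := P.norm_resolvent_le hz u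
    have h3 : Γ u = c := by rw [← P.compA hz, hu, h _ hz]
    rw [hu, him, neg_neg] at h1 h2
    rw [h3] at h1
    have h4 := mul_le_mul_of_nonneg_right h2 (norm_nonneg w)
    have h5 := mul_le_mul_of_nonneg_left h1 ht.le
    nlinarith [mul_nonneg (sq_nonneg t) (sq_nonneg ‖(u : H)‖)]
  by_contra hc
  have hpos : 0 < ‖c‖ ^ 2 := by positivity
  have := key ((2 * ‖w‖ ^ 2 + 1) / ‖c‖ ^ 2) (by positivity)
  rw [div_mul_cancel₀ _ hpos.ne'] at this
  linarith

/-- If `Γ (A - z₀)⁻¹ (A - z)⁻¹ w = 0` for all `z`, then by the resolvent identity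
`Γ (A - z)⁻¹ w` is constant in `z`, hence zero. -/
lemma compResolvent_eq_zero_of_forall {z₀ : ℂ} (hz₀ : σ * z₀.im < 0) {w : H}
    (h : ∀ z : ℂ, σ * z.im < 0 → compResolvent A Γ z₀ (resolventOp A z w) = 0) (hz : σ * z.im < 0) :
    compResolvent A Γ z w = 0 := by
  have hc : ∀ z : ℂ, σ * z.im < 0 → compResolvent A Γ z w = compResolvent A Γ z₀ w := by
    intro z hz
    have h1 := P.sub_smul_compResolvent hz₀ hz w
    rw [h z hz, smul_zero] at h1
    exact (sub_eq_zero.mp h1.symm).symm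
  rw [hc z hz]
  exact P.eq_zero_of_compResolvent_const hc

/-- Continuity of `z ↦ Γ (A - z)⁻¹ w`, in the form needed here. -/
lemma compResolvent_eq_zero_of_forall_ne (hζ : σ * ζ.im < 0) {w : H}
    (h : ∀ z : ℂ, σ * z.im < 0 → z ≠ ζ → compResolvent A Γ z w = 0) :
    compResolvent A Γ ζ w = 0 := by
  set G := compResolvent A Γ ζ
  set a := -(σ * ζ.im) with ha
  have hapos : 0 < a := by linarith
  have key : ∀ t : ℝ, 0 < t → a * ‖G w‖ ≤ t * (‖G‖ * ‖w‖) := by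
    intro t ht
    set z : ℂ := ζ - σ * t * Complex.I with hzdef
    have him : σ * z.im = -a - t := by
      rcases P.sign with h | h
      · simp [hzdef, ha, h]
      · simp [hzdef, ha, h]
        ring
    have hz : σ * z.im < 0 := by rw [him]; linarith
    have hnorm : ‖ζ - z‖ = t := by
      rw [hzdef, sub_sub_cancel, norm_mul, norm_mul, Complex.norm_I, Complex.norm_real,
        Complex.norm_real, Real.norm_eq_abs, Real.norm_of_nonneg ht.le]
      rcases P.sign with h | h <;> simp [h]
    have hne : z ≠ ζ := by
      intro h0
      rw [h0, sub_self, norm_zero] at hnorm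
      linarith
    have h1 := P.sub_smul_compResolvent hζ hz w
    rw [h z hz hne, sub_zero] at h1
    have h2 : (a + t) * ‖resolventOp A z w‖ ≤ ‖w‖ := by
      obtain ⟨u, rfl⟩ := P.existsA hz w
      rw [(P.resA z hz).2]
      have := P.norm_resolvent_le hz u
      rwa [him, neg_sub, sub_neg_eq_add, add_comm t] at this
    have h3 : a * ‖resolventOp A z w‖ ≤ ‖w‖ :=
      le_trans (by nlinarith [norm_nonneg (resolventOp A z w)]) h2
    have h4 : ‖G w‖ ≤ t * (‖G‖ * ‖resolventOp A z w‖) := by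
      rw [← h1, norm_smul, hnorm]
      exact mul_le_mul_of_nonneg_left (G.le_opNorm _) ht.le
    calc a * ‖G w‖ ≤ a * (t * (‖G‖ * ‖resolventOp A z w‖)) := by gcongr
      _ = t * (‖G‖ * (a * ‖resolventOp A z w‖)) := by ring
      _ ≤ t * (‖G‖ * ‖w‖) := by gcongr
  by_contra hne
  have hpos : 0 < ‖G w‖ := norm_pos_iff.mpr hne
  have hb : 0 ≤ ‖G‖ * ‖w‖ := by positivity
  have h1 := key (a * ‖G w‖ / (2 * (‖G‖ * ‖w‖ + 1))) (by positivity)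
  rw [div_mul_eq_mul_div, le_div_iff₀ (by positivity)] at h1
  have : 0 < a * ‖G w‖ := by positivity
  nlinarith

/-- If `Γ (A - ζ)⁻¹ w = 0`, the operator `B` agrees with `A` on `(A - ζ)⁻¹ w`. -/
lemma mem_graph_of_compResolvent_eq_zero (hζ : σ * ζ.im < 0) {w : H}
    (hw : compResolvent A Γ ζ w = 0) :
    (resolventOp A ζ w, w + ζ • resolventOp A ζ w) ∈ B.graph := by
  obtain ⟨u, rfl⟩ := P.existsA hζ w
  rw [P.compA hζ] at hw
  rw [(P.resA ζ hζ).2, sub_add_cancel]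
  refine P.symm.mem_graph_of_forall_inner fun v => ?_
  have := P.lagA.lagrange u v
  rwa [hw, inner_zero_right, mul_zero, sub_eq_zero] at this

lemma map_eq_zero_of_common {u : A.domain} {w : B.domain} (h : (u : H) = w) (h' : A u = B w)
    (hΓ : Γ u = 0) : Γs w = 0 := by
  have h1 := P.lagA.two_mul_im_inner u
  have h2 := P.lagB.two_mul_im_inner w
  rw [← h, ← h', h1, hΓ] at h2
  have hσ : σ ≠ 0 := by rcases P.sign with h | h <;> simp [h]
  rw [norm_zero, zero_pow two_ne_zero, mul_zero, eq_comm, neg_mul, neg_eq_zero, mul_eq_zero,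
    or_iff_right hσ] at h2
  exact norm_eq_zero.mp (pow_eq_zero_iff two_ne_zero |>.mp h2)

/-- For `z ≠ ζ` the boundary values of `(A - ζ)⁻¹ w` vanish by the resolvent identity, for `z = ζ`
by continuity. -/
lemma isBoundaryFree_resolvent (hζ : σ * ζ.im < 0) {w : H} (hw : IsBoundaryFree σ A B Γ Γs w) :
    IsBoundaryFree σ A B Γ Γs (resolventOp A ζ w) := by
  refine ⟨fun z hz => ?_, fun z hz => ?_⟩
  · have hne : ∀ z : ℂ, σ * z.im < 0 → z ≠ ζ →
        compResolvent A Γ z (resolventOp A ζ w) = 0 := by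
      intro z hz hne
      have h := P.sub_smul_compResolvent hz hζ w
      rw [hw.1 z hz, hw.1 ζ hζ, sub_zero, smul_eq_zero] at h
      exact h.resolve_left (sub_ne_zero.mpr hne)
    rcases eq_or_ne z ζ with rfl | h
    · exact P.compResolvent_eq_zero_of_forall_ne hz hne
    · exact hne z hz h
  · obtain ⟨x, hx, hBx⟩ := B.mem_graph_iff.mp
      (P.mem_graph_of_compResolvent_eq_zero hζ (hw.1 ζ hζ))
    dsimp only at hx hBx
    have hΓs : Γs x = 0 := by
      refine P.map_eq_zero_of_common (u := ⟨resolventOp A ζ w, (P.resA ζ hζ).mem_domain w⟩) hx.symm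
        ?_ ?_
      · rw [(P.resA ζ hζ).apply, hBx]
      · rw [← P.compA hζ, (P.resA ζ hζ).apply, add_sub_cancel_right]
        exact hw.1 ζ hζ
    have h1 := P.compB hz x
    have h2 : B x - z • (x : H) = w + (ζ - z) • resolventOp A ζ w := by
      rw [hBx, hx, sub_smul]; abel
    rw [h2, map_add, hw.2 z hz, zero_add, hΓs, map_smul, smul_eq_zero] at h1
    refine h1.resolve_left (sub_ne_zero.mpr fun h => ?_)
    rw [h] at hζ
    linarith

end BoundaryPair

lemma mem_span_orthogonal_iff {S : Set H} {w : H} :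
    w ∈ (Submodule.span ℂ S)ᗮ ↔ ∀ x ∈ S, inner ℂ x w = 0 := by
  rw [Submodule.mem_orthogonal]
  refine ⟨fun h x hx => h x (Submodule.subset_span hx), fun h x hx => ?_⟩
  induction hx using Submodule.span_induction with
  | mem x hx => exact h x hx
  | zero => exact inner_zero_left _
  | add x y _ _ hx hy => rw [inner_add_left, hx, hy, add_zero]
  | smul c x _ hx => rw [inner_smul_left, hx, mul_zero]

variable [CompleteSpace H] [CompleteSpace E] [CompleteSpace Es]

/-- The orthogonal complement of `H_cns` consists of the vectors without boundary values. -/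
theorem mem_Hcns_orthogonal_iff {Γs : A.adjoint.domain →ₗ[ℂ] Es}
    (P : BoundaryPair 1 A A.adjoint Γ Γs) {w : H} :
    w ∈ (Hcns A Γ Γs)ᗮ ↔ IsBoundaryFree 1 A A.adjoint Γ Γs w := by
  have hmi : (1 : ℝ) * (-Complex.I).im < 0 := by simp
  have hpi : (0 : ℝ) < 1 * Complex.I.im := by simp
  unfold Hcns
  rw [Submodule.orthogonal_closure, ← Submodule.inf_orthogonal, Submodule.mem_inf,
    mem_span_orthogonal_iff, mem_span_orthogonal_iff]
  constructor
  · rintro ⟨h1, h2⟩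
    refine ⟨fun z hz => P.compResolvent_eq_zero_of_forall hmi (fun z hz => ?_) hz, fun z hz =>
      P.symm.compResolvent_eq_zero_of_forall (z₀ := Complex.I)
        (show -1 * Complex.I.im < 0 by simp) (fun z hz => ?_)
        (show -1 * z.im < 0 by linarith)⟩
    · have hz' := BoundaryPair.conj_pos hz
      refine ext_inner_left ℂ fun e => ?_
      have := h2 _ (mem_iUnion₂.mpr ⟨starRingEnd ℂ z, by simpa using hz,
        mem_image_of_mem _ (Or.inl ⟨e, rfl⟩)⟩)
      rw [P.symm.inner_resolventOp (by linarith), Complex.conj_conj,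
        ContinuousLinearMap.adjoint_inner_left] at this
      rw [this, inner_zero_right]
    · refine ext_inner_left ℂ fun e => ?_
      have := h1 _ (mem_iUnion₂.mpr ⟨starRingEnd ℂ z, by simpa using hz,
        mem_image_of_mem _ (Or.inr ⟨e, rfl⟩)⟩)
      rw [P.inner_resolventOp (by simpa using hz), Complex.conj_conj,
        ContinuousLinearMap.adjoint_inner_left] at this
      rw [this, inner_zero_right]
  · intro hw
    have hM : ∀ m ∈ generatingSet A Γ Γs, ∀ x, IsBoundaryFree 1 A A.adjoint Γ Γs x →
        inner ℂ m x = 0 := by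
      rintro m (⟨e, rfl⟩ | ⟨e, rfl⟩) x hx
      · rw [ContinuousLinearMap.adjoint_inner_left, hx.1 _ hmi, inner_zero_right]
      · rw [ContinuousLinearMap.adjoint_inner_left, hx.2 _ hpi, inner_zero_right]
    constructor
    · intro x hx
      obtain ⟨z, hz, m, hm, rfl⟩ := mem_iUnion₂.mp hx
      have hz' : (1 : ℝ) * z.im < 0 := by simpa using hz
      rw [P.inner_resolventOp hz']
      refine hM m hm _ ?_
      have := P.symm.isBoundaryFree_resolvent (ζ := starRingEnd ℂ z)
        (by linarith [BoundaryPair.conj_pos hz']) hw.symm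
      simpa using this.symm
    · intro x hx
      obtain ⟨z, hz, m, hm, rfl⟩ := mem_iUnion₂.mp hx
      have hz' : (0 : ℝ) < 1 * z.im := by simpa using hz
      rw [P.symm.inner_resolventOp (by linarith)]
      exact hM m hm _ (P.isBoundaryFree_resolvent (BoundaryPair.conj_neg hz') hw)

end SelfadjointPart

/-! ### The graph of the dilation and its selfadjointness -/

section DilationOperator

variable {H : Type*} [NormedAddCommGroup H] [InnerProductSpace ℂ H] [CompleteSpace H]
variable {E : Type*} [NormedAddCommGroup E] [InnerProductSpace ℂ E] [CompleteSpace E]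
variable {Es : Type*} [NormedAddCommGroup Es] [InnerProductSpace ℂ Es] [CompleteSpace Es]
variable {A : H →ₗ.[ℂ] H} {Γ : A.domain →ₗ[ℂ] E} {Γs : A.adjoint.domain →ₗ[ℂ] Es} {μ ν z : ℂ}

lemma BoundaryPair.strausFunction_apply (P : BoundaryPair 1 A A.adjoint Γ Γs) (hz : 0 < z.im)
    (u : A.domain) :
    strausFunction A Γ Γs z (Γ u) = compResolvent A.adjoint Γs z (A u - z • (u : H)) := by
  have h := P.exists_straus (z := z) (by simpa using hz)
  unfold strausFunction
  rw [dif_pos h]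
  exact h.choose_spec u

/-- The boundary condition of the dilation together with its action in the middle component is the
node relation; in particular it depends neither on `μ` nor on `ν`. -/
lemma BoundaryPair.nodeRel_iff (P : BoundaryPair 1 A A.adjoint Γ Γs) (hμ : μ.im < 0)
    (hν : 0 < ν.im) {em : Es} {u f : H} {ep : E} :
    NodeRel A A.adjoint Γ Γs em u ep f ↔ BoundaryCondition A Γ Γs μ ν em u ep ∧
      ∃ h : shiftPos A Γ ν u ep ∈ A.adjoint.domain, midAction A Γ ν u ep h = f := by
  have hμ' : (1 : ℝ) * (-starRingEnd ℂ μ).im < 0 := by simpa using hμ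
  have hν' : (0 : ℝ) < 1 * (-starRingEnd ℂ ν).im := by simpa using hν
  have hν'' : -(1 : ℝ) * (-starRingEnd ℂ ν).im < 0 := by linarith
  have cμ : starRingEnd ℂ (-starRingEnd ℂ μ) = -μ := by simp
  have cν : starRingEnd ℂ (-starRingEnd ℂ ν) = -ν := by simp
  have hS : ∀ u : A.domain, strausFunction A Γ Γs (starRingEnd ℂ (-starRingEnd ℂ μ)) (Γ u) =
      compResolvent A.adjoint Γs (starRingEnd ℂ (-starRingEnd ℂ μ))
        (A u - starRingEnd ℂ (-starRingEnd ℂ μ) • (u : H)) :=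
    fun u => P.strausFunction_apply (by simpa using hμ) u
  have hS' := P.straus_adjoint hν' (fun u => P.strausFunction_apply (by simpa using hν') u)
  constructor
  · intro h
    obtain ⟨u₀, h1, h2, -⟩ := P.exists_of_nodeRel hμ' hS h
    obtain ⟨w₀, h3, h4, h5⟩ := P.symm.exists_of_nodeRel hν'' hS' h.symm
    rw [cμ] at h1 h2
    rw [cν] at h3 h5
    rw [ContinuousLinearMap.adjoint_adjoint] at h4
    have e1 : shiftNeg A Γs μ u em = u₀ := h1.symm
    have e2 : shiftPos A Γ ν u ep = w₀ := h3.symm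
    have hd1 : shiftNeg A Γs μ u em ∈ A.domain := e1 ▸ u₀.2
    have hd2 : shiftPos A Γ ν u ep ∈ A.adjoint.domain := e2 ▸ w₀.2
    have e1' : (⟨_, hd1⟩ : A.domain) = u₀ := Subtype.ext e1
    have e2' : (⟨_, hd2⟩ : A.adjoint.domain) = w₀ := Subtype.ext e2
    refine ⟨⟨hd1, hd2, ?_, ?_⟩, hd2, ?_⟩
    · rw [e1']
      simpa using h2
    · rw [e2']
      refine h4.trans ?_
      rw [sub_eq_add_neg, ← neg_smul]
      simp
    · rw [midAction, e2', h5, neg_smul, neg_add_cancel_right]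
  · rintro ⟨⟨hd1, hd2, -, h2⟩, hd, rfl⟩
    have h3 := (P.symm.nodeRel_mk hν'' hS' ⟨_, hd2⟩ ep).symm
    rw [cν, ContinuousLinearMap.adjoint_adjoint] at h3
    have e1 : (shiftPos A Γ ν u ep) - (compResolvent A Γ (-ν)).adjoint ep = u :=
      add_sub_cancel_right _ _
    have e2 : strausFunction A Γ Γs (-starRingEnd ℂ ν) ep +
        (((-1 : ℝ) : ℂ) * Complex.I) • Γs ⟨_, hd2⟩ = em := by
      conv_rhs => rw [h2]
      rw [sub_eq_add_neg, ← neg_smul]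
      simp
    have e3 : A.adjoint ⟨_, hd2⟩ - -starRingEnd ℂ ν • (compResolvent A Γ (-ν)).adjoint ep =
        midAction A Γ ν u ep hd := by
      rw [midAction, neg_smul, sub_neg_eq_add]
    rw [e2, e3] at h3
    dsimp only at h3
    rwa [e1] at h3

/-- The graph of the dilation in terms of the node relation. -/
lemma BoundaryPair.mem_graph_dilation_iff (P : BoundaryPair 1 A A.adjoint Γ Γs) (hμ : μ.im < 0)
    (hν : 0 < ν.im) {U F : DilationSpace H E Es} :
    (U, F) ∈ (dilation A Γ Γs μ ν).graph ↔ ∃ wm em wp ep,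
      HasDerivTrace (Iio 0) (compNeg U) wm em ∧ HasDerivTrace (Ioi 0) (compPos U) wp ep ∧
      NodeRel A A.adjoint Γ Γs em (compMid U) ep (compMid F) ∧
      compNeg F = Complex.I • wm ∧ compPos F = Complex.I • wp := by
  rw [LinearPMap.mem_graph_iff]
  constructor
  · rintro ⟨⟨V, hV⟩, hVU, rfl⟩
    dsimp only at hVU
    subst hVU
    exact ⟨_, _, _, _, hV.choose.choose_spec.choose_spec,
      hV.choose_spec.choose.choose_spec.choose_spec,
      (P.nodeRel_iff hμ hν).mpr ⟨hV.choose_spec.choose_spec, _, rfl⟩, rfl, rfl⟩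
  · rintro ⟨wm, em, wp, ep, hm, hp, hN, hFm, hFp⟩
    have hmU : compNeg U ∈ H1On (Iio 0) Es := ⟨wm, em, hm⟩
    have hpU : compPos U ∈ H1On (Ioi 0) E := ⟨wp, ep, hp⟩
    obtain ⟨e1, e2⟩ := hm.unique isOpen_Iio zero_mem_closure_Iio hmU.choose_spec.choose_spec
    obtain ⟨e3, e4⟩ := hp.unique isOpen_Ioi zero_mem_closure_Ioi hpU.choose_spec.choose_spec
    obtain ⟨hB, hd, hact⟩ := (P.nodeRel_iff hμ hν).mp hN
    subst e1 e2 e3 e4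
    refine ⟨⟨U, hmU, hpU, hB⟩, rfl, ?_⟩
    refine (column_congr hFm.symm hact hFp.symm).trans rfl

lemma inner_dilationSpace (U V : DilationSpace H E Es) :
    inner ℂ U V = inner ℂ (compNeg U) (compNeg V) +
      (inner ℂ (compMid U) (compMid V) + inner ℂ (compPos U) (compPos V)) := rfl

lemma BoundaryPair.dilation_symmetric (P : BoundaryPair 1 A A.adjoint Γ Γs) (hμ : μ.im < 0)
    (hν : 0 < ν.im) (U V : (dilation A Γ Γs μ ν).domain) :
    inner ℂ (dilation A Γ Γs μ ν U) (V : DilationSpace H E Es) =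
      inner ℂ (U : DilationSpace H E Es) (dilation A Γ Γs μ ν V) := by
  obtain ⟨wm, em, wp, ep, hm, hp, hN, hFm, hFp⟩ :=
    (P.mem_graph_dilation_iff hμ hν).mp ((dilation A Γ Γs μ ν).mem_graph U)
  obtain ⟨wm', em', wp', ep', hm', hp', hN', hFm', hFp'⟩ :=
    (P.mem_graph_dilation_iff hμ hν).mp ((dilation A Γ Γs μ ν).mem_graph V)
  have h1 := hm.inner_add_inner_neg hm'
  have h2 := hp.inner_add_inner hp'
  have h3 := P.green hN' hN
  rw [inner_dilationSpace, inner_dilationSpace, hFm, hFm', hFp, hFp']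
  simp only [inner_smul_left, inner_smul_right, Complex.conj_I]
  push_cast at h3
  linear_combination -h3 - Complex.I * h1 - Complex.I * h2

/-- The boundary value problem `(𝓛 - z) U = F` is solved componentwise. For `Im z < 0` the
component on `ℝ⁻` is determined by its equation and provides the incoming value `v₋(0)`, the node
relation gives the middle component and `v₊(0)`, the initial value for the component on `ℝ⁺`. For
`Im z > 0` the order is the opposite. -/
lemma BoundaryPair.exists_dilation_sub (P : BoundaryPair 1 A A.adjoint Γ Γs) (hμ : μ.im < 0)
    (hν : 0 < ν.im) (hz : z.im ≠ 0) (F : DilationSpace H E Es) :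
    ∃ U : (dilation A Γ Γs μ ν).domain,
      dilation A Γ Γs μ ν U - z • (U : DilationSpace H E Es) = F := by
  have hI : Complex.I * Complex.I = -1 := Complex.I_mul_I
  suffices h : ∃ vm em vp ep u,
      HasDerivTrace (Iio 0) vm ((-Complex.I * z) • vm + -Complex.I • compNeg F) em ∧
      HasDerivTrace (Ioi 0) vp ((-Complex.I * z) • vp + -Complex.I • compPos F) ep ∧
      NodeRel A A.adjoint Γ Γs em u ep (compMid F + z • u) by
    obtain ⟨vm, em, vp, ep, u, hm, hp, hN⟩ := h
    have hg : (column vm u vp, column (compNeg F + z • vm) (compMid F + z • u)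
        (compPos F + z • vp)) ∈ (dilation A Γ Γs μ ν).graph := by
      refine (P.mem_graph_dilation_iff hμ hν).mpr ⟨_, _, _, _, hm, hp, hN, ?_, ?_⟩
      · change compNeg F + z • vm = _
        rw [smul_add, smul_smul, smul_smul]
        rw [← mul_assoc, mul_neg, hI, neg_neg, one_mul, one_smul, add_comm]
      · change compPos F + z • vp = _
        rw [smul_add, smul_smul, smul_smul]
        rw [← mul_assoc, mul_neg, hI, neg_neg, one_mul, one_smul, add_comm]
    obtain ⟨U, hU, hLU⟩ := (LinearPMap.mem_graph_iff _).mp hg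
    refine ⟨U, ?_⟩
    dsimp only at hU hLU
    rw [hLU, hU, column_add, column_smul, add_sub_cancel_right]
    rfl
  have hre : (-Complex.I * z).re = z.im := by simp
  rcases lt_or_gt_of_ne hz with hz | hz
  · have hz1 : (1 : ℝ) * z.im < 0 := by simpa using hz
    obtain ⟨vm, em, hm⟩ := exists_hasDerivTrace_Iio_of_re_neg (ζ := -Complex.I * z)
      (by rwa [hre]) (-Complex.I • compNeg F)
    obtain ⟨u₀, hu₀⟩ := P.existsA hz1 (compMid F)
    obtain ⟨S, hS⟩ := P.exists_straus (BoundaryPair.conj_pos hz1)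
    have hN := P.nodeRel_mk hz1 hS u₀ em
    obtain ⟨vp, hp⟩ := exists_hasDerivTrace_of_re_neg (ζ := -Complex.I * z)
      (by rwa [hre]) (-Complex.I • compPos F)
      (S.adjoint em + (((1 : ℝ) : ℂ) * Complex.I) • Γ u₀)
    refine ⟨vm, em, vp, _, (u₀ : H) - (compResolvent A.adjoint Γs (starRingEnd ℂ z)).adjoint em,
      hm, hp, ?_⟩
    convert hN using 1
    rw [← hu₀, smul_sub]
    abel
  · have hz1 : (0 : ℝ) < 1 * z.im := by simpa using hz
    have hz2 : -(1 : ℝ) * z.im < 0 := by linarith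
    obtain ⟨vp, ep, hp⟩ := exists_hasDerivTrace_of_re_pos (ζ := -Complex.I * z)
      (by rwa [hre]) (-Complex.I • compPos F)
    obtain ⟨u₀, hu₀⟩ := P.existsB hz1 (compMid F)
    obtain ⟨S, hS⟩ := P.symm.exists_straus (BoundaryPair.conj_pos hz2)
    have hN := (P.symm.nodeRel_mk hz2 hS u₀ ep).symm
    obtain ⟨vm, hm⟩ := exists_hasDerivTrace_Iio_of_re_pos (ζ := -Complex.I * z)
      (by rwa [hre]) (-Complex.I • compNeg F)
      (S.adjoint ep + (((-1 : ℝ) : ℂ) * Complex.I) • Γs u₀)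
    refine ⟨vm, _, vp, ep, (u₀ : H) - (compResolvent A Γ (starRingEnd ℂ z)).adjoint ep,
      hm, hp, ?_⟩
    convert hN using 1
    rw [← hu₀, smul_sub]
    abel

theorem BoundaryPair.isSelfAdjoint_dilation (P : BoundaryPair 1 A A.adjoint Γ Γs) (hμ : μ.im < 0)
    (hν : 0 < ν.im) : IsSelfAdjoint (dilation A Γ Γs μ ν) :=
  isSelfAdjoint_of_symmetric (z := Complex.I) (P.dilation_symmetric hμ hν) (by simp)
    (P.exists_dilation_sub hμ hν (by simp)) (P.exists_dilation_sub hμ hν (by simp))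

/-- The resolvent of the dilation compressed to `H` is the resolvent of `A`: for `Im z < 0` the
component of `(𝓛 - z)⁻¹ (0, f, 0)` on `ℝ⁻` is zero. -/
lemma BoundaryPair.compMid_resolventOp (P : BoundaryPair 1 A A.adjoint Γ Γs) (hμ : μ.im < 0)
    (hν : 0 < ν.im) (hz : z.im < 0) (f : H) :
    compMid (resolventOp (dilation A Γ Γs μ ν) z (column 0 f 0)) = resolventOp A z f := by
  have hL := P.isSelfAdjoint_dilation hμ hν
  have hz1 : (1 : ℝ) * z.im < 0 := by simpa using hz
  set u₀ : A.domain := ⟨resolventOp A z f, (P.resA z hz1).mem_domain f⟩ with hu₀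
  have hAu₀ : A u₀ = f + z • (u₀ : H) := (P.resA z hz1).apply f
  obtain ⟨S, hS⟩ := P.exists_straus (BoundaryPair.conj_pos hz1)
  have hN := P.nodeRel_mk hz1 hS u₀ 0
  obtain ⟨vp, hp⟩ := exists_hasDerivTrace_of_re_neg (ζ := -Complex.I * z) (by simpa using hz)
    0 (S.adjoint 0 + (((1 : ℝ) : ℂ) * Complex.I) • Γ u₀)
  have hg : (column 0 (u₀ : H) vp, column 0 f 0 + z • column 0 (u₀ : H) vp) ∈
      (dilation A Γ Γs μ ν).graph := by
    refine (P.mem_graph_dilation_iff hμ hν).mpr ⟨0, 0, _, _, HasDerivTrace.zero _, hp, ?_, ?_, ?_⟩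
    · simp only [map_zero, sub_zero, smul_zero] at hN ⊢
      rw [hAu₀] at hN
      exact hN
    · change (0 : L2On (Iio 0) Es) + z • (0 : L2On (Iio 0) Es) = _
      simp
    · change (0 : L2On (Ioi 0) E) + z • vp = _
      rw [zero_add, add_zero, smul_smul, ← mul_assoc, mul_neg, Complex.I_mul_I, neg_neg, one_mul]
  have := (hL.isResolventAt hz.ne).eq_of_graph hg
  rw [add_sub_cancel_right] at this
  rw [this]
  rfl

/-- The dilation on vectors `(0, w, 0)`. -/
lemma BoundaryPair.mem_graph_dilation_column_iff (P : BoundaryPair 1 A A.adjoint Γ Γs)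
    (hμ : μ.im < 0) (hν : 0 < ν.im) {w : H} {F : DilationSpace H E Es} :
    (column 0 w 0, F) ∈ (dilation A Γ Γs μ ν).graph ↔
      NodeRel A A.adjoint Γ Γs 0 w 0 (compMid F) ∧ F = column 0 (compMid F) 0 := by
  rw [P.mem_graph_dilation_iff hμ hν]
  constructor
  · rintro ⟨wm, em, wp, ep, hm, hp, hN, hFm, hFp⟩
    obtain ⟨rfl, rfl⟩ := HasDerivTrace.eq_zero isOpen_Iio zero_mem_closure_Iio hm
    obtain ⟨rfl, rfl⟩ := HasDerivTrace.eq_zero isOpen_Ioi zero_mem_closure_Ioi hp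
    rw [smul_zero] at hFm hFp
    exact ⟨hN, column_congr hFm rfl hFp⟩
  · rintro ⟨hN, hF⟩
    refine ⟨0, 0, 0, 0, HasDerivTrace.zero _, HasDerivTrace.zero _, hN, ?_, ?_⟩
    · rw [hF, smul_zero]
      rfl
    · rw [hF, smul_zero]
      rfl

end DilationOperator

/-! ### The decomposition of `A` -/

section Decomposition

variable {H : Type*} [NormedAddCommGroup H] [InnerProductSpace ℂ H]
variable {E : Type*} [NormedAddCommGroup E] [InnerProductSpace ℂ E]
variable {Es : Type*} [NormedAddCommGroup Es] [InnerProductSpace ℂ Es]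

lemma exists_restrictTo_sub {A : H →ₗ.[ℂ] H} {K : Submodule ℂ H} {z : ℂ} {x f : H} (hx : x ∈ K)
    (hf : f ∈ K) (h : (x, f + z • x) ∈ A.graph) :
    ∃ u : (restrictTo A K).domain, restrictTo A K u - z • (u : K) = ⟨f, hf⟩ := by
  have hg : ((⟨x, hx⟩ : K), (⟨f, hf⟩ : K) + z • (⟨x, hx⟩ : K)) ∈ (restrictTo A K).graph :=
    mem_graph_restrictTo.mpr h
  obtain ⟨u, hu, hAu⟩ := (LinearPMap.mem_graph_iff _).mp hg
  dsimp only at hu hAu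
  exact ⟨u, by rw [hAu, hu, add_sub_cancel_right]⟩

namespace BoundaryPair

variable {σ : ℝ} {A B : H →ₗ.[ℂ] H} {Γ : A.domain →ₗ[ℂ] E} {Γs : B.domain →ₗ[ℂ] Es} {z : ℂ}

/-- A vector of `D(A)` with `Im ⟨A x, x⟩ = 0` is in the kernel of `Γ` and of `Γ_*`. -/
lemma nodeRel_zero_of_im_eq_zero (P : BoundaryPair σ A B Γ Γs) {x y : H} (h : (x, y) ∈ A.graph)
    (him : (inner ℂ x y : ℂ).im = 0) : NodeRel A B Γ Γs 0 x 0 y := by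
  obtain ⟨u, rfl, rfl⟩ := A.mem_graph_iff.mp h
  have hσ : σ ≠ 0 := by rcases P.sign with h | h <;> simp [h]
  have h1 := P.lagA.two_mul_im_inner u
  rw [him, mul_zero, eq_comm, mul_eq_zero, or_iff_right hσ, sq_eq_zero_iff, norm_eq_zero] at h1
  refine ⟨fun w => ?_, fun v => ?_⟩
  · rw [inner_zero_right, P.symm.formal w u, sub_self]
  · rw [P.lagA.lagrange u v, h1, inner_zero_right, mul_zero]

lemma compResolvent_eq_zero_of_nodeRel (P : BoundaryPair σ A B Γ Γs) (hz : σ * z.im < 0) {x w : H}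
    (h : NodeRel A B Γ Γs 0 x 0 (w + z • x)) : compResolvent A Γ z w = 0 := by
  have hg : (x, w + z • x) ∈ A.graph := P.mem_graph_of_forall_inner fun v => by
    rw [← sub_eq_zero, h.1 v, inner_zero_right]
  obtain ⟨u, hu, hAu⟩ := A.mem_graph_iff.mp hg
  dsimp only at hu hAu
  have h1 := P.compA hz u
  rw [hAu, hu, add_sub_cancel_right] at h1
  have h2 := P.lagA.lagrange u u
  have h3 := h.2 u
  rw [← hAu, ← hu, h2, inner_zero_right] at h3
  have hσ : (σ : ℂ) * Complex.I ≠ 0 := by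
    rcases P.sign with h | h <;> simp [h]
  rw [h1]
  exact inner_self_eq_zero.mp ((mul_eq_zero.mp h3).resolve_left hσ)

lemma nodeRel_resolvent (P : BoundaryPair σ A B Γ Γs) (hz : σ * z.im < 0) {w : H}
    (hw : compResolvent A Γ z w = 0) :
    NodeRel A B Γ Γs 0 (resolventOp A z w) 0 (w + z • resolventOp A z w) := by
  obtain ⟨v, hv, hBv⟩ := B.mem_graph_iff.mp (P.mem_graph_of_compResolvent_eq_zero hz hw)
  obtain ⟨u, hu, hAu⟩ := A.mem_graph_iff.mp ((P.resA z hz).mem_graph w)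
  dsimp only at hu hAu hv hBv
  refine ⟨fun w' => ?_, fun u' => ?_⟩
  · rw [← hAu, ← hu, inner_zero_right, P.symm.formal w' u, sub_self]
  · rw [← hBv, ← hv, inner_zero_right, P.formal u' v, sub_self]

lemma mem_graph_of_nodeRel (P : BoundaryPair σ A B Γ Γs) {x y : H}
    (h : NodeRel A B Γ Γs 0 x 0 y) : (x, y) ∈ A.graph :=
  P.mem_graph_of_forall_inner fun v => by rw [← sub_eq_zero, h.1 v, inner_zero_right]

end BoundaryPair

variable [CompleteSpace H] [CompleteSpace E] [CompleteSpace Es]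
variable {A : H →ₗ.[ℂ] H} {Γ : A.domain →ₗ[ℂ] E} {Γs : A.adjoint.domain →ₗ[ℂ] Es} {μ ν z : ℂ}

namespace BoundaryPair

variable (P : BoundaryPair 1 A A.adjoint Γ Γs)
include P

lemma resolventOp_mem_Hsa (hz : z.im < 0) {w : H} (hw : w ∈ (Hcns A Γ Γs)ᗮ) :
    resolventOp A z w ∈ (Hcns A Γ Γs)ᗮ := by
  rw [mem_Hcns_orthogonal_iff P] at hw ⊢
  exact P.isBoundaryFree_resolvent (by simpa using hz) hw

lemma resolventOp_adjoint_mem_Hsa (hz : 0 < z.im) {w : H} (hw : w ∈ (Hcns A Γ Γs)ᗮ) :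
    resolventOp A.adjoint z w ∈ (Hcns A Γ Γs)ᗮ := by
  rw [mem_Hcns_orthogonal_iff P] at hw ⊢
  simpa using (P.symm.isBoundaryFree_resolvent (by simpa using hz) hw.symm).symm

lemma resolventOp_mem_Hcns (hz : z.im < 0) {x : H} (hx : x ∈ Hcns A Γ Γs) :
    resolventOp A z x ∈ Hcns A Γ Γs := by
  rw [← Submodule.orthogonal_orthogonal (Hcns A Γ Γs), Submodule.mem_orthogonal']
  intro w hw
  rw [P.inner_resolventOp (by simpa using hz)]
  exact (Submodule.mem_orthogonal _ _).mp
    (P.resolventOp_adjoint_mem_Hsa (z := starRingEnd ℂ z) (by simpa using hz) hw) x hx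

theorem isReducingFor_Hcns : IsReducingFor A (Hcns A Γ Γs) :=
  (P.resA (-Complex.I) (by simp)).isReducingFor
    (fun _ hx => P.resolventOp_mem_Hcns (by simp) hx)
    (fun _ hx => P.resolventOp_mem_Hsa (by simp) hx)

/-- On `H_sa` the boundary operators vanish. -/
lemma nodeRel_of_mem_Hsa {x y : H} (hx : x ∈ (Hcns A Γ Γs)ᗮ) (h : (x, y) ∈ A.graph) :
    NodeRel A A.adjoint Γ Γs 0 x 0 y := by
  have hi : (1 : ℝ) * (-Complex.I).im < 0 := by simp
  have hy : y ∈ (Hcns A Γ Γs)ᗮ := by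
    obtain ⟨u, rfl, rfl⟩ := A.mem_graph_iff.mp h
    obtain ⟨hp, hAp⟩ := P.isReducingFor_Hcns.2 u
    have hu := Submodule.starProjection_eq_self_iff.mpr hx
    have e : (⟨_, hp⟩ : A.domain) = u := Subtype.ext hu
    rwa [e] at hAp
  set f := y - (-Complex.I) • x with hf
  have hfm : f ∈ (Hcns A Γ Γs)ᗮ := Submodule.sub_mem _ hy (Submodule.smul_mem _ _ hx)
  have hR : resolventOp A (-Complex.I) f = x := (P.resA _ hi).eq_of_graph h
  have := P.nodeRel_resolvent hi (((mem_Hcns_orthogonal_iff P).mp hfm).1 _ hi)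
  rwa [hR, hf, sub_add_cancel] at this

theorem isSelfAdjoint_Hsa : IsSelfAdjoint (restrictTo A (Hcns A Γ Γs)ᗮ) := by
  refine isSelfAdjoint_of_symmetric (z := -Complex.I) (fun u v => ?_) (by simp) (fun f => ?_)
    fun f => ?_
  · have h1 := P.nodeRel_of_mem_Hsa (u : (Hcns A Γ Γs)ᗮ).2 (restrictTo_apply_mem_graph u)
    have h2 := P.nodeRel_of_mem_Hsa (v : (Hcns A Γ Γs)ᗮ).2 (restrictTo_apply_mem_graph v)
    have h3 := P.green h2 h1
    rw [inner_zero_left, inner_zero_left, sub_self, mul_zero, sub_eq_zero] at h3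
    exact h3.symm
  · exact exists_restrictTo_sub (P.resolventOp_mem_Hsa (by simp) f.2) f.2
      ((P.resA (-Complex.I) (by simp)).mem_graph f)
  · refine exists_restrictTo_sub (P.resolventOp_adjoint_mem_Hsa
      (z := starRingEnd ℂ (-Complex.I)) (by simp) f.2) f.2 ?_
    have hz : -(1 : ℝ) * (starRingEnd ℂ (-Complex.I)).im < 0 := by simp
    exact P.mem_graph_of_nodeRel (P.symm.nodeRel_resolvent hz
      (((mem_Hcns_orthogonal_iff P).mp f.2).2 _ (by linarith))).symm

lemma mem_Hsa_of_forall_nodeRel {w : H}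
    (h : ∀ z : ℂ, z.im ≠ 0 → ∃ y : H, NodeRel A A.adjoint Γ Γs 0 y 0 (w + z • y)) :
    w ∈ (Hcns A Γ Γs)ᗮ := by
  rw [mem_Hcns_orthogonal_iff P]
  refine ⟨fun z hz => ?_, fun z hz => ?_⟩
  · obtain ⟨y, hy⟩ := h z (by rintro h; simp [h] at hz)
    exact P.compResolvent_eq_zero_of_nodeRel hz hy
  · obtain ⟨y, hy⟩ := h z (by rintro h; simp [h] at hz)
    exact P.symm.compResolvent_eq_zero_of_nodeRel (by linarith) hy.symm

theorem isMaximalDissipative_Hcns (hA : IsMaximalDissipative A) :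
    IsMaximalDissipative (restrictTo A (Hcns A Γ Γs)) := by
  refine IsDissipative.isMaximalDissipative (z := -Complex.I) ⟨?_, fun u => ?_⟩ (by simp)
    fun f => ?_
  · have hd := (Function.Surjective.denseRange fun x : Hcns A Γ Γs => ⟨(x : H),
      Submodule.orthogonalProjectionOnto_mem_subspace_eq_self x⟩).dense_image
      (ContinuousLinearMap.continuous _) hA.1.1
    refine hd.mono ?_
    rintro _ ⟨u, hu, rfl⟩
    exact P.isReducingFor_Hcns.1 ⟨u, hu⟩
  · obtain ⟨x, hx, hAx⟩ := A.mem_graph_iff.mp (restrictTo_apply_mem_graph u)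
    have := hA.1.2 x
    rwa [hx, hAx] at this
  · exact exists_restrictTo_sub (P.resolventOp_mem_Hcns (by simp) f.2) f.2
      ((P.resA (-Complex.I) (by simp)).mem_graph f)

/-- A subspace on which `A` acts as a selfadjoint operator consists of vectors without boundary
values, so it is contained in `H_sa`. -/
theorem isCompletelyNonSelfadjoint_Hcns (hA : IsMaximalDissipative A) :
    IsCompletelyNonSelfadjoint (restrictTo A (Hcns A Γ Γs)) := by
  refine ⟨P.isMaximalDissipative_Hcns hA, fun K _ _ hT => ?_⟩
  have hsym := im_inner_eq_zero_of_symmetric hT.inner_apply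
  rw [Submodule.eq_bot_iff]
  intro x hx
  have key : ∀ z : ℂ, z.im ≠ 0 → ∃ y : H, NodeRel A A.adjoint Γ Γs 0 y 0 ((x : H) + z • y) := by
    intro z hz
    have hg := (hT.isResolventAt hz).mem_graph ⟨x, hx⟩
    obtain ⟨v, hv, hTv⟩ := (LinearPMap.mem_graph_iff _).mp hg
    have him := hsym v
    rw [hv, hTv] at him
    have hg₁ := mem_graph_restrictTo.mp hg
    have hg₂ := mem_graph_restrictTo.mp hg₁
    exact ⟨_, P.nodeRel_zero_of_im_eq_zero hg₂ him⟩
  have hsa : (x : H) ∈ (Hcns A Γ Γs)ᗮ := P.mem_Hsa_of_forall_nodeRel key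
  exact Subtype.ext (inner_self_eq_zero.mp ((Submodule.mem_orthogonal _ _).mp hsa x x.2))

end BoundaryPair

end Decomposition

/-! ### The dilation along the decomposition, and minimality -/

section Minimality

variable {F : Type*} [NormedAddCommGroup F] [InnerProductSpace ℂ F] [CompleteSpace F]

/-- Integration by parts against an exponential. -/
lemma HasDerivTrace.inner_expo_eq {v w : L2On (Ioi 0) F} (h : HasDerivTrace (Ioi 0) v w 0) {s : ℝ}
    (hs : 0 < (s : ℂ).re) (d : F) :
    inner ℂ (expo hs d) w = (s : ℂ) * inner ℂ (expo hs d) v := by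
  have h1 := (hasDerivTrace_expo hs d).inner_add_inner h
  rw [inner_zero_right, neg_zero, inner_smul_left, map_neg, Complex.conj_ofReal] at h1
  linear_combination h1

variable {H : Type*} [NormedAddCommGroup H] [InnerProductSpace ℂ H] [CompleteSpace H]
variable {E : Type*} [NormedAddCommGroup E] [InnerProductSpace ℂ E] [CompleteSpace E]
variable {Es : Type*} [NormedAddCommGroup Es] [InnerProductSpace ℂ Es] [CompleteSpace Es]
variable {A : H →ₗ.[ℂ] H} {Γ : A.domain →ₗ[ℂ] E} {Γs : A.adjoint.domain →ₗ[ℂ] Es} {μ ν z : ℂ}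

lemma column_mem_sumSubspace {Q : Submodule ℂ H} {w : H} (hw : w ∈ Q) :
    (column 0 w 0 : DilationSpace H E Es) ∈ sumSubspace ⊥ Q ⊥ :=
  ⟨Submodule.zero_mem _, hw, Submodule.zero_mem _⟩

lemma eq_column_of_mem_sumSubspace {Q : Submodule ℂ H} {U : DilationSpace H E Es}
    (hU : U ∈ sumSubspace ⊥ Q ⊥) : U = column 0 (compMid U) 0 :=
  column_congr ((Submodule.mem_bot ℂ).mp hU.1) rfl ((Submodule.mem_bot ℂ).mp hU.2.2)

lemma inner_column_mid (w : H) (U : DilationSpace H E Es) :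
    inner ℂ (column 0 w 0) U = inner ℂ w (compMid U) := by
  rw [inner_dilationSpace]
  change inner ℂ (0 : L2On (Iio 0) Es) _ + (inner ℂ w _ + inner ℂ (0 : L2On (Ioi 0) E) _) = _
  rw [inner_zero_left, inner_zero_left, zero_add, add_zero]

lemma sumSubspace_orthogonal (Q : Submodule ℂ H) :
    (sumSubspace ⊥ Q ⊥ : Submodule ℂ (DilationSpace H E Es))ᗮ = sumSubspace ⊤ Qᗮ ⊤ := by
  ext U
  rw [Submodule.mem_orthogonal]
  constructor
  · intro h
    refine ⟨Submodule.mem_top, (Submodule.mem_orthogonal _ _).mpr fun w hw => ?_,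
      Submodule.mem_top⟩
    rw [← inner_column_mid, h _ (column_mem_sumSubspace hw)]
  · intro h V hV
    rw [eq_column_of_mem_sumSubspace hV, inner_column_mid]
    exact (Submodule.mem_orthogonal _ _).mp h.2.1 _ hV.2.1

lemma sumSubspace_orthogonal_orthogonal (Q : Submodule ℂ H) [Q.HasOrthogonalProjection] :
    (sumSubspace ⊥ Qᗮ ⊥ : Submodule ℂ (DilationSpace H E Es))ᗮ = sumSubspace ⊤ Q ⊤ := by
  rw [sumSubspace_orthogonal, Submodule.orthogonal_orthogonal]

lemma mem_iSup_orthogonal_iff {ι : Type*} {S : Set ι} {K : ι → Submodule ℂ H} {x : H} :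
    x ∈ (⨆ i ∈ S, K i)ᗮ ↔ ∀ i ∈ S, ∀ y ∈ K i, inner ℂ y x = 0 := by
  rw [Submodule.mem_orthogonal]
  refine ⟨fun h i hi y hy => h y ((le_iSup₂ (f := fun i (_ : i ∈ S) => K i) i hi) hy),
    fun h y hy => ?_⟩
  have hle : (⨆ i ∈ S, K i) ≤ (ℂ ∙ x)ᗮ := iSup₂_le fun i hi y hy => by
    rw [Submodule.mem_orthogonal_singleton_iff_inner_left]
    exact h i hi y hy
  exact Submodule.mem_orthogonal_singleton_iff_inner_left.mp (hle hy)

/-- The dilation property in weak form. -/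
lemma isSelfadjointDilation_of_inner {𝓚 : Type*} [NormedAddCommGroup 𝓚] [InnerProductSpace ℂ 𝓚]
    [CompleteSpace 𝓚] {B : H →ₗ.[ℂ] H} {L : 𝓚 →ₗ.[ℂ] 𝓚} {J : H →ₗᵢ[ℂ] 𝓚} (hL : IsSelfAdjoint L)
    (h : ∀ z : ℂ, z.im < 0 → ∃ R, IsResolventAt B z R ∧
      ∀ x y, inner ℂ (J y) (resolventOp L z (J x)) = inner ℂ y (R x)) :
    IsSelfadjointDilation B L J := by
  refine ⟨hL, fun z hz => ?_⟩
  obtain ⟨R, hR, hi⟩ := h z hz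
  convert hR using 1
  ext x
  refine ext_inner_left ℂ fun y => ?_
  rw [← hi, ContinuousLinearMap.comp_apply, ContinuousLinearMap.adjoint_inner_right]
  rfl

lemma eq_column_of_orthogonal {U : DilationSpace H E Es}
    (h : ∀ V ∈ (sumSubspace ⊤ ⊥ ⊤ : Submodule ℂ (DilationSpace H E Es)), inner ℂ V U = 0) :
    U = column 0 (compMid U) 0 := by
  have h1 := h (column (compNeg U) 0 (compPos U))
    ⟨Submodule.mem_top, Submodule.zero_mem _, Submodule.mem_top⟩
  rw [inner_dilationSpace] at h1
  change inner ℂ (compNeg U) (compNeg U) + (inner ℂ (0 : H) _ +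
    inner ℂ (compPos U) (compPos U)) = 0 at h1
  rw [inner_zero_left, zero_add] at h1
  have e1 : (inner ℂ (compNeg U) (compNeg U) : ℂ).re = _ := inner_self_eq_norm_sq (𝕜 := ℂ) _
  have e2 : (inner ℂ (compPos U) (compPos U) : ℂ).re = _ := inner_self_eq_norm_sq (𝕜 := ℂ) _
  have h2 : ‖compNeg U‖ ^ 2 + ‖compPos U‖ ^ 2 = 0 := by
    rw [← e1, ← e2, ← Complex.add_re, h1, Complex.zero_re]
  have h3 : ‖compNeg U‖ ^ 2 = 0 := by nlinarith [sq_nonneg ‖compNeg U‖, sq_nonneg ‖compPos U‖]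
  have h4 : ‖compPos U‖ ^ 2 = 0 := by nlinarith [sq_nonneg ‖compNeg U‖, sq_nonneg ‖compPos U‖]
  exact column_congr (norm_eq_zero.mp (sq_eq_zero_iff.mp h3)) rfl
    (norm_eq_zero.mp (sq_eq_zero_iff.mp h4))

lemma inner_of_mem_top_bot_top {V : DilationSpace H E Es}
    (hV : V ∈ (sumSubspace ⊤ ⊥ ⊤ : Submodule ℂ (DilationSpace H E Es))) (w : H) :
    inner ℂ V (column 0 w 0) = 0 := by
  rw [← inner_conj_symm, inner_column_mid, (Submodule.mem_bot ℂ).mp hV.2.1, inner_zero_right,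
    map_zero]

namespace BoundaryPair

variable (P : BoundaryPair 1 A A.adjoint Γ Γs) (hμ : μ.im < 0) (hν : 0 < ν.im)
include P

lemma exists_nodeRel_of_mem_Hsa (hz : z.im ≠ 0) {w : H} (hw : w ∈ (Hcns A Γ Γs)ᗮ) :
    ∃ y ∈ (Hcns A Γ Γs)ᗮ, NodeRel A A.adjoint Γ Γs 0 y 0 (w + z • y) := by
  have hw' := (mem_Hcns_orthogonal_iff P).mp hw
  rcases lt_or_gt_of_ne hz with h | h
  · have hz' : (1 : ℝ) * z.im < 0 := by simpa using h
    exact ⟨_, P.resolventOp_mem_Hsa h hw, P.nodeRel_resolvent hz' (hw'.1 z hz')⟩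
  · have hz' : (0 : ℝ) < 1 * z.im := by simpa using h
    exact ⟨_, P.resolventOp_adjoint_mem_Hsa h hw,
      (P.symm.nodeRel_resolvent (by linarith) (hw'.2 z hz')).symm⟩

include hμ hν

lemma resolventOp_dilation_mem_Hsa (hz : z.im ≠ 0) {U : DilationSpace H E Es}
    (hU : U ∈ sumSubspace ⊥ (Hcns A Γ Γs)ᗮ ⊥) :
    resolventOp (dilation A Γ Γs μ ν) z U ∈ sumSubspace ⊥ (Hcns A Γ Γs)ᗮ ⊥ := by
  obtain ⟨y, hy, hN⟩ := P.exists_nodeRel_of_mem_Hsa hz hU.2.1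
  have hg : (column 0 y 0, U + z • column 0 y 0) ∈ (dilation A Γ Γs μ ν).graph := by
    refine (P.mem_graph_dilation_column_iff hμ hν).mpr ⟨hN, ?_⟩
    refine column_congr ?_ rfl ?_
    · change compNeg U + z • (0 : L2On (Iio 0) Es) = 0
      rw [(Submodule.mem_bot ℂ).mp hU.1, smul_zero, add_zero]
    · change compPos U + z • (0 : L2On (Ioi 0) E) = 0
      rw [(Submodule.mem_bot ℂ).mp hU.2.2, smul_zero, add_zero]
  have := ((P.isSelfAdjoint_dilation hμ hν).isResolventAt hz).eq_of_graph hg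
  rw [add_sub_cancel_right] at this
  rw [this]
  exact column_mem_sumSubspace hy

lemma inner_resolventOp_dilation (hz : z.im ≠ 0) (U V : DilationSpace H E Es) :
    inner ℂ (resolventOp (dilation A Γ Γs μ ν) z U) V =
      inner ℂ U (resolventOp (dilation A Γ Γs μ ν) (starRingEnd ℂ z) V) := by
  rw [← (P.isSelfAdjoint_dilation hμ hν).adjoint_resolventOp hz,
    ContinuousLinearMap.adjoint_inner_right]

lemma resolventOp_dilation_mem_orthogonal (hz : z.im ≠ 0) {U : DilationSpace H E Es}
    (hU : U ∈ (sumSubspace ⊥ (Hcns A Γ Γs)ᗮ ⊥)ᗮ) :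
    resolventOp (dilation A Γ Γs μ ν) z U ∈ (sumSubspace ⊥ (Hcns A Γ Γs)ᗮ ⊥)ᗮ := by
  rw [Submodule.mem_orthogonal'] at hU ⊢
  intro V hV
  rw [P.inner_resolventOp_dilation hμ hν hz]
  exact hU _ (P.resolventOp_dilation_mem_Hsa hμ hν (by simpa using hz) hV)

theorem isReducingFor_dilation :
    IsReducingFor (dilation A Γ Γs μ ν) (sumSubspace ⊥ (Hcns A Γ Γs)ᗮ ⊥) := by
  have hz : (-Complex.I).im ≠ 0 := by simp
  exact ((P.isSelfAdjoint_dilation hμ hν).isResolventAt hz).isReducingFor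
    (fun _ hU => P.resolventOp_dilation_mem_Hsa hμ hν hz hU)
    (fun _ hU => P.resolventOp_dilation_mem_orthogonal hμ hν hz hU)

theorem column_mem_domain_dilation_iff {w : H} (hw : w ∈ (Hcns A Γ Γs)ᗮ) :
    column 0 w 0 ∈ (dilation A Γ Γs μ ν).domain ↔ w ∈ A.domain := by
  constructor
  · intro h
    have h1 := (dilation A Γ Γs μ ν).mem_graph ⟨_, h⟩
    have h2 := ((P.mem_graph_dilation_column_iff hμ hν).mp h1).1
    exact LinearPMap.mem_domain_of_mem_graph (P.mem_graph_of_nodeRel h2)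
  · intro h
    have h1 := P.nodeRel_of_mem_Hsa hw (A.mem_graph ⟨w, h⟩)
    exact LinearPMap.mem_domain_of_mem_graph
      ((P.mem_graph_dilation_column_iff hμ hν (F := column 0 (A ⟨w, h⟩) 0)).mpr ⟨h1, rfl⟩)

theorem dilation_apply_column {w : H} (hL : column 0 w 0 ∈ (dilation A Γ Γs μ ν).domain)
    (hw : w ∈ A.domain) : dilation A Γ Γs μ ν ⟨column 0 w 0, hL⟩ = column 0 (A ⟨w, hw⟩) 0 := by
  obtain ⟨hN, hF⟩ := (P.mem_graph_dilation_column_iff hμ hν).mp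
    ((dilation A Γ Γs μ ν).mem_graph ⟨_, hL⟩)
  rw [hF]
  exact column_congr rfl
    (A.mem_graph_snd_inj (P.mem_graph_of_nodeRel hN) (A.mem_graph ⟨w, hw⟩) rfl) rfl

/-- A vector is orthogonal to the resolvents of the dilation on the channels if and only if its
images under all resolvents have the form `(0, u, 0)`, that is, if it belongs to `H_sa`. -/
theorem orthogonal_iSup_resolventOp :
    (⨆ z ∈ {z : ℂ | z.im ≠ 0},
      (sumSubspace ⊤ ⊥ ⊤ : Submodule ℂ (DilationSpace H E Es)).map
        (resolventOp (dilation A Γ Γs μ ν) z).toLinearMap)ᗮ =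
      sumSubspace ⊥ (Hcns A Γ Γs)ᗮ ⊥ := by
  have hL := P.isSelfAdjoint_dilation hμ hν
  ext U
  rw [mem_iSup_orthogonal_iff]
  constructor
  · intro h
    have h1 : ∀ z : ℂ, z.im ≠ 0 → ∃ y : H,
        NodeRel A A.adjoint Γ Γs 0 y 0 (compMid U + z • y) ∧
          U + z • column 0 y 0 = column 0 (compMid U + z • y) 0 := by
      intro z hz
      have hz' : (starRingEnd ℂ z).im ≠ 0 := by simpa using hz
      have h2 := eq_column_of_orthogonal
        (U := resolventOp (dilation A Γ Γs μ ν) z U) fun V hV => by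
          have := h (starRingEnd ℂ z) hz' _ (Submodule.mem_map_of_mem hV)
          rw [← Complex.conj_conj z, ← P.inner_resolventOp_dilation hμ hν hz']
          exact this
      have h3 := (hL.isResolventAt hz).mem_graph U
      rw [h2] at h3
      exact ⟨_, (P.mem_graph_dilation_column_iff hμ hν).mp h3⟩
    have h4 : compNeg U = 0 ∧ compPos U = 0 := by
      obtain ⟨y, -, h⟩ := h1 Complex.I (by simp)
      have e1 := congrArg compNeg h
      have e2 := congrArg compPos h
      change compNeg U + Complex.I • (0 : L2On (Iio 0) Es) = 0 at e1
      change compPos U + Complex.I • (0 : L2On (Ioi 0) E) = 0 at e2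
      rw [smul_zero, add_zero] at e1 e2
      exact ⟨e1, e2⟩
    exact ⟨(Submodule.mem_bot ℂ).mpr h4.1,
      P.mem_Hsa_of_forall_nodeRel fun z hz => (h1 z hz).imp fun _ h => h.1,
      (Submodule.mem_bot ℂ).mpr h4.2⟩
  · rintro hU z hz _ ⟨V, hV, rfl⟩
    have hz' : (starRingEnd ℂ z).im ≠ 0 := by simpa using hz
    have h1 := P.resolventOp_dilation_mem_Hsa hμ hν hz' hU
    refine (P.inner_resolventOp_dilation hμ hν hz V U).trans ?_
    rw [eq_column_of_mem_sumSubspace h1]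
    exact inner_of_mem_top_bot_top hV _

lemma resolventOp_dilation_mem_Hcns (hz : z.im ≠ 0) {U : DilationSpace H E Es}
    (hU : U ∈ sumSubspace ⊤ (Hcns A Γ Γs) ⊤) :
    resolventOp (dilation A Γ Γs μ ν) z U ∈ sumSubspace ⊤ (Hcns A Γ Γs) ⊤ := by
  rw [← sumSubspace_orthogonal_orthogonal] at hU ⊢
  exact P.resolventOp_dilation_mem_orthogonal hμ hν hz hU

theorem isSelfadjointDilation_Hcns :
    IsSelfadjointDilation
      (𝓚 := (sumSubspace ⊤ (Hcns A Γ Γs) ⊤ : Submodule ℂ (DilationSpace H E Es)))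
      (restrictTo A (Hcns A Γ Γs))
      (restrictTo (dilation A Γ Γs μ ν) (sumSubspace ⊤ (Hcns A Γ Γs) ⊤))
      (embedMid (Hcns A Γ Γs)) := by
  have hL := P.isSelfAdjoint_dilation hμ hν
  refine isSelfadjointDilation_of_inner (hL.restrictTo (z := Complex.I) (by simp)
    (fun U hU => P.resolventOp_dilation_mem_Hcns hμ hν (by simp) hU)
    (fun U hU => P.resolventOp_dilation_mem_Hcns hμ hν (by simp) hU)) fun z hz => ?_
  refine ⟨_, (P.resA z (by simpa using hz)).restrictTo
    (fun x hx => P.resolventOp_mem_Hcns (A := A) hz hx), fun x y => ?_⟩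
  rw [((hL.isResolventAt hz.ne).restrictTo
    (fun U hU => P.resolventOp_dilation_mem_Hcns hμ hν hz.ne hU)).resolventOp_eq]
  refine (inner_column_mid (y : H) _).trans ?_
  exact congrArg (inner ℂ (y : H)) (P.compMid_resolventOp hμ hν hz (x : H))

/-- If all `(𝓛 - z)⁻¹ (v₋, 0, v₊)` have zero middle component, their boundary values vanish, so
`v₋` and `v₊` are orthogonal to the exponentials. -/
lemma eq_zero_of_compMid_resolventOp {U : DilationSpace H E Es} (hU : compMid U = 0)
    (h : ∀ z : ℂ, z.im ≠ 0 → compMid (resolventOp (dilation A Γ Γs μ ν) z U) = 0) : U = 0 := by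
  have key : ∀ z : ℂ, z.im ≠ 0 → ∃ vm wm vp wp,
      HasDerivTrace (Iio 0) vm wm (0 : Es) ∧ HasDerivTrace (Ioi 0) vp wp (0 : E) ∧
      compNeg U = Complex.I • wm - z • vm ∧ compPos U = Complex.I • wp - z • vp := by
    intro z hz
    obtain ⟨wm, em, wp, ep, hm, hp, hN, hFm, hFp⟩ := (P.mem_graph_dilation_iff hμ hν).mp
      (((P.isSelfAdjoint_dilation hμ hν).isResolventAt hz).mem_graph U)
    have hmid : compMid (U + z • resolventOp (dilation A Γ Γs μ ν) z U) = 0 := by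
      change compMid U + z • compMid (resolventOp (dilation A Γ Γs μ ν) z U) = 0
      rw [hU, h z hz, smul_zero, add_zero]
    rw [hmid, h z hz] at hN
    have hN0 : NodeRel A A.adjoint Γ Γs 0 0 0 0 :=
      ⟨fun w => by simp, fun v => by simp⟩
    obtain ⟨rfl, rfl⟩ := P.eq_of_nodeRel hN hN0
    exact ⟨_, wm, _, wp, hm, hp, eq_sub_of_add_eq hFm, eq_sub_of_add_eq hFp⟩
  refine column_congr (vm' := 0) (u' := 0) (vp' := 0) ?_ hU ?_
  · refine (reflect measurePreserving_neg_Ioi).injective ?_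
    rw [map_zero]
    refine eq_zero_of_forall_inner_expo 0 fun s hs hs' d => ?_
    -- reflected to `ℝ⁺`, the derivative changes sign, whence `z = -is`
    obtain ⟨vm, wm, vp, wp, hm, -, hUm, -⟩ := key (-Complex.I * s) (by simpa using hs'.ne')
    have h1 := (hm.reflect measurePreserving_neg_Ioi).inner_expo_eq hs d
    rw [inner_neg_right] at h1
    change inner ℂ _ (reflect measurePreserving_neg_Ioi (compNeg U)) = 0
    rw [hUm, map_sub, map_smul, map_smul, inner_sub_right, inner_smul_right, inner_smul_right]
    linear_combination -Complex.I * h1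
  · refine eq_zero_of_forall_inner_expo 0 fun s hs hs' d => ?_
    -- the pairing of `v₊` with `e^{-st} d` is `i s - z` times that of the resolvent component
    obtain ⟨vm, wm, vp, wp, -, hp, -, hUp⟩ := key (Complex.I * s) (by simpa using hs'.ne')
    have h1 := hp.inner_expo_eq hs d
    change inner ℂ _ (compPos U) = 0
    rw [hUp, inner_sub_right, inner_smul_right, inner_smul_right]
    linear_combination Complex.I * h1

theorem isMinimalSelfadjointDilation_Hcns :
    IsMinimalSelfadjointDilation
      (𝓚 := (sumSubspace ⊤ (Hcns A Γ Γs) ⊤ : Submodule ℂ (DilationSpace H E Es)))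
      (restrictTo A (Hcns A Γ Γs))
      (restrictTo (dilation A Γ Γs μ ν) (sumSubspace ⊤ (Hcns A Γ Γs) ⊤))
      (embedMid (Hcns A Γ Γs)) := by
  refine ⟨P.isSelfadjointDilation_Hcns hμ hν, fun K _ hK hred _ => ?_⟩
  have hL := P.isSelfAdjoint_dilation hμ hν
  -- vectors orthogonal to `K` are orthogonal to `H_cns` and have middle component in `H_cns`
  have hmid : ∀ V ∈ Kᗮ, compMid (V : DilationSpace H E Es) = 0 := by
    intro V hV
    have h1 := (Submodule.mem_orthogonal _ _).mp hV _ (hK ⟨_, V.2.2.1⟩)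
    have h2 := (inner_column_mid (compMid (V : DilationSpace H E Es))
      (V : DilationSpace H E Es)).symm.trans h1
    exact inner_self_eq_zero.mp h2
  rw [← Submodule.orthogonal_eq_bot_iff, Submodule.eq_bot_iff]
  intro U hU
  refine Subtype.ext (P.eq_zero_of_compMid_resolventOp hμ hν (hmid U hU) fun z hz => ?_)
  have h2 := (hL.isResolventAt hz).restrictTo
    (fun U hU => P.resolventOp_dilation_mem_Hcns hμ hν hz hU)
  exact hmid _ (hred.orthogonal.resolvent_mem h2 hU)

end BoundaryPair

end Minimality

end DissipativeDilation

theorem mainTheorem2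
    {H : Type*} [NormedAddCommGroup H] [InnerProductSpace ℂ H] [CompleteSpace H]
    {E : Type*} [NormedAddCommGroup E] [InnerProductSpace ℂ E] [CompleteSpace E]
    {Es : Type*} [NormedAddCommGroup Es] [InnerProductSpace ℂ Es] [CompleteSpace Es]
    (A : H →ₗ.[ℂ] H) (hA : IsMaximalDissipative A)
    (Γ : A.domain →ₗ[ℂ] E) (hΓ : IsLagrangeMap A Γ Complex.I)
    (Γs : A.adjoint.domain →ₗ[ℂ] Es) (hΓs : IsLagrangeMap A.adjoint Γs (-Complex.I))
    (μ ν : ℂ) (hμ : μ.im < 0) (hν : 0 < ν.im) :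
    -- `H_cns` reduces `A`
    IsReducingFor A (Hcns A Γ Γs) ∧
    -- `A_sa` is selfadjoint
    IsSelfAdjoint (restrictTo A (Hcns A Γ Γs)ᗮ) ∧
    -- `A_cns` is completely non-selfadjoint
    IsCompletelyNonSelfadjoint (restrictTo A (Hcns A Γ Γs)) ∧
    -- `0 ⊕ H_sa ⊕ 0` reduces the dilation, which acts there as `A_sa`
    (IsReducingFor (dilation A Γ Γs μ ν) (sumSubspace ⊥ (Hcns A Γ Γs)ᗮ ⊥) ∧
      ∀ w ∈ (Hcns A Γ Γs)ᗮ,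
        (column 0 w 0 ∈ (dilation A Γ Γs μ ν).domain ↔ w ∈ A.domain) ∧
        ∀ (hL : column 0 w 0 ∈ (dilation A Γ Γs μ ν).domain) (hw : w ∈ A.domain),
          dilation A Γ Γs μ ν ⟨column 0 w 0, hL⟩ = column 0 (A ⟨w, hw⟩) 0) ∧
    -- the closed span of the resolvents of the dilation on the channels
    ((⨆ z ∈ {z : ℂ | z.im ≠ 0},
        (sumSubspace ⊤ ⊥ ⊤ : Submodule ℂ (DilationSpace H E Es)).map
          (resolventOp (dilation A Γ Γs μ ν) z).toLinearMap).topologicalClosure =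
        (sumSubspace ⊥ (Hcns A Γ Γs)ᗮ ⊥)ᗮ ∧
      (sumSubspace ⊥ (Hcns A Γ Γs)ᗮ ⊥ : Submodule ℂ (DilationSpace H E Es))ᗮ =
        sumSubspace ⊤ (Hcns A Γ Γs) ⊤) ∧
    -- the dilation restricted to `L² ⊕ H_cns ⊕ L²` is a minimal selfadjoint dilation of `A_cns`
    IsMinimalSelfadjointDilation
      (𝓚 := (sumSubspace ⊤ (Hcns A Γ Γs) ⊤ : Submodule ℂ (DilationSpace H E Es)))
      (restrictTo A (Hcns A Γ Γs))
      (restrictTo (dilation A Γ Γs μ ν) (sumSubspace ⊤ (Hcns A Γ Γs) ⊤))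
      (embedMid (Hcns A Γ Γs)) := by
  have P := hA.boundaryPair hΓ hΓs
  exact ⟨P.isReducingFor_Hcns, P.isSelfAdjoint_Hsa, P.isCompletelyNonSelfadjoint_Hcns hA,
    ⟨P.isReducingFor_dilation hμ hν, fun w hw => ⟨P.column_mem_domain_dilation_iff hμ hν hw,
      fun hL hwA => P.dilation_apply_column hμ hν hL hwA⟩⟩,
    ⟨by rw [← P.orthogonal_iSup_resolventOp hμ hν,
      Submodule.orthogonal_orthogonal_eq_closure], sumSubspace_orthogonal_orthogonal _⟩,
    P.isMinimalSelfadjointDilation_Hcns hμ hν⟩
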